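/- Let $d\ge 1$. Let $\rho:\mathbb R^d\to[0,+\infty)$ be integrable and not almost everywhere zero, and put $\rho_\varepsilon(x)=\varepsilon^{-d}\rho(x/\varepsilon)$ for $\varepsilon>0$. Let $f\in C^2([0,+\infty))$ be strongly convex, that is, $t\mapsto f(t)-\frac{\alpha}{2}t^2$ is convex on $[0,+\infty)$ for some $\alpha>0$, with $f(0)=f'(0)=0$. Write $\hat z=z/|z|$. For $u\in H^1_{\mathrm{loc}}(\mathbb R^d)$ set $$\mathcal F_\varepsilon(u)=\int_{\mathbb R^d}\int_{\mathbb R^d}\rho_\varepsilon(y-x)\,f\!\left(\frac{|u(y)-u(x)|}{|y-x|}\right)dy\,dx,\qquad \mathcal F_0(u)=\int_{\mathbb R^d}\int_{\mathbb R^d}\rho(z)\,f(|\nabla u(x)\cdot\hat z|)\,dz\,dx ,$$ and let $\mathcal D=\{u\in H^1_{\mathrm{loc}}(\mathbb R^d):\mathcal F_0(u)<+\infty\}$. For $u\in\mathcal D$ define the rate functionals $$\mathcal E_\varepsilon(u)=\frac{\mathcal F_0(u)-\mathcal F_\varepsilon(u)}{\varepsilon^2}$$ and $$\mathcal E_0(u)=\frac1{24}\int_{\mathbb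 R^d}\int_{\mathbb R^d}\rho(z)|z|^2 f''(|\nabla u(x)\cdot\hat z|)\,|\nabla^2u(x)\hat z\cdot\hat z|^2\,dz\,dx$$ if $u\in H^2_{\mathrm{loc}}(\mathbb R^d)$, $\mathcal E_0(u)=+\infty$ otherwise. Then the following hold. (1) If $\varepsilon_n\to0^+$, $u_n,u\in\mathcal D$ and $u_n\to u$ in $H^1_{\mathrm{loc}}(\mathbb R^d)$, then $\mathcal E_0(u)\le\liminf_{n}\mathcal E_{\varepsilon_n}(u_n)$. (2) Let $Y\subseteq\mathcal D$, and suppose that $f''$ is bounded on $[0,+\infty)$, or else that $\nabla u\in L^\infty(\mathbb R^d;\mathbb R^d)$ for every $u\in Y$. Then, as $\varepsilon\to0^+$, the functionals $\mathcal E_\varepsilon$ restricted to $Y$ $\Gamma$-converge to $\mathcal E_0$ with respect to $H^1_{\mathrm{loc}}(\mathbb R^d)$ convergence; that is, (1) holds with $Y$ in place of $\mathcal D$, and for every $u\in Y$ and every sequence $\varepsilon_n\to0^+$ there are $u_n\in Y$ with $u_n\to u$ in $H^1_{\mathrm{loc}}(\mathbb R^d)$ and $\limsup_n\mathcal E_{\varepsilon_n}(u_n)\le\mathcal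 E_0(u)$. In particular, if $f''$ is bounded, $\mathcal E_\varepsilon$ $\Gamma$-converges to $\mathcal E_0$ on all of $\mathcal D$, and also on $\{u\in\mathcal D:\nabla u=0\text{ a.e. outside }\Omega\}$ for every measurable set $\Omega\subseteq\mathbb R^d$. -/

import Mathlib

open MeasureTheory Filter Topology Set
open scoped ENNReal ContDiff

/-- `ℝ^d` with its Euclidean structure. -/
abbrev Rd (d : ℕ) : Type := EuclideanSpace ℝ (Fin d)

noncomputable section

/-- `u'` is a weak (distributional) derivative of `u` on the whole space. -/
def IsWeakFDeriv {d : ℕ} {F : Type*} [NormedAddCommGroup F] [NormedSpace ℝ F]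
    (u : Rd d → F) (u' : Rd d → (Rd d →L[ℝ] F)) : Prop :=
  LocallyIntegrable u ∧ LocallyIntegrable u' ∧
    ∀ φ : Rd d → ℝ, ContDiff ℝ ∞ φ → HasCompactSupport φ → ∀ v : Rd d,
      ∫ x, (fderiv ℝ φ x v) • u x = - ∫ x, φ x • u' x v

open Classical in
/-- A weak derivative of `u` (it is unique up to null sets), and `0` if there is none. -/
def weakFDeriv {d : ℕ} {F : Type*} [NormedAddCommGroup F] [NormedSpace ℝ F]
    (u : Rd d → F) : Rd d → (Rd d →L[ℝ] F) :=
  if h : ∃ u', IsWeakFDeriv u u' then h.choose else 0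

/-- `u ∈ L²_loc(ℝ^d; F)`. -/
def MemL2loc {d : ℕ} {F : Type*} [NormedAddCommGroup F] (u : Rd d → F) : Prop :=
  ∀ R : ℝ, MemLp u 2 (volume.restrict (Metric.ball 0 R))

/-- `u ∈ H¹_loc(ℝ^d; F)`: `u` and its weak derivative exist in `L²_loc`. -/
def MemH1loc {d : ℕ} {F : Type*} [NormedAddCommGroup F] [NormedSpace ℝ F]
    (u : Rd d → F) : Prop :=
  MemL2loc u ∧ ∃ u', IsWeakFDeriv u u' ∧ MemL2loc u'

/-- `u ∈ H²_loc(ℝ^d)`. -/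
def MemH2loc {d : ℕ} (u : Rd d → ℝ) : Prop :=
  MemH1loc u ∧ MemH1loc (weakFDeriv u)

/-- Convergence of the sequence `U` to `u` in `H¹_loc(ℝ^d)`. -/
def TendstoH1loc {d : ℕ} (U : ℕ → Rd d → ℝ) (u : Rd d → ℝ) : Prop :=
  ∀ R : ℝ,
    Tendsto (fun n => eLpNorm (U n - u) 2 (volume.restrict (Metric.ball 0 R))) atTop (𝓝 0) ∧
    Tendsto (fun n => eLpNorm (weakFDeriv (U n) - weakFDeriv u) 2
      (volume.restrict (Metric.ball 0 R))) atTop (𝓝 0)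

/-- `ẑ = z / |z|`. -/
def unitDir {d : ℕ} (z : Rd d) : Rd d := ‖z‖⁻¹ • z

/-- The rescaled kernel `ρ_ε(x) = ε^{-d} ρ(x / ε)`. -/
def rescale {d : ℕ} (ρ : Rd d → ℝ) (ε : ℝ) (x : Rd d) : ℝ := (ε ^ d)⁻¹ * ρ (ε⁻¹ • x)

/-- `F_ε(u) = ∫∫ ρ_ε(y - x) f(|u(y) - u(x)| / |y - x|) dy dx`. -/
def nonlocalEnergy {d : ℕ} (ρ : Rd d → ℝ) (f : ℝ → ℝ) (ε : ℝ) (u : Rd d → ℝ) : ℝ≥0∞ :=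
  ∫⁻ x, ∫⁻ y, ENNReal.ofReal (rescale ρ ε (y - x) * f (|u y - u x| / ‖y - x‖))

/-- `F_0(u) = ∫∫ ρ(z) f(|∇u(x) · ẑ|) dz dx`. -/
def localEnergy {d : ℕ} (ρ : Rd d → ℝ) (f : ℝ → ℝ) (u : Rd d → ℝ) : ℝ≥0∞ :=
  ∫⁻ x, ∫⁻ z, ENNReal.ofReal (ρ z * f |weakFDeriv u x (unitDir z)|)

/-- `E_ε(u) = (F_0(u) - F_ε(u)) / ε²`, used only where `F_0(u) < ∞`. -/
def rateEnergy {d : ℕ} (ρ : Rd d → ℝ) (f : ℝ → ℝ) (ε : ℝ) (u : Rd d → ℝ) : EReal :=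
  ((localEnergy ρ f u : EReal) - (nonlocalEnergy ρ f ε u : EReal)) / ((ε ^ 2 : ℝ) : EReal)

/-- The second derivative on `[0, ∞)`, one-sided at `0`. -/
def secondDeriv (f : ℝ → ℝ) (t : ℝ) : ℝ := iteratedDerivWithin 2 f (Ici 0) t

open Classical in
/-- `E_0(u) = (1/24) ∫∫ ρ(z) |z|² f''(|∇u(x) · ẑ|) |∇²u(x) ẑ · ẑ|² dz dx` if `u ∈ H²_loc`,
and `+∞` otherwise. -/
def limitEnergy {d : ℕ} (ρ : Rd d → ℝ) (f : ℝ → ℝ) (u : Rd d → ℝ) : EReal :=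
  if MemH2loc u then
    (((1 / 24 : ℝ≥0∞) * ∫⁻ x, ∫⁻ z, ENNReal.ofReal
      (ρ z * ‖z‖ ^ 2 * secondDeriv f |weakFDeriv u x (unitDir z)| *
        |weakFDeriv (weakFDeriv u) x (unitDir z) (unitDir z)| ^ 2) : ℝ≥0∞) : EReal)
  else ⊤

/-- The functions `u ∈ H¹_loc(ℝ^d)` with `F_0(u) < ∞`. -/
def rateDomain {d : ℕ} (ρ : Rd d → ℝ) (f : ℝ → ℝ) : Set (Rd d → ℝ) :=
  {u | MemH1loc u ∧ localEnergy ρ f u < ⊤}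

/-- The `Γ`-lower limit inequality on the space `Y`, as `ε → 0⁺`, along the notion of
convergence `conv` of sequences. -/
def GammaLowerLimit {X : Type*} (conv : (ℕ → X) → X → Prop) (Y : Set X)
    (F : ℝ → X → EReal) (F₀ : X → EReal) : Prop :=
  ∀ x ∈ Y, ∀ ε : ℕ → ℝ, (∀ n, 0 < ε n) → Tendsto ε atTop (𝓝 0) →
    ∀ ξ : ℕ → X, (∀ n, ξ n ∈ Y) → conv ξ x →
      F₀ x ≤ liminf (fun n => F (ε n) (ξ n)) atTop

/-- The `Γ`-upper limit inequality: existence of recovery sequences in `Y`. -/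
def GammaUpperLimit {X : Type*} (conv : (ℕ → X) → X → Prop) (Y : Set X)
    (F : ℝ → X → EReal) (F₀ : X → EReal) : Prop :=
  ∀ x ∈ Y, ∀ ε : ℕ → ℝ, (∀ n, 0 < ε n) → Tendsto ε atTop (𝓝 0) →
    ∃ ξ : ℕ → X, (∀ n, ξ n ∈ Y) ∧ conv ξ x ∧
      limsup (fun n => F (ε n) (ξ n)) atTop ≤ F₀ x

/-- The family `F ε` (restricted to `Y`) `Γ`-converges to `F₀` as `ε → 0⁺`. -/
def GammaConverges {X : Type*} (conv : (ℕ → X) → X → Prop) (Y : Set X)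
    (F : ℝ → X → EReal) (F₀ : X → EReal) : Prop :=
  GammaLowerLimit conv Y F F₀ ∧ GammaUpperLimit conv Y F F₀

end

/-! The rate functional is a Jensen gap. Substituting `y = x + εz`, the difference quotient of `u`
is the mean `m` of `g = ∇u · ẑ` over the segment from `x` to `x + εz`, while translation invariance
lets the local energy be averaged over the same segment. For almost every `x`, the difference of the
energies at fixed `z` is thus the mean of `F(g)` minus `F(m)`, where `F(s) = f(|s|)` is `C²` on the
line. Taylor's formula about `m` kills the linear term and leaves `(g - m)² A(m, g)`, with `A =
taylorWeight` and `A(t, t) = f''(|t|) / 2`. To first order `g(x + sεz) - m = ε (s - 1/2) ∂_z g`, and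
`∫₀¹ (s - 1/2)² ds = 1/12`; hence the factor 1/24. Since `∂_z g = |z| ∇²u ẑ · ẑ`, the factor `|z|²`
also appears.

Lower bound. For fixed `z` the gap is bounded below by its dual quadratic form, tested with `ψ(x)(s
- 1/2)` (`ofReal_sub_le_segGap_div`). The form is linear in the gradients apart from a penalty
containing `1 / A`, and strong convexity bounds `1 / A`, so it passes to the limit under `L²_loc`
convergence of gradients alone, with no bound on `f''`. A finite liminf makes the distributional
derivative `∂_z g` bounded on test functions in `L²` norm; Riesz's theorem represents it by an `L²`
function, and optimising over `ψ` recovers the quadratic energy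
(`exists_isWeakDirDeriv_of_liminf_segGap`). Fatou's lemma integrates this in `z`. It gives pure
second derivatives only for almost every `z` with respect to `ρ dz`; as `ρ` is not null, these
contain a set of positive Lebesgue measure, which contains small parallelograms, and polarisation
yields the full Hessian (`exists_hessian`).

Upper bound. The constant sequence recovers. A bound on `f''` or on the gradient bounds `A` along
segments; then the gap over `ε²` is dominated by a multiple of the directional limit density, its
limsup for fixed `z` is at most that density (`limsup_segGap_le`), and reverse Fatou concludes. -/

noncomputable section

/-! ### Taylor remainders and the even extension of the energy density. -/

/-- The weight `∫₀¹ (1 - θ) φ (m + θ (g - m)) dθ` of the integral form of Taylor's remainder. -/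
def taylorWeight (φ : ℝ → ℝ) (m g : ℝ) : ℝ :=
  ∫ θ in (0 : ℝ)..1, (1 - θ) * φ (m + θ * (g - m))

theorem continuous_taylorWeight {φ : ℝ → ℝ} (hφ : Continuous φ) :
    Continuous (fun p : ℝ × ℝ => taylorWeight φ p.1 p.2) := by
  unfold taylorWeight
  apply intervalIntegral.continuous_parametric_intervalIntegral_of_continuous'
  fun_prop

theorem integral_one_sub_mul_const (c : ℝ) : ∫ θ in (0 : ℝ)..1, (1 - θ) * c = c / 2 := by
  rw [intervalIntegral.integral_mul_const, intervalIntegral.integral_sub] <;> norm_num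
  ring

theorem taylorWeight_self (φ : ℝ → ℝ) (m : ℝ) : taylorWeight φ m m = φ m / 2 := by
  simp only [taylorWeight, sub_self, mul_zero, add_zero, integral_one_sub_mul_const]

theorem le_taylorWeight {φ : ℝ → ℝ} (hφ : Continuous φ) {α : ℝ} (hα : ∀ s, α ≤ φ s) (m g : ℝ) :
    α / 2 ≤ taylorWeight φ m g := by
  rw [← integral_one_sub_mul_const]
  apply intervalIntegral.integral_mono_on zero_le_one
  · exact Continuous.intervalIntegrable (by fun_prop) _ _
  · exact Continuous.intervalIntegrable (by fun_prop) _ _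
  · intro θ hθ
    exact mul_le_mul_of_nonneg_left (hα _) (by linarith [hθ.2])

/-- The weight samples `φ` only on the segment between `m` and `g`, which convexity keeps in `K`.
The useful cases are the whole line, when `f''` is bounded, and a compact interval, when the
gradient is. -/
theorem taylorWeight_le {φ : ℝ → ℝ} (hφ : Continuous φ) {M : ℝ} {K : Set ℝ} (hK : Convex ℝ K)
    (hM : ∀ s ∈ K, φ s ≤ M) {m g : ℝ} (hm : m ∈ K) (hg : g ∈ K) :
    taylorWeight φ m g ≤ M / 2 := by
  rw [← integral_one_sub_mul_const]
  apply intervalIntegral.integral_mono_on zero_le_one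
  · exact Continuous.intervalIntegrable (by fun_prop) _ _
  · exact Continuous.intervalIntegrable (by fun_prop) _ _
  · intro θ hθ
    refine mul_le_mul_of_nonneg_left (hM _ ?_) (by linarith [hθ.2])
    have := hK hm hg (sub_nonneg.2 hθ.2) hθ.1 (by ring)
    convert this using 1
    simp only [smul_eq_mul]; ring

/-- The function `F(c(θ)) + (1 - θ)(g - m) F'(c(θ))` with `c(θ) = m + θ(g - m)` is a primitive of
the remainder's integrand: the two first-order terms cancel on differentiation. -/
theorem eq_taylor_of_hasDerivAt {F F' φ : ℝ → ℝ} (hF : ∀ s, HasDerivAt F (F' s) s)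
    (hF' : ∀ s, HasDerivAt F' (φ s) s) (hφ : Continuous φ) (m g : ℝ) :
    F g = F m + F' m * (g - m) + (g - m) ^ 2 * taylorWeight φ m g := by
  have hline : ∀ θ : ℝ, HasDerivAt (fun θ : ℝ => m + θ * (g - m)) (g - m) θ := fun θ => by
    simpa using ((hasDerivAt_id θ).mul_const (g - m)).const_add m
  have hd : ∀ θ : ℝ, HasDerivAt
      (fun θ : ℝ => F (m + θ * (g - m)) + (1 - θ) * ((g - m) * F' (m + θ * (g - m))))
      ((g - m) ^ 2 * ((1 - θ) * φ (m + θ * (g - m)))) θ := fun θ => by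
    have h1 := (hF (m + θ * (g - m))).comp θ (hline θ)
    have h2 := ((hF' (m + θ * (g - m))).comp θ (hline θ)).const_mul (g - m)
    have h3 := ((hasDerivAt_id θ).const_sub 1).mul h2
    refine (h1.add h3).congr_deriv ?_
    simp only [Function.comp_apply, id]; ring
  have := intervalIntegral.integral_eq_sub_of_hasDerivAt (a := 0) (b := 1) (fun θ _ => hd θ)
    (Continuous.intervalIntegrable (by fun_prop) _ _)
  rw [intervalIntegral.integral_const_mul] at this
  unfold taylorWeight
  rw [this]
  ring_nf

/-- The even extension of a `C²` function on `[0, ∞)` with `f 0 = f' 0 = 0` is `C²`. -/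
theorem hasDerivAt_comp_abs {f : ℝ → ℝ} (hf : ContDiffOn ℝ 2 f (Ici 0)) (hf0 : f 0 = 0)
    (hf1 : derivWithin f (Ici 0) 0 = 0) :
    Continuous (fun s => secondDeriv f |s|) ∧ ∃ F' : ℝ → ℝ,
      (∀ s, HasDerivAt (fun s => f |s|) (F' s) s) ∧
      (∀ s, HasDerivAt F' (secondDeriv f |s|) s) ∧ F' 0 = 0 := by
  have hU : UniqueDiffOn ℝ (Ici (0 : ℝ)) := uniqueDiffOn_Ici 0
  have hcφ : Continuous (fun s => secondDeriv f |s|) := by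
    have h := hf.continuousOn_iteratedDerivWithin (m := 2) le_rfl hU
    exact h.comp_continuous continuous_abs (fun s => abs_nonneg s)
  refine ⟨hcφ, ?_⟩
  set φ : ℝ → ℝ := fun s => secondDeriv f |s| with hφdef
  set f1 := derivWithin f (Ici 0) with hf1def
  have hf1C : ContDiffOn ℝ 1 f1 (Ici 0) := hf.derivWithin hU (by norm_num)
  have hd0 : ∀ t, 0 < t → HasDerivAt f (f1 t) t := fun t ht =>
    ((hf.differentiableOn (by norm_num) t ht.le).hasDerivWithinAt).hasDerivAt (Ici_mem_nhds ht)
  have hd1 : ∀ t, 0 < t → HasDerivAt f1 (φ t) t := fun t ht => by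
    have := ((hf1C.differentiableOn (by norm_num) t ht.le).hasDerivWithinAt).hasDerivAt
      (Ici_mem_nhds ht)
    refine this.congr_deriv ?_
    simp only [hφdef, secondDeriv, abs_of_pos ht]
    rw [show (2 : ℕ) = 1 + 1 from rfl, iteratedDerivWithin_succ]
    exact (derivWithin_congr (fun x hx => by rw [iteratedDerivWithin_one]) (by
      rw [iteratedDerivWithin_one])).symm
  -- The primitive from 0 of an even function is odd, and the primitive of an odd one is even.
  -- Integrating `f''(|s|)` twice therefore gives the even extension of `f` at once, without gluing
  -- derivatives at 0.
  set Φ : ℝ → ℝ := fun t => ∫ s in (0 : ℝ)..t, φ s with hΦ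
  have hΦd : ∀ s, HasDerivAt Φ (φ s) s := fun s =>
    intervalIntegral.integral_hasDerivAt_right (hcφ.intervalIntegrable _ _)
      (hcφ.stronglyMeasurableAtFilter _ _) hcφ.continuousAt
  have hΦc : Continuous Φ := continuous_iff_continuousAt.2 fun s => (hΦd s).continuousAt
  have hΦf : ∀ t, 0 ≤ t → f1 t = Φ t := fun t ht => by
    have := intervalIntegral.integral_eq_sub_of_hasDerivAt_of_le ht
      (hf1C.continuousOn.mono Icc_subset_Ici_self) (fun x hx => hd1 x hx.1)
      (hcφ.intervalIntegrable _ _)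
    rw [hΦ]; simp only; rw [this, hf1, sub_zero]
  have hΦodd : ∀ t, Φ (-t) = -Φ t := fun t => by
    have h := intervalIntegral.integral_comp_neg (a := 0) (b := t) φ
    simp only [hφdef, abs_neg, neg_zero] at h
    simp only [hΦ, hφdef]
    rw [h, intervalIntegral.integral_symm]
  have hpos : ∀ t, 0 ≤ t → f t = ∫ s in (0 : ℝ)..t, Φ s := fun t ht => by
    have := intervalIntegral.integral_eq_sub_of_hasDerivAt_of_le ht
      (hf.continuousOn.mono Icc_subset_Ici_self)
      (fun x hx => by rw [← hΦf x hx.1.le]; exact hd0 x hx.1) (hΦc.intervalIntegrable _ _)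
    rw [this, hf0, sub_zero]
  have hF : (fun s => f |s|) = fun s => ∫ t in (0 : ℝ)..s, Φ t := by
    funext s
    rcases le_total 0 s with h | h
    · rw [abs_of_nonneg h, hpos s h]
    · rw [abs_of_nonpos h, hpos _ (by linarith)]
      have h2 := intervalIntegral.integral_comp_neg (a := 0) (b := s) Φ
      simp only [hΦodd, neg_zero, intervalIntegral.integral_neg] at h2
      rw [intervalIntegral.integral_symm, ← h2, neg_neg]
  refine ⟨Φ, fun s => ?_, hΦd, by simp [hΦ]⟩
  rw [hF]
  exact intervalIntegral.integral_hasDerivAt_right (hΦc.intervalIntegrable _ _)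
    (hΦc.stronglyMeasurableAtFilter _ _) hΦc.continuousAt

/-- Convexity of `f - αt²/2` makes `f' - αt` monotone on the half-line, so its one-sided derivative
is nonnegative, at the endpoint 0 as well. -/
theorem le_secondDeriv_of_strongConvexOn {f : ℝ → ℝ} (hf : ContDiffOn ℝ 2 f (Ici 0)) {α : ℝ}
    (hα : StrongConvexOn (Ici 0) α f) {t : ℝ} (ht : 0 ≤ t) : α ≤ secondDeriv f t := by
  have hU : UniqueDiffOn ℝ (Ici (0 : ℝ)) := uniqueDiffOn_Ici 0
  have hconv := strongConvexOn_iff_convex.1 hα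
  have hsq : ∀ x : ℝ, HasDerivWithinAt (fun x : ℝ => α / 2 * ‖x‖ ^ 2) (α * x) (Ici 0) x :=
    fun x => by
      have h := ((hasDerivAt_pow 2 x).const_mul (α / 2)).hasDerivWithinAt (s := Ici 0)
      simp only [Real.norm_eq_abs, sq_abs]
      refine h.congr_deriv ?_
      push_cast; ring
  have hfd : DifferentiableOn ℝ f (Ici 0) := hf.differentiableOn (by norm_num)
  have hmono := hconv.monotoneOn_derivWithin
    (fun x hx => ((hfd x hx).hasDerivWithinAt.sub (hsq x)).differentiableWithinAt)
  have hf1C : ContDiffOn ℝ 1 (derivWithin f (Ici 0)) (Ici 0) := hf.derivWithin hU (by norm_num)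
  have heq : EqOn (derivWithin (fun x => f x - α / 2 * ‖x‖ ^ 2) (Ici 0))
      (fun x => derivWithin f (Ici 0) x - α * x) (Ici 0) := fun x hx =>
    ((hfd x hx).hasDerivWithinAt.sub (hsq x)).derivWithin (hU x hx)
  have hmono' : MonotoneOn (fun x => derivWithin f (Ici 0) x - α * x) (Ici 0) := hmono.congr heq
  have hnn := hmono'.derivWithin_nonneg (x := t)
  have h2 : HasDerivWithinAt (fun x => derivWithin f (Ici 0) x - α * x)
      (derivWithin (derivWithin f (Ici 0)) (Ici 0) t - α) (Ici 0) t := by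
    have := ((hf1C.differentiableOn (by norm_num) t ht).hasDerivWithinAt).sub
      (((hasDerivAt_id t).const_mul α).hasDerivWithinAt (s := Ici 0))
    exact this.congr_deriv (by ring)
  rw [h2.derivWithin (hU t ht)] at hnn
  have h3 : secondDeriv f t = derivWithin (derivWithin f (Ici 0)) (Ici 0) t := by
    unfold secondDeriv
    rw [show (2 : ℕ) = 1 + 1 from rfl, iteratedDerivWithin_succ]
    exact derivWithin_congr (fun x hx => by rw [iteratedDerivWithin_one]) (by
      rw [iteratedDerivWithin_one])
  rw [h3]; linarith

end

/-! ### Means over segments and their behaviour under local `L²` convergence. -/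

noncomputable section

/-- The uniform measure on `(0, 1]`. -/
def unitMeasure : Measure ℝ := volume.restrict (Ioc 0 1)

instance : IsProbabilityMeasure unitMeasure := ⟨by simp [unitMeasure]⟩

theorem ae_unitMeasure_mem : ∀ᵐ s ∂unitMeasure, s ∈ Ioc (0 : ℝ) 1 :=
  ae_restrict_mem measurableSet_Ioc

theorem integral_unitMeasure (k : ℝ → ℝ) : ∫ s, k s ∂unitMeasure = ∫ s in (0 : ℝ)..1, k s :=
  (intervalIntegral.integral_of_le zero_le_one).symm

/-- The mean of `g` on the segment from `x` to `x + h`. -/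
def segAvg {d : ℕ} (g : Rd d → ℝ) (h x : Rd d) : ℝ := ∫ s, g (x + s • h) ∂unitMeasure

theorem measurable_comp_add_smul {d : ℕ} {β : Type*} [MeasurableSpace β] {g : Rd d → β}
    (hg : Measurable g) (h : Rd d) : Measurable (fun p : Rd d × ℝ => g (p.1 + p.2 • h)) :=
  hg.comp (Continuous.measurable (by fun_prop))

theorem measurable_segAvg {d : ℕ} {g : Rd d → ℝ} (hg : Measurable g) (h : Rd d) :
    Measurable (segAvg g h) :=
  ((measurable_comp_add_smul hg h).stronglyMeasurable.integral_prod_right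
    (ν := unitMeasure)).measurable

theorem eLpNorm_two_sq {X F : Type*} [MeasurableSpace X] [NormedAddCommGroup F] (f : X → F)
    (μ : Measure X) : eLpNorm f 2 μ ^ 2 = ∫⁻ x, ‖f x‖ₑ ^ 2 ∂μ := by
  have := eLpNorm_nnreal_pow_eq_lintegral (f := f) (μ := μ) (p := 2) two_ne_zero
  simpa using this

theorem tendsto_eLpNorm_two_iff {ι X F : Type*} [MeasurableSpace X] [NormedAddCommGroup F]
    {l : Filter ι} {f : ι → X → F} {μ : Measure X} :
    Tendsto (fun i => eLpNorm (f i) 2 μ) l (𝓝 0) ↔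
      Tendsto (fun i => ∫⁻ x, ‖f i x‖ₑ ^ 2 ∂μ) l (𝓝 0) := by
  simp_rw [← eLpNorm_two_sq]
  constructor
  · intro h
    simpa using ENNReal.Tendsto.pow (n := 2) h
  · intro h
    have := h.ennrpow_const (1 / 2)
    rw [ENNReal.zero_rpow_of_pos (by norm_num)] at this
    refine this.congr fun i => ?_
    rw [← ENNReal.rpow_natCast, ← ENNReal.rpow_mul]
    norm_num

theorem memLp_two_iff {X F : Type*} [MeasurableSpace X] [NormedAddCommGroup F] {f : X → F}
    {μ : Measure X} (hf : AEStronglyMeasurable f μ) :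
    MemLp f 2 μ ↔ ∫⁻ x, ‖f x‖ₑ ^ 2 ∂μ < ⊤ := by
  rw [← eLpNorm_two_sq]
  constructor
  · intro h
    exact ENNReal.pow_lt_top h.2
  · intro h
    exact ⟨hf, by simpa using h⟩

theorem lintegral_sq_le {X : Type*} [MeasurableSpace X] {μ : Measure X} [IsProbabilityMeasure μ]
    {a : X → ℝ≥0∞} (ha : AEMeasurable a μ) : (∫⁻ x, a x ∂μ) ^ 2 ≤ ∫⁻ x, a x ^ 2 ∂μ := by
  have h := ENNReal.lintegral_mul_le_Lp_mul_Lq μ Real.HolderConjugate.two_two ha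
    (aemeasurable_const (b := (1 : ℝ≥0∞)))
  simp only [Pi.mul_apply, mul_one, ENNReal.one_rpow, lintegral_const, measure_univ] at h
  calc (∫⁻ x, a x ∂μ) ^ 2 ≤ ((∫⁻ x, a x ^ (2 : ℝ) ∂μ) ^ (1 / 2 : ℝ)) ^ 2 := by gcongr
    _ = ∫⁻ x, a x ^ 2 ∂μ := by
      rw [← ENNReal.rpow_natCast, ← ENNReal.rpow_mul]
      norm_num

/-- Jensen's inequality for the square. Integrability is not assumed: without it the right side is
infinite, so the default value 0 of the integral does no harm. -/
theorem enorm_integral_sub_sq_le {X : Type*} [MeasurableSpace X] {μ : Measure X}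
    [IsProbabilityMeasure μ] {k : X → ℝ} (hk : Measurable k) (c : ℝ) :
    ‖(∫ x, k x ∂μ) - c‖ₑ ^ 2 ≤ ∫⁻ x, ‖k x - c‖ₑ ^ 2 ∂μ := by
  have hm : Measurable fun x => k x - c := hk.sub_const c
  have hCS := lintegral_sq_le (μ := μ) (hm.enorm.aemeasurable)
  by_cases hi : Integrable k μ
  · have : (∫ x, k x ∂μ) - c = ∫ x, (k x - c) ∂μ := by
      rw [integral_sub hi (integrable_const c)]; simp
    rw [this]
    refine le_trans ?_ hCS
    gcongr
    exact enorm_integral_le_lintegral_enorm _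
  · have : ∫⁻ x, ‖k x - c‖ₑ ∂μ = ⊤ := by
      by_contra hne
      apply hi
      have h1 : Integrable (fun x => k x - c) μ :=
        ⟨hm.aestronglyMeasurable, lt_top_iff_ne_top.2 hne⟩
      exact (h1.add (integrable_const c)).congr (ae_of_all _ fun x => by simp)
    rw [this] at hCS
    rw [ENNReal.top_pow two_ne_zero, top_le_iff] at hCS
    rw [hCS]; exact le_top

theorem enorm_add_sq_le (a b : ℝ) : ‖a + b‖ₑ ^ 2 ≤ 2 * ‖a‖ₑ ^ 2 + 2 * ‖b‖ₑ ^ 2 := by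
  simp only [Real.enorm_eq_ofReal_abs, ← ENNReal.ofReal_pow (abs_nonneg _), sq_abs]
  rw [show (2 : ℝ≥0∞) = ENNReal.ofReal 2 by simp, ← ENNReal.ofReal_mul (by norm_num),
    ← ENNReal.ofReal_mul (by norm_num), ← ENNReal.ofReal_add (by positivity) (by positivity)]
  apply ENNReal.ofReal_le_ofReal
  nlinarith [sq_nonneg (a - b)]

/-- Translations are continuous in `L²`. -/
theorem tendsto_lintegral_translate_sub {d : ℕ} {p : Rd d → ℝ} (hp : MemLp p 2) :
    Tendsto (fun h : Rd d => ∫⁻ x, ‖p (x + h) - p x‖ₑ ^ 2) (𝓝 0) (𝓝 0) := by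
  rw [← tendsto_eLpNorm_two_iff (f := fun h x => p (x + h) - p x)]
  have : Fact ((2 : ℝ≥0∞) ≠ ⊤) := ⟨by norm_num⟩
  -- Translation is a continuous action on `Lp` for finite exponents; the claim is continuity of one
  -- orbit at 0.
  have hc : Continuous (fun h : Rd d => DomAddAct.mk h +ᵥ hp.toLp p) :=
    (DomAddAct.continuous_mk).vadd continuous_const
  have h0 := (hc.tendsto 0).edist (tendsto_const_nhds (x := hp.toLp p))
  have hz : DomAddAct.mk (0 : Rd d) +ᵥ hp.toLp p = hp.toLp p := by
    simp
  rw [hz, edist_self] at h0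
  refine h0.congr fun h => ?_
  rw [DomAddAct.mk_vadd_toLp, Lp.edist_toLp_toLp]
  congr 1
  funext x
  simp [add_comm]

/-- Local `L²` convergence of `gₙ` is stable under composition with vanishing translations. -/
theorem tendsto_lintegral_segment_sub {d : ℕ} {g : Rd d → ℝ} {G : ℕ → Rd d → ℝ}
    (hg : Measurable g) (hG : ∀ n, Measurable (G n))
    (hgL : ∀ R : ℝ, ∫⁻ x in Metric.ball 0 R, ‖g x‖ₑ ^ 2 < ⊤)
    (hconv : ∀ R : ℝ, Tendsto (fun n => ∫⁻ x in Metric.ball 0 R, ‖G n x - g x‖ₑ ^ 2) atTop (𝓝 0))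
    {h : ℕ → Rd d} (hh : Tendsto h atTop (𝓝 0)) (R : ℝ) :
    Tendsto (fun n => ∫⁻ x in Metric.ball 0 R, ∫⁻ s, ‖G n (x + s • h n) - g x‖ₑ ^ 2 ∂unitMeasure)
      atTop (𝓝 0) := by
  -- Continuity of translations is a global `L²` fact, so `g` is cut off on a ball that still
  -- contains every point of the ball of radius `R` shifted by less than 1.
  set g' : Rd d → ℝ := (Metric.ball 0 (R + 1)).indicator g with hg'
  have hg'm : Measurable g' := hg.indicator measurableSet_ball
  have hg'L : MemLp g' 2 := by
    rw [memLp_two_iff hg'm.aestronglyMeasurable]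
    refine lt_of_eq_of_lt ?_ (hgL (R + 1))
    rw [← lintegral_indicator measurableSet_ball]
    refine lintegral_congr fun x => ?_
    by_cases hx : x ∈ Metric.ball (0 : Rd d) (R + 1) <;> simp [hg', hx]
  have htr := tendsto_lintegral_translate_sub hg'L
  rw [ENNReal.tendsto_nhds_zero]
  intro η hη
  have hη4 : 0 < η / 4 := ENNReal.div_pos hη.ne' (by norm_num)
  have e1 := (ENNReal.tendsto_nhds_zero.1 (hconv (R + 1))) (η / 4) hη4
  have e2 := (ENNReal.tendsto_nhds_zero.1 htr) (η / 4) hη4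
  obtain ⟨δ, hδ, hball⟩ := Metric.eventually_nhds_iff.1 e2
  have e3 : ∀ᶠ n in atTop, ‖h n‖ < min δ 1 := by
    have := (Metric.tendsto_nhds.1 hh) (min δ 1) (by positivity)
    simpa using this
  filter_upwards [e1, e3] with n h1 h3
  have hmeas : Measurable fun q : Rd d × ℝ => ‖G n (q.1 + q.2 • h n) - g q.1‖ₑ ^ 2 :=
    (((measurable_comp_add_smul (hG n) (h n)).sub (hg.comp measurable_fst)).enorm).pow_const 2
  rw [lintegral_lintegral_swap hmeas.aemeasurable]
  have key : ∀ s ∈ Ioc (0 : ℝ) 1,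
      ∫⁻ x in Metric.ball 0 R, ‖G n (x + s • h n) - g x‖ₑ ^ 2 ≤ η := by
    intro s hs
    have hsn : ‖s • h n‖ ≤ ‖h n‖ := by
      rw [norm_smul, Real.norm_eq_abs, abs_of_pos hs.1]
      nlinarith [norm_nonneg (h n), hs.2]
    have hs1 : ‖s • h n‖ < 1 := hsn.trans_lt (h3.trans_le (min_le_right _ _))
    have hsδ : ‖s • h n‖ < δ := hsn.trans_lt (h3.trans_le (min_le_left _ _))
    have hb1 : ∀ x ∈ Metric.ball (0 : Rd d) R, x + s • h n ∈ Metric.ball (0 : Rd d) (R + 1) := by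
      intro x hx
      rw [mem_ball_zero_iff] at hx ⊢
      exact (norm_add_le _ _).trans_lt (add_lt_add hx hs1)
    have hb2 : ∀ x ∈ Metric.ball (0 : Rd d) R, x ∈ Metric.ball (0 : Rd d) (R + 1) := fun x hx =>
      Metric.ball_subset_ball (by linarith) hx
    have hpt : ∀ x ∈ Metric.ball (0 : Rd d) R, ‖G n (x + s • h n) - g x‖ₑ ^ 2 ≤
        2 * (Metric.ball (0 : Rd d) (R + 1)).indicator (fun y => ‖G n y - g y‖ₑ ^ 2) (x + s • h n)
          + 2 * ‖g' (x + s • h n) - g' x‖ₑ ^ 2 := by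
      intro x hx
      rw [indicator_of_mem (hb1 x hx), hg', indicator_of_mem (hb1 x hx),
        indicator_of_mem (hb2 x hx)]
      have := enorm_add_sq_le (G n (x + s • h n) - g (x + s • h n)) (g (x + s • h n) - g x)
      simpa using this
    have hm1 : Measurable ((Metric.ball (0 : Rd d) (R + 1)).indicator
        (fun y => ‖G n y - g y‖ₑ ^ 2)) :=
      (((hG n).sub hg).enorm.pow_const 2).indicator measurableSet_ball
    have hm2 : Measurable fun x => (Metric.ball (0 : Rd d) (R + 1)).indicator
        (fun y => ‖G n y - g y‖ₑ ^ 2) (x + s • h n) := hm1.comp (measurable_add_const _)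
    calc ∫⁻ x in Metric.ball 0 R, ‖G n (x + s • h n) - g x‖ₑ ^ 2
        ≤ ∫⁻ x in Metric.ball 0 R, (2 * (Metric.ball (0 : Rd d) (R + 1)).indicator
            (fun y => ‖G n y - g y‖ₑ ^ 2) (x + s • h n)
          + 2 * ‖g' (x + s • h n) - g' x‖ₑ ^ 2) :=
          setLIntegral_mono' measurableSet_ball hpt
      _ ≤ ∫⁻ x, (2 * (Metric.ball (0 : Rd d) (R + 1)).indicator
            (fun y => ‖G n y - g y‖ₑ ^ 2) (x + s • h n)
          + 2 * ‖g' (x + s • h n) - g' x‖ₑ ^ 2) := setLIntegral_le_lintegral _ _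
      _ = 2 * (∫⁻ x, (Metric.ball (0 : Rd d) (R + 1)).indicator
            (fun y => ‖G n y - g y‖ₑ ^ 2) (x + s • h n))
          + 2 * ∫⁻ x, ‖g' (x + s • h n) - g' x‖ₑ ^ 2 := by
          rw [lintegral_add_left (hm2.const_mul 2),
            lintegral_const_mul _ hm2,
            lintegral_const_mul' _ _ (by norm_num)]
      _ ≤ 2 * (η / 4) + 2 * (η / 4) := by
          rw [lintegral_add_right_eq_self (fun y => (Metric.ball (0 : Rd d) (R + 1)).indicator
            (fun y => ‖G n y - g y‖ₑ ^ 2) y) (s • h n), lintegral_indicator measurableSet_ball]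
          gcongr
          exact hball (by simpa using hsδ)
      _ = η := by
          rw [← two_mul, ← mul_assoc]
          norm_num
          exact ENNReal.mul_div_cancel (by norm_num) (by norm_num)
  calc ∫⁻ s, (∫⁻ x in Metric.ball 0 R, ‖G n (x + s • h n) - g x‖ₑ ^ 2) ∂unitMeasure
      ≤ ∫⁻ s, η ∂unitMeasure :=
        lintegral_mono_ae (ae_unitMeasure_mem.mono fun s hs => key s hs)
    _ = η := by simp

/-- A diagonal choice: pick `n_j` with integral at most `2^{-j}` over `S j`. Since `S k ⊆ S (j +
k)`, the tail series has finite integral over each `S k`, so it converges almost everywhere there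
and its terms vanish in the limit. -/
theorem exists_subseq_ae_tendsto_zero {X : Type*} [MeasurableSpace X] {μ : Measure X}
    {T : ℕ → X → ℝ≥0∞} (hT : ∀ n, Measurable (T n)) {S : ℕ → Set X} (hS : Monotone S)
    (hlim : ∀ k, Tendsto (fun n => ∫⁻ x in S k, T n x ∂μ) atTop (𝓝 0)) :
    ∃ ns : ℕ → ℕ, StrictMono ns ∧
      ∀ k, ∀ᵐ x ∂μ.restrict (S k), Tendsto (fun j => T (ns j) x) atTop (𝓝 0) := by
  have hev : ∀ j : ℕ, ∀ᶠ n in atTop, ∫⁻ x in S j, T n x ∂μ ≤ (2⁻¹ : ℝ≥0∞) ^ j := fun j =>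
    ENNReal.tendsto_nhds_zero.1 (hlim j) _ (ENNReal.pow_pos (by simp) j)
  obtain ⟨ns, hns, hle⟩ := extraction_forall_of_eventually hev
  refine ⟨ns, hns, fun k => ?_⟩
  have hfin : ∫⁻ x in S k, ∑' j, T (ns (j + k)) x ∂μ ≠ ⊤ := by
    rw [lintegral_tsum fun j => (hT _).aemeasurable]
    refine ne_top_of_le_ne_top ?_ (ENNReal.tsum_le_tsum (g := fun j => (2⁻¹ : ℝ≥0∞) ^ j) fun j => ?_)
    · rw [ENNReal.tsum_geometric]; simp
    · calc ∫⁻ x in S k, T (ns (j + k)) x ∂μ ≤ ∫⁻ x in S (j + k), T (ns (j + k)) x ∂μ :=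
            lintegral_mono_set (hS (Nat.le_add_left k j))
        _ ≤ (2⁻¹ : ℝ≥0∞) ^ (j + k) := hle _
        _ ≤ (2⁻¹ : ℝ≥0∞) ^ j :=
            pow_le_pow_right_of_le_one' (by simp) (Nat.le_add_right j k)
  filter_upwards [ae_lt_top (Measurable.tsum fun j => hT _) hfin] with x hx
  exact (tendsto_add_atTop_iff_nat k).1 (ENNReal.tendsto_atTop_zero_of_tsum_ne_top hx.ne)

/-- This variance, times the factor 1/2 from `taylorWeight_self`, is the constant 1/24 of the limit.
-/
theorem integral_sub_half_sq : ∫ s, (s - 1 / 2) ^ 2 ∂unitMeasure = 1 / 12 := by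
  rw [integral_unitMeasure, intervalIntegral.integral_comp_sub_right (fun x => x ^ 2)]
  norm_num

theorem integral_sub_half : ∫ s, (s - 1 / 2) ∂unitMeasure = 0 := by
  rw [integral_unitMeasure, intervalIntegral.integral_comp_sub_right (fun x => x)]
  norm_num

theorem tendsto_of_enorm_sub_sq {ι : Type*} {l : Filter ι} {a : ι → ℝ} {b : ℝ}
    (h : Tendsto (fun i => ‖a i - b‖ₑ ^ 2) l (𝓝 0)) : Tendsto a l (𝓝 b) := by
  rw [tendsto_iff_edist_tendsto_0]
  have := h.ennrpow_const (1 / 2)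
  rw [ENNReal.zero_rpow_of_pos (by norm_num)] at this
  refine this.congr fun i => ?_
  rw [edist_eq_enorm_sub, ← ENNReal.rpow_natCast, ← ENNReal.rpow_mul]
  norm_num

/-- Convergence of integrals of bounded continuous functions of the values on short segments. -/
theorem tendsto_integral_segment {d : ℕ} {g : Rd d → ℝ} {G : ℕ → Rd d → ℝ}
    (hg : Measurable g) (hG : ∀ n, Measurable (G n))
    (hgL : ∀ R : ℝ, ∫⁻ x in Metric.ball 0 R, ‖g x‖ₑ ^ 2 < ⊤)
    (hconv : ∀ R : ℝ, Tendsto (fun n => ∫⁻ x in Metric.ball 0 R, ‖G n x - g x‖ₑ ^ 2) atTop (𝓝 0))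
    {h : ℕ → Rd d} (hh : Tendsto h atTop (𝓝 0)) {B : ℝ × ℝ → ℝ} (hB : Continuous B) {C : ℝ}
    (hC : ∀ q, |B q| ≤ C) {w : Rd d → ℝ} (hw : Integrable w) :
    Tendsto (fun n => ∫ q : Rd d × ℝ, w q.1 * (q.2 - 1 / 2) ^ 2 *
        B (segAvg (G n) (h n) q.1, G n (q.1 + q.2 • h n)) ∂(volume.prod unitMeasure)) atTop
      (𝓝 (1 / 12 * ∫ x, w x * B (g x, g x))) := by
  have hlim : 1 / 12 * ∫ x, w x * B (g x, g x) =
      ∫ q : Rd d × ℝ, (w q.1 * B (g q.1, g q.1)) * (q.2 - 1 / 2) ^ 2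
        ∂(volume.prod unitMeasure) := by
    rw [integral_prod_mul (fun x => w x * B (g x, g x)) (fun s : ℝ => (s - 1 / 2) ^ 2),
      integral_sub_half_sq, mul_comm]
  rw [hlim]
  -- The first summand controls the value at the point of the segment and, by Jensen, the second
  -- controls the mean, so convergence of `T` to 0 handles both arguments of `B`.
  set T : ℕ → Rd d × ℝ → ℝ≥0∞ := fun n q => ‖G n (q.1 + q.2 • h n) - g q.1‖ₑ ^ 2 +
    ∫⁻ s, ‖G n (q.1 + s • h n) - g q.1‖ₑ ^ 2 ∂unitMeasure with hT
  have hD : ∀ n, Measurable fun q : Rd d × ℝ => ‖G n (q.1 + q.2 • h n) - g q.1‖ₑ ^ 2 := fun n =>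
    (((measurable_comp_add_smul (hG n) (h n)).sub (hg.comp measurable_fst)).enorm).pow_const 2
  have hE : ∀ n, Measurable fun x : Rd d =>
      ∫⁻ s, ‖G n (x + s • h n) - g x‖ₑ ^ 2 ∂unitMeasure := fun n =>
    (hD n).lintegral_prod_right'
  have hTm : ∀ n, Measurable (T n) := fun n => (hD n).add ((hE n).comp measurable_fst)
  set S : ℕ → Set (Rd d × ℝ) := fun k => Metric.ball 0 k ×ˢ univ with hS
  have hSmono : Monotone S := fun a b hab =>
    prod_mono (Metric.ball_subset_ball (by exact_mod_cast hab)) le_rfl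
  have hTlim : ∀ k, Tendsto (fun n => ∫⁻ q in S k, T n q ∂(volume.prod unitMeasure)) atTop
      (𝓝 0) := fun k => by
    have hseg := tendsto_lintegral_segment_sub hg hG hgL hconv hh k
    have : Tendsto (fun n => 2 * ∫⁻ x in Metric.ball 0 (k : ℝ),
        ∫⁻ s, ‖G n (x + s • h n) - g x‖ₑ ^ 2 ∂unitMeasure) atTop (𝓝 0) := by
      simpa using ENNReal.Tendsto.const_mul hseg (Or.inr (by norm_num : (2 : ℝ≥0∞) ≠ ⊤))
    refine this.congr fun n => ?_
    rw [hS, ← Measure.prod_restrict, Measure.restrict_univ,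
      lintegral_prod _ (hTm n).aemeasurable, two_mul, ← lintegral_add_left (hE n)]
    refine lintegral_congr fun x => ?_
    simp only [hT]
    rw [lintegral_add_right _ measurable_const]
    simp
  -- Pointwise convergence is available only along subsequences; it is enough that every subsequence
  -- has a further one along which dominated convergence applies.
  refine tendsto_of_subseq_tendsto fun φ hφ => ?_
  obtain ⟨ns, hns, hae⟩ := exists_subseq_ae_tendsto_zero (μ := volume.prod unitMeasure)
    (T := fun j => T (φ j)) (fun j => hTm _) hSmono (fun k => (hTlim k).comp hφ)
  refine ⟨ns, ?_⟩
  have hall : ∀ᵐ q ∂(volume.prod unitMeasure : Measure (Rd d × ℝ)),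
      Tendsto (fun j => T (φ (ns j)) q) atTop (𝓝 0) := by
    have h1 : ∀ᵐ q ∂(volume.prod unitMeasure : Measure (Rd d × ℝ)),
        ∀ k, q ∈ S k → Tendsto (fun j => T (φ (ns j)) q) atTop (𝓝 0) :=
      ae_all_iff.2 fun k =>
        (ae_restrict_iff' (measurableSet_ball.prod MeasurableSet.univ)).1 (hae k)
    filter_upwards [h1] with q hq
    obtain ⟨k, hk⟩ := exists_nat_gt ‖q.1‖
    exact hq k (by simpa [hS] using hk)
  have hwi : Integrable (fun q : Rd d × ℝ => C * ‖w q.1‖) (volume.prod unitMeasure) :=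
    (hw.norm.comp_fst unitMeasure).const_mul C
  refine tendsto_integral_of_dominated_convergence (fun q => C * ‖w q.1‖) (fun j => ?_) hwi
    (fun j => ?_) ?_
  · refine ((hw.aestronglyMeasurable.comp_fst).mul ?_).mul ?_
    · exact Continuous.aestronglyMeasurable (by fun_prop)
    · exact (hB.measurable.comp (((measurable_segAvg (hG _) _).comp measurable_fst).prodMk
        (measurable_comp_add_smul (hG _) _))).aestronglyMeasurable
  · have hs : ∀ᵐ q ∂(volume.prod unitMeasure : Measure (Rd d × ℝ)), q.2 ∈ Ioc (0 : ℝ) 1 :=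
      Measure.quasiMeasurePreserving_snd.ae ae_unitMeasure_mem
    filter_upwards [hs] with q hq
    rw [norm_mul, norm_mul, mul_comm C, Real.norm_eq_abs (B _)]
    have h2 : ‖(q.2 - 1 / 2) ^ 2‖ ≤ 1 := by
      rw [Real.norm_eq_abs, abs_of_nonneg (sq_nonneg _)]
      nlinarith [hq.1, hq.2]
    have h3 := hC (segAvg (G (φ (ns j))) (h (φ (ns j))) q.1,
      G (φ (ns j)) (q.1 + q.2 • h (φ (ns j))))
    exact mul_le_mul (mul_le_of_le_one_right (norm_nonneg _) h2) h3 (abs_nonneg _) (norm_nonneg _)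
  · filter_upwards [hall] with q hq
    have t1 : Tendsto (fun j => G (φ (ns j)) (q.1 + q.2 • h (φ (ns j)))) atTop (𝓝 (g q.1)) := by
      apply tendsto_of_enorm_sub_sq
      exact tendsto_of_tendsto_of_tendsto_of_le_of_le tendsto_const_nhds hq (fun _ => zero_le)
        (fun j => le_self_add)
    have t2 : Tendsto (fun j => segAvg (G (φ (ns j))) (h (φ (ns j))) q.1) atTop (𝓝 (g q.1)) := by
      apply tendsto_of_enorm_sub_sq
      refine tendsto_of_tendsto_of_tendsto_of_le_of_le tendsto_const_nhds hq (fun _ => zero_le)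
        (fun j => ?_)
      refine le_trans (enorm_integral_sub_sq_le ?_ _) le_add_self
      exact (measurable_comp_add_smul (hG _) _).comp measurable_prodMk_left
    have t3 := ((hB.tendsto (g q.1, g q.1)).comp (t2.prodMk_nhds t1)).const_mul
      (w q.1 * (q.2 - 1 / 2) ^ 2)
    refine t3.trans (le_of_eq ?_)
    congr 1; ring

end

/-! ### Weak directional derivatives and the fundamental theorem along segments. -/

noncomputable section

theorem LocallyIntegrable.integrableOn_ball {d : ℕ} {F : Type*} [NormedAddCommGroup F]
    {p : Rd d → F} (hp : LocallyIntegrable p) (R : ℝ) : IntegrableOn p (Metric.ball 0 R) :=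
  (hp.integrableOn_isCompact (isCompact_closedBall 0 R)).mono_set Metric.ball_subset_closedBall

theorem locallyIntegrable_of_integrableOn_ball {d : ℕ} {F : Type*} [NormedAddCommGroup F]
    {p : Rd d → F} (hp : ∀ R : ℝ, IntegrableOn p (Metric.ball 0 R)) : LocallyIntegrable p :=
  fun x => ⟨Metric.ball 0 (‖x‖ + 1), Metric.isOpen_ball.mem_nhds (by simp), hp _⟩

theorem integrable_segment {d : ℕ} {p : Rd d → ℝ} (hpm : Measurable p) (hp : Integrable p)
    (v : Rd d) : Integrable (fun q : Rd d × ℝ => p (q.1 + q.2 • v)) (volume.prod unitMeasure) := by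
  rw [integrable_prod_iff' (measurable_comp_add_smul hpm v).aestronglyMeasurable]
  refine ⟨ae_of_all _ fun s => hp.comp_add_right (s • v), ?_⟩
  simp_rw [integral_add_right_eq_self (fun x => ‖p x‖)]
  exact integrable_const _

theorem ae_snd_mem_Ioc {d : ℕ} : ∀ᵐ q ∂(volume.prod unitMeasure : Measure (Rd d × ℝ)),
    q.2 ∈ Ioc (0 : ℝ) 1 :=
  Measure.quasiMeasurePreserving_snd.ae ae_unitMeasure_mem

theorem norm_smul_lt_of_mem_Ioc {d : ℕ} {s : ℝ} (hs : s ∈ Ioc (0 : ℝ) 1) (v : Rd d) :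
    ‖s • v‖ ≤ ‖v‖ := by
  rw [norm_smul, Real.norm_eq_abs, abs_of_pos hs.1]
  exact mul_le_of_le_one_left (norm_nonneg _) hs.2

/-- Where `K` does not vanish, the base point lies in the ball of radius `R`, so `p` is evaluated
only in the ball of radius `R + ‖v‖` and may be replaced by its integrable truncation. -/
theorem integrable_mul_segment {d : ℕ} {p : Rd d → ℝ} (hpm : Measurable p)
    (hp : LocallyIntegrable p) (v : Rd d) {K : Rd d × ℝ → ℝ} (hK : Measurable K) {C R : ℝ}
    (hC : ∀ q, q.2 ∈ Ioc (0 : ℝ) 1 → |K q| ≤ C)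
    (hR : ∀ q, q.2 ∈ Ioc (0 : ℝ) 1 → R ≤ ‖q.1‖ → K q = 0) :
    Integrable (fun q : Rd d × ℝ => K q * p (q.1 + q.2 • v)) (volume.prod unitMeasure) := by
  have h1 := integrable_segment (hpm.indicator (measurableSet_ball (x := 0) (ε := R + ‖v‖)))
    ((LocallyIntegrable.integrableOn_ball hp (R + ‖v‖)).integrable_indicator measurableSet_ball) v
  have h2 := h1.bdd_mul hK.aestronglyMeasurable (c := C)
    (ae_snd_mem_Ioc.mono fun q hq => by simpa using hC q hq)
  refine h2.congr (ae_snd_mem_Ioc.mono fun q hq => ?_)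
  by_cases h : R ≤ ‖q.1‖
  · simp [hR q hq h]
  · have : q.1 + q.2 • v ∈ Metric.ball (0 : Rd d) (R + ‖v‖) := by
      rw [mem_ball_zero_iff]
      exact (norm_add_le _ _).trans_lt
        (add_lt_add_of_lt_of_le (not_le.1 h) (norm_smul_lt_of_mem_Ioc hq v))
    simp only [indicator_of_mem this]

theorem ae_integrable_segment {d : ℕ} {p : Rd d → ℝ} (hpm : Measurable p)
    (hp : LocallyIntegrable p) (v : Rd d) :
    ∀ᵐ x, Integrable (fun s => p (x + s • v)) unitMeasure := by
  have h : ∀ k : ℕ, ∀ᵐ x : Rd d, ‖x‖ < k → Integrable (fun s => p (x + s • v)) unitMeasure := by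
    intro k
    have h1 := integrable_mul_segment hpm hp v (C := 1) (R := k)
      (K := fun q => (Metric.ball (0 : Rd d) k).indicator (fun _ => (1 : ℝ)) q.1)
      ((measurable_const.indicator measurableSet_ball).comp measurable_fst)
      (fun q _ => by
        by_cases h : q.1 ∈ Metric.ball (0 : Rd d) k
        · rw [indicator_of_mem h]; simp
        · rw [indicator_of_notMem h]; simp)
      (fun q _ h => indicator_of_notMem (by simpa using h) _)
    filter_upwards [h1.prod_right_ae] with x hx hxk
    simpa [indicator_of_mem (show x ∈ Metric.ball (0 : Rd d) k by simpa using hxk)] using hx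
  filter_upwards [ae_all_iff.2 h] with x hx
  obtain ⟨k, hk⟩ := exists_nat_gt ‖x‖
  exact hx k hk

theorem locallyIntegrable_segAvg {d : ℕ} {p : Rd d → ℝ} (hpm : Measurable p)
    (hp : LocallyIntegrable p) (v : Rd d) : LocallyIntegrable (segAvg p v) := by
  refine locallyIntegrable_of_integrableOn_ball fun R => ?_
  have h1 := integrable_mul_segment hpm hp v (C := 1) (R := R)
    (K := fun q => (Metric.ball (0 : Rd d) R).indicator (fun _ => (1 : ℝ)) q.1)
    ((measurable_const.indicator measurableSet_ball).comp measurable_fst)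
    (fun q _ => by
      by_cases h : q.1 ∈ Metric.ball (0 : Rd d) R
      · rw [indicator_of_mem h]; simp
      · rw [indicator_of_notMem h]; simp)
    (fun q _ h => indicator_of_notMem (by simpa using h) _)
  rw [← integrable_indicator_iff measurableSet_ball]
  refine h1.integral_prod_left.congr (ae_of_all _ fun x => ?_)
  by_cases h : x ∈ Metric.ball (0 : Rd d) R
  · simp [indicator_of_mem h, segAvg]
  · simp [indicator_of_notMem h]

/-- `p` is the weak derivative of `g` in the direction `v`. -/
def IsWeakDirDeriv {d : ℕ} (g : Rd d → ℝ) (v : Rd d) (p : Rd d → ℝ) : Prop :=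
  ∀ ψ : Rd d → ℝ, ContDiff ℝ ∞ ψ → HasCompactSupport ψ →
    ∫ x, fderiv ℝ ψ x v * g x = - ∫ x, ψ x * p x

theorem exists_bound_of_hasCompactSupport {d : ℕ} {ψ : Rd d → ℝ} (hψ : Continuous ψ)
    (hc : HasCompactSupport ψ) : ∃ C R : ℝ, 0 ≤ C ∧ 0 < R ∧ (∀ x, |ψ x| ≤ C) ∧
      ∀ x, R ≤ ‖x‖ → ψ x = 0 := by
  obtain ⟨C, hC⟩ := hψ.bounded_above_of_compact_support hc
  obtain ⟨R, hR0, hR⟩ := hc.exists_pos_le_norm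
  exact ⟨C, R, (norm_nonneg _).trans (hC 0), hR0, hC, fun x hx => hR x hx⟩

theorem integral_fderiv_segment {d : ℕ} {ψ : Rd d → ℝ} (hψ : ContDiff ℝ ∞ ψ) (v x : Rd d) :
    ∫ s, fderiv ℝ ψ (x - s • v) v ∂unitMeasure = ψ x - ψ (x - v) := by
  rw [integral_unitMeasure]
  have hd : ∀ s : ℝ, HasDerivAt (fun s : ℝ => - ψ (x - s • v)) (fderiv ℝ ψ (x - s • v) v) s := by
    intro s
    have h1 : HasDerivAt (fun s : ℝ => x - s • v) (-v) s := by
      simpa using ((hasDerivAt_id s).smul_const v).const_sub x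
    have h2 := ((hψ.differentiable (by norm_num)) (x - s • v)).hasFDerivAt.comp_hasDerivAt s h1
    exact h2.neg.congr_deriv (by simp)
  rw [intervalIntegral.integral_eq_sub_of_hasDerivAt (fun s _ => hd s)]
  · simp; ring
  · have := hψ.continuous_fderiv (by norm_num)
    exact Continuous.intervalIntegrable (by fun_prop) _ _

/-- A function with a weak directional derivative satisfies the fundamental theorem of calculus
along almost every segment in that direction. -/
theorem IsWeakDirDeriv.ae_sub_eq_segAvg {d : ℕ} {g p : Rd d → ℝ} {v : Rd d}
    (h : IsWeakDirDeriv g v p) (hgm : Measurable g) (hg : LocallyIntegrable g)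
    (hpm : Measurable p) (hp : LocallyIntegrable p) :
    ∀ᵐ x, g (x + v) - g x = segAvg p v x := by
  have hgv : LocallyIntegrable (fun x => g (x + v)) := by
    refine locallyIntegrable_of_integrableOn_ball fun R => ?_
    have h1 := ((LocallyIntegrable.integrableOn_ball hg (R + ‖v‖)).integrable_indicator
      measurableSet_ball).comp_add_right v
    refine h1.integrableOn.congr_fun (fun x hx => ?_) measurableSet_ball
    refine indicator_of_mem ?_ _
    rw [mem_ball_zero_iff] at hx ⊢
    exact (norm_add_le _ _).trans_lt (by linarith)
  refine ae_eq_of_integral_contDiff_smul_eq (hgv.sub hg) (locallyIntegrable_segAvg hpm hp v) ?_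
  intro ψ hψ hc
  obtain ⟨C, R, hC0, hR0, hC, hR⟩ := exists_bound_of_hasCompactSupport hψ.continuous hc
  have hψ' := hψ.continuous_fderiv (by norm_num)
  have hc' : HasCompactSupport (fun x => fderiv ℝ ψ x v) := hc.fderiv_apply ℝ v
  obtain ⟨C', R', hC0', hR0', hC', hR'⟩ := exists_bound_of_hasCompactSupport
    (hψ'.clm_apply continuous_const) hc'
  have htrans : ∀ s : ℝ, HasCompactSupport (fun x => ψ (x - s • v)) := fun s => by
    simpa [sub_eq_add_neg, Function.comp_def] using
      hc.comp_homeomorph (Homeomorph.addRight (-(s • v)))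
  have hsm : ∀ s : ℝ, ContDiff ℝ ∞ (fun x => ψ (x - s • v)) := fun s =>
    hψ.comp (contDiff_id.sub contDiff_const)
  have hint : ∀ (φ k : Rd d → ℝ), Continuous φ → HasCompactSupport φ → LocallyIntegrable k →
      Integrable (fun x => φ x * k x) := fun φ k hφ hφc hk =>
    hk.integrable_smul_left_of_hasCompactSupport hφ hφc
  have i1 : Integrable (fun q : Rd d × ℝ => fderiv ℝ ψ (q.1 - q.2 • v) v * g q.1)
      (volume.prod unitMeasure) := by
    -- The shift sits on the test function here, so `g` is taken with shift 0 and the support radius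
    -- grows by `‖v‖` instead.
    have := integrable_mul_segment hgm hg 0 (C := C') (R := R' + ‖v‖)
      (K := fun q : Rd d × ℝ => fderiv ℝ ψ (q.1 - q.2 • v) v)
      (Continuous.measurable (by fun_prop)) (fun q _ => hC' _)
      (fun q hq h => hR' _ (by
        have := norm_sub_norm_le q.1 (q.2 • v)
        have := norm_smul_lt_of_mem_Ioc hq v
        linarith))
    simpa using this
  have i2 : Integrable (fun q : Rd d × ℝ => ψ q.1 * p (q.1 + q.2 • v))
      (volume.prod unitMeasure) :=
    integrable_mul_segment hpm hp v (C := C) (R := R) (K := fun q : Rd d × ℝ => ψ q.1)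
      (hψ.continuous.comp continuous_fst).measurable (fun q _ => hC _) (fun q _ h => hR _ h)
  have key : ∀ s : ℝ, ∫ x, ψ x * p (x + s • v) = - ∫ x, fderiv ℝ ψ (x - s • v) v * g x := by
    intro s
    have h1 := h _ (hsm s) (htrans s)
    have h2 : ∀ x, fderiv ℝ (fun x => ψ (x - s • v)) x = fderiv ℝ ψ (x - s • v) := fun x =>
      fderiv_comp_sub _
    simp only [h2] at h1
    rw [h1, neg_neg, ← integral_add_right_eq_self (fun x => ψ (x - s • v) * p x) (s • v)]
    simp
  -- The increment is moved onto `ψ`, written there as a classical integral along the segment,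
  -- paired with `g` through the weak derivative at each `s`, and translated back onto `p`.
  calc ∫ x, ψ x • (g (x + v) - g x)
      = (∫ x, ψ x * g (x + v)) - ∫ x, ψ x * g x := by
        rw [← integral_sub (hint _ _ hψ.continuous hc hgv) (hint _ _ hψ.continuous hc hg)]
        simp only [smul_eq_mul, mul_sub]
    _ = (∫ x, ψ (x - v) * g x) - ∫ x, ψ x * g x := by
        rw [← integral_add_right_eq_self (fun x => ψ (x - v) * g x) v]
        simp
    _ = - ∫ x, (∫ s, fderiv ℝ ψ (x - s • v) v ∂unitMeasure) * g x := by
        have h1 := htrans 1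
        have h2 := hsm 1
        simp only [one_smul] at h1 h2
        rw [← integral_sub (hint _ _ h2.continuous h1 hg) (hint _ _ hψ.continuous hc hg),
          ← integral_neg]
        refine integral_congr_ae (ae_of_all _ fun x => ?_)
        simp only [integral_fderiv_segment hψ]
        ring
    _ = - ∫ x, ∫ s, fderiv ℝ ψ (x - s • v) v * g x ∂unitMeasure := by
        simp_rw [integral_mul_const]
    _ = - ∫ s, (∫ x, fderiv ℝ ψ (x - s • v) v * g x) ∂unitMeasure := by
        rw [integral_integral_swap i1]
    _ = ∫ s, (∫ x, ψ x * p (x + s • v)) ∂unitMeasure := by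
        rw [← integral_neg]; simp_rw [key]
    _ = ∫ x, ∫ s, ψ x * p (x + s • v) ∂unitMeasure := by
        rw [← integral_integral_swap i2]
    _ = ∫ x, ψ x • segAvg p v x := by
        simp_rw [integral_const_mul, segAvg, smul_eq_mul]

end

/-! ### Duality between test functions and `L²`. -/

noncomputable section

/-- Smooth functions with compact support. -/
def testFunctions (d : ℕ) : Submodule ℝ (Rd d → ℝ) where
  carrier := {ψ | ContDiff ℝ ∞ ψ ∧ HasCompactSupport ψ}
  add_mem' h h' := ⟨h.1.add h'.1, h.2.add h'.2⟩
  zero_mem' := ⟨contDiff_const, HasCompactSupport.zero⟩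
  smul_mem' c _ h := ⟨contDiff_const.smul h.1, h.2.smul_left (f := fun _ => c)⟩

theorem memLp_testFunction {d : ℕ} (ψ : testFunctions d) : MemLp (ψ : Rd d → ℝ) 2 :=
  ψ.2.1.continuous.memLp_of_hasCompactSupport ψ.2.2

/-- The inclusion of test functions in `L²`. -/
def testToL2 (d : ℕ) : testFunctions d →ₗ[ℝ] Lp ℝ 2 (volume : Measure (Rd d)) where
  toFun ψ := (memLp_testFunction ψ).toLp _
  map_add' ψ χ := MemLp.toLp_add (memLp_testFunction ψ) (memLp_testFunction χ)
  map_smul' c ψ := MemLp.toLp_const_smul c (memLp_testFunction ψ)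

theorem norm_testToL2_sq {d : ℕ} (ψ : testFunctions d) :
    ‖testToL2 d ψ‖ ^ 2 = ∫ x, (ψ : Rd d → ℝ) x ^ 2 := by
  rw [← real_inner_self_eq_norm_sq, L2.inner_def]
  refine integral_congr_ae ?_
  filter_upwards [(memLp_testFunction ψ).coeFn_toLp] with x hx
  simp only [testToL2, LinearMap.coe_mk, AddHom.coe_mk, hx]
  simp [sq]

theorem denseRange_testToL2 (d : ℕ) : DenseRange (testToL2 d) := by
  have h := Lp.dense_hasCompactSupport_contDiff (E := Rd d) (F := ℝ) (p := 2) (μ := volume)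
    (by norm_num)
  refine h.mono ?_
  rintro f ⟨g, hfg, hc, hs⟩
  refine ⟨⟨g, hs, hc⟩, ?_⟩
  refine Lp.ext ?_
  exact ((memLp_testFunction ⟨g, hs, hc⟩).coeFn_toLp).trans hfg.symm

/-- A functional on test functions that is bounded for the `L²` norm is given by an `L²`
function. -/
theorem exists_memLp_of_le_norm {d : ℕ} (l : testFunctions d →ₗ[ℝ] ℝ) {C : ℝ}
    (hC : ∀ ψ, |l ψ| ≤ C * ‖testToL2 d ψ‖) :
    ∃ q : Rd d → ℝ, Measurable q ∧ MemLp q 2 ∧ ∀ ψ : testFunctions d,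
      l ψ = ∫ x, (ψ : Rd d → ℝ) x * q x := by
  set L := l.extendOfNorm (testToL2 d) with hL
  have hLe : ∀ ψ, L (testToL2 d ψ) = l ψ := fun ψ =>
    LinearMap.extendOfNorm_eq (denseRange_testToL2 d) ⟨C, hC⟩ ψ
  set Q := (InnerProductSpace.toDual ℝ (Lp ℝ 2 (volume : Measure (Rd d)))).symm L with hQ
  have hm := (Lp.aestronglyMeasurable Q).aemeasurable
  refine ⟨hm.mk _, hm.measurable_mk, (memLp_congr_ae hm.ae_eq_mk).1 (Lp.memLp Q), fun ψ => ?_⟩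
  have h1 : inner ℝ Q (testToL2 d ψ) = L (testToL2 d ψ) :=
    InnerProductSpace.toDual_symm_apply
  rw [← hLe, ← h1, L2.inner_def]
  refine integral_congr_ae ?_
  filter_upwards [(memLp_testFunction ψ).coeFn_toLp, hm.ae_eq_mk] with x hx hx'
  simp only [testToL2, LinearMap.coe_mk, AddHom.coe_mk, hx]
  rw [← hx']
  simp

/-- Homogeneity: apply the bound to `ψ / ‖T ψ‖`, and to `-ψ` for the other sign. If `T ψ = 0`, a
positive value of `l ψ` could be scaled past `K₁`. -/
theorem abs_le_mul_norm_of_le_add_sq {V H : Type*} [AddCommGroup V] [Module ℝ V]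
    [NormedAddCommGroup H] [NormedSpace ℝ H] (l : V →ₗ[ℝ] ℝ) (T : V →ₗ[ℝ] H) {K₁ K₂ : ℝ}
    (h : ∀ ψ, l ψ ≤ K₁ + K₂ * ‖T ψ‖ ^ 2) (ψ : V) : |l ψ| ≤ (K₁ + K₂) * ‖T ψ‖ := by
  have hpos : ∀ ψ, l ψ ≤ (K₁ + K₂) * ‖T ψ‖ := by
    intro ψ
    rcases eq_or_ne (T ψ) 0 with h0 | h0
    · rw [h0, norm_zero, mul_zero]
      by_contra hlt
      push Not at hlt
      have := h (((|K₁| + 1) / l ψ) • ψ)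
      rw [map_smul, map_smul, h0, smul_zero, norm_zero, smul_eq_mul,
        div_mul_cancel₀ _ hlt.ne'] at this
      have := le_abs_self K₁
      norm_num at *
      linarith
    · have hn : 0 < ‖T ψ‖ := norm_pos_iff.2 h0
      have := h (‖T ψ‖⁻¹ • ψ)
      rw [map_smul, map_smul, norm_smul, norm_inv, norm_norm, inv_mul_cancel₀ hn.ne',
        smul_eq_mul, one_pow, mul_one, inv_mul_le_iff₀ hn] at this
      linarith
  rw [abs_le]
  refine ⟨?_, hpos ψ⟩
  have := hpos (-ψ)
  rw [map_neg, map_neg, norm_neg] at this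
  linarith

theorem integrable_test_mul {d : ℕ} {φ k : Rd d → ℝ} (hφ : Continuous φ)
    (hφc : HasCompactSupport φ) (hk : LocallyIntegrable k) : Integrable (fun x => φ x * k x) :=
  hk.integrable_smul_left_of_hasCompactSupport hφ hφc

theorem integrable_fderiv_test_mul {d : ℕ} (ψ : testFunctions d) {k : Rd d → ℝ}
    (hk : LocallyIntegrable k) (v : Rd d) :
    Integrable (fun x => fderiv ℝ (ψ : Rd d → ℝ) x v * k x) :=
  integrable_test_mul ((ψ.2.1.continuous_fderiv (by norm_num)).clm_apply continuous_const)
    (ψ.2.2.fderiv_apply ℝ v) hk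

/-- The distributional derivative of `g` in the direction `v`. -/
def dirPairing {d : ℕ} {g : Rd d → ℝ} (hg : LocallyIntegrable g) (v : Rd d) :
    testFunctions d →ₗ[ℝ] ℝ where
  toFun ψ := - ∫ x, fderiv ℝ (ψ : Rd d → ℝ) x v * g x
  map_add' ψ χ := by
    rw [← neg_add, ← integral_add (integrable_fderiv_test_mul ψ hg v)
      (integrable_fderiv_test_mul χ hg v)]
    congr 1
    refine integral_congr_ae (ae_of_all _ fun x => ?_)
    simp only [Submodule.coe_add]
    rw [fderiv_add (ψ.2.1.differentiable (by norm_num) x) (χ.2.1.differentiable (by norm_num) x)]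
    simp [add_mul]
  map_smul' c ψ := by
    rw [RingHom.id_apply, smul_eq_mul, mul_neg, ← integral_const_mul]
    congr 1
    refine integral_congr_ae (ae_of_all _ fun x => ?_)
    simp only [Submodule.coe_smul]
    rw [fderiv_const_smul (ψ.2.1.differentiable (by norm_num) x)]
    simp [mul_assoc]

theorem isWeakDirDeriv_iff {d : ℕ} {g p : Rd d → ℝ} (hg : LocallyIntegrable g) {v : Rd d} :
    IsWeakDirDeriv g v p ↔ ∀ ψ : testFunctions d,
      dirPairing hg v ψ = ∫ x, (ψ : Rd d → ℝ) x * p x :=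
  ⟨fun h ψ => by
    have := h ψ ψ.2.1 ψ.2.2
    simp only [dirPairing, LinearMap.coe_mk, AddHom.coe_mk, this, neg_neg],
   fun h ψ h1 h2 => by
    have := h ⟨ψ, h1, h2⟩
    simp only [dirPairing, LinearMap.coe_mk, AddHom.coe_mk] at this
    rw [← this, neg_neg]⟩

theorem IsWeakDirDeriv.ae_eq {d : ℕ} {g p p' : Rd d → ℝ} {v : Rd d}
    (h : IsWeakDirDeriv g v p) (h' : IsWeakDirDeriv g v p') (hp : LocallyIntegrable p)
    (hp' : LocallyIntegrable p') : p =ᵐ[volume] p' :=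
  ae_eq_of_integral_contDiff_smul_eq hp hp' fun ψ h1 h2 => by
    have e1 := h ψ h1 h2
    have e2 := h' ψ h1 h2
    simp only [smul_eq_mul]
    linarith

/-- Since `1 / a ≤ 1 / α`, the quadratic functional is continuous on `L²`, so a bound on the dense
set of test functions extends to all of `L²`. -/
theorem two_mul_integral_sub_le_of_test {d : ℕ} {a p : Rd d → ℝ} (ha : Measurable a) {α : ℝ}
    (hα : 0 < α) (hαa : ∀ x, α ≤ a x) (hp : MemLp p 2) {K : ℝ}
    (h : ∀ ψ : testFunctions d, 2 * (∫ x, (ψ : Rd d → ℝ) x * p x) -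
      ∫ x, (ψ : Rd d → ℝ) x ^ 2 / a x ≤ K) {χ : Rd d → ℝ} (hχ : MemLp χ 2) :
    2 * (∫ x, χ x * p x) - ∫ x, χ x ^ 2 / a x ≤ K := by
  have hb0 : ∀ x, 0 < a x := fun x => hα.trans_le (hαa x)
  have hb : ∀ x, |(a x)⁻¹| ≤ α⁻¹ := fun x => by
    rw [abs_of_pos (inv_pos.2 (hb0 x))]
    exact inv_anti₀ hα (hαa x)
  have hbL : ∀ {u : Rd d → ℝ}, MemLp u 2 → MemLp (fun x => (a x)⁻¹ * u x) 2 := fun {u} hu =>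
    hu.of_le_mul (c := α⁻¹) (ha.inv.aestronglyMeasurable.mul hu.1) (ae_of_all _ fun x => by
      rw [norm_mul]
      exact mul_le_mul_of_nonneg_right (hb x) (norm_nonneg _))
  -- The gradient of the functional at `χ`: its exact expansion about `χ` has `W` as linear
  -- coefficient and only a quadratic term beyond it.
  set W : Rd d → ℝ := fun x => 2 * (p x - (a x)⁻¹ * χ x) with hW
  have hWL : MemLp W 2 := (hp.sub (hbL hχ)).const_mul 2
  set N := ‖hWL.toLp W‖
  have key : ∀ δ : ℝ, 0 < δ →
      2 * (∫ x, χ x * p x) - ∫ x, χ x ^ 2 / a x ≤ K + δ * N + α⁻¹ * δ ^ 2 := by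
    intro δ hδ
    obtain ⟨ψ, hψ⟩ := (denseRange_testToL2 d).exists_dist_lt (hχ.toLp χ) hδ
    have hψL := memLp_testFunction ψ
    have hrL : MemLp (fun x => χ x - (ψ : Rd d → ℝ) x) 2 := hχ.sub hψL
    have hrn : ‖hrL.toLp _‖ < δ := by
      rw [dist_eq_norm] at hψ
      exact hψ
    have e1 : 2 * (∫ x, χ x * p x) - ∫ x, χ x ^ 2 / a x =
        (2 * (∫ x, (ψ : Rd d → ℝ) x * p x) - ∫ x, (ψ : Rd d → ℝ) x ^ 2 / a x) +
          (∫ x, (χ x - (ψ : Rd d → ℝ) x) * W x) +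
          ∫ x, (χ x - (ψ : Rd d → ℝ) x) ^ 2 / a x := by
      have hsq : ∀ {u : Rd d → ℝ}, MemLp u 2 → Integrable (fun x => u x ^ 2 / a x) :=
        fun {u} hu => (hu.integrable_mul (hbL hu)).congr (ae_of_all _ fun x => by
          simp only [Pi.mul_apply]; field_simp)
      have i1 : Integrable fun x => 2 * (χ x * p x) := (hχ.integrable_mul hp).const_mul 2
      have i3 : Integrable fun x => 2 * ((ψ : Rd d → ℝ) x * p x) :=
        (hψL.integrable_mul hp).const_mul 2
      have i4 : Integrable fun x => (χ x - (ψ : Rd d → ℝ) x) * W x := hrL.integrable_mul hWL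
      have i5 : Integrable fun x =>
          2 * ((ψ : Rd d → ℝ) x * p x) - (ψ : Rd d → ℝ) x ^ 2 / a x := i3.sub (hsq hψL)
      have i6 : Integrable fun x => 2 * ((ψ : Rd d → ℝ) x * p x) - (ψ : Rd d → ℝ) x ^ 2 / a x +
          (χ x - (ψ : Rd d → ℝ) x) * W x := i5.add i4
      rw [← integral_const_mul, ← integral_const_mul,
        ← integral_sub i1 (hsq hχ), ← integral_sub i3 (hsq hψL),
        ← integral_add i5 i4, ← integral_add i6 (hsq hrL)]
      refine integral_congr_ae (ae_of_all _ fun x => ?_)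
      have := (hb0 x).ne'
      simp only [hW]
      field_simp
      ring
    have e2 : ∫ x, (χ x - (ψ : Rd d → ℝ) x) * W x ≤ δ * N := by
      have : ∫ x, (χ x - (ψ : Rd d → ℝ) x) * W x = inner ℝ (hrL.toLp _) (hWL.toLp W) := by
        rw [L2.inner_def]
        refine integral_congr_ae ?_
        filter_upwards [hrL.coeFn_toLp, hWL.coeFn_toLp] with x h1 h2
        rw [h1, h2]; simp [mul_comm]
      rw [this]
      exact (real_inner_le_norm _ _).trans (mul_le_mul_of_nonneg_right hrn.le (norm_nonneg _))
    have e3 : ∫ x, (χ x - (ψ : Rd d → ℝ) x) ^ 2 / a x ≤ α⁻¹ * δ ^ 2 := by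
      have h1 : ∫ x, (χ x - (ψ : Rd d → ℝ) x) ^ 2 = ‖hrL.toLp _‖ ^ 2 := by
        rw [← real_inner_self_eq_norm_sq, L2.inner_def]
        refine integral_congr_ae ?_
        filter_upwards [hrL.coeFn_toLp] with x h1
        rw [h1]; simp [sq]
      calc ∫ x, (χ x - (ψ : Rd d → ℝ) x) ^ 2 / a x
          ≤ ∫ x, α⁻¹ * (χ x - (ψ : Rd d → ℝ) x) ^ 2 := by
            refine integral_mono_of_nonneg (ae_of_all _ fun x =>
              div_nonneg (sq_nonneg _) (hb0 x).le) (hrL.integrable_sq.const_mul _)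
              (ae_of_all _ fun x => ?_)
            simp only [div_eq_inv_mul]
            exact mul_le_mul_of_nonneg_right ((le_abs_self _).trans (hb x)) (sq_nonneg _)
        _ ≤ α⁻¹ * δ ^ 2 := by
            rw [integral_const_mul, h1]
            gcongr
    rw [e1]
    linarith [h ψ]
  have hlim : Tendsto (fun δ : ℝ => K + δ * N + α⁻¹ * δ ^ 2) (𝓝[>] 0) (𝓝 K) := by
    have : Continuous (fun δ : ℝ => K + δ * N + α⁻¹ * δ ^ 2) := by fun_prop
    have h2 := (this.tendsto 0).mono_left (nhdsWithin_le_nhds (s := Ioi 0))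
    simpa using h2
  exact ge_of_tendsto hlim (eventually_nhdsWithin_of_forall fun δ hδ => key δ hδ)

/-- The quadratic functional `∫ a p²` is the supremum over test functions of its dual form. -/
theorem lintegral_mul_sq_le_of_test {d : ℕ} {a p : Rd d → ℝ} (ha : Measurable a) {α : ℝ}
    (hα : 0 < α) (hαa : ∀ x, α ≤ a x) (hpm : Measurable p) (hp : MemLp p 2) {K : ℝ}
    (h : ∀ ψ : testFunctions d, 2 * (∫ x, (ψ : Rd d → ℝ) x * p x) -
      ∫ x, (ψ : Rd d → ℝ) x ^ 2 / a x ≤ K) :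
    ∫⁻ x, ENNReal.ofReal (a x * p x ^ 2) ≤ ENNReal.ofReal K := by
  have hb0 : ∀ x, 0 < a x := fun x => hα.trans_le (hαa x)
  -- The optimal test is `a p`, which need not be in `L²` when `a` is unbounded. The truncation `min
  -- a k * p` is, and because `min a k ≤ a` it still gives at least `∫ min a k * p²`; then `k` tends
  -- to infinity monotonically.
  have key : ∀ k : ℕ, ∫⁻ x, ENNReal.ofReal (min (a x) k * p x ^ 2) ≤ ENNReal.ofReal K := by
    intro k
    have hmin0 : ∀ x, 0 ≤ min (a x) (k : ℝ) := fun x => le_min (hb0 x).le (Nat.cast_nonneg k)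
    have hχ : MemLp (fun x => min (a x) (k : ℝ) * p x) 2 :=
      hp.of_le_mul (c := k) ((ha.min measurable_const).mul hpm).aestronglyMeasurable
        (ae_of_all _ fun x => by
          rw [norm_mul, Real.norm_of_nonneg (hmin0 x)]
          exact mul_le_mul_of_nonneg_right (min_le_right _ _) (norm_nonneg _))
    have h1 := two_mul_integral_sub_le_of_test ha hα hαa hp h hχ
    have hint : Integrable (fun x => min (a x) (k : ℝ) * p x ^ 2) :=
      (hχ.integrable_mul hp).congr (ae_of_all _ fun x => by simp only [Pi.mul_apply]; ring)
    rw [← ofReal_integral_eq_lintegral_ofReal hint (ae_of_all _ fun x =>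
      mul_nonneg (hmin0 x) (sq_nonneg _))]
    refine ENNReal.ofReal_le_ofReal (le_trans ?_ h1)
    have h2 : ∫ x, (min (a x) (k : ℝ) * p x) ^ 2 / a x ≤ ∫ x, min (a x) (k : ℝ) * p x ^ 2 := by
      refine integral_mono_of_nonneg (ae_of_all _ fun x => div_nonneg (sq_nonneg _) (hb0 x).le)
        hint (ae_of_all _ fun x => ?_)
      simp only
      rw [div_le_iff₀ (hb0 x)]
      have : min (a x) (k : ℝ) * p x ^ 2 * min (a x) k ≤ min (a x) (k : ℝ) * p x ^ 2 * a x :=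
        mul_le_mul_of_nonneg_left (min_le_left _ _) (mul_nonneg (hmin0 x) (sq_nonneg _))
      nlinarith [this]
    have h3 : ∫ x, min (a x) (k : ℝ) * p x * p x = ∫ x, min (a x) (k : ℝ) * p x ^ 2 :=
      integral_congr_ae (ae_of_all _ fun x => by ring)
    rw [h3]
    linarith
  have hmono : ∀ᵐ x : Rd d, Monotone fun k : ℕ => ENNReal.ofReal (min (a x) (k : ℝ) * p x ^ 2) :=
    ae_of_all _ fun x i j hij => ENNReal.ofReal_le_ofReal
      (mul_le_mul_of_nonneg_right (min_le_min_left _ (by exact_mod_cast hij)) (sq_nonneg _))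
  have hlim : ∀ᵐ x : Rd d, Tendsto (fun k : ℕ => ENNReal.ofReal (min (a x) (k : ℝ) * p x ^ 2))
      atTop (𝓝 (ENNReal.ofReal (a x * p x ^ 2))) := ae_of_all _ fun x => by
    refine tendsto_const_nhds.congr' ?_
    obtain ⟨k₀, hk₀⟩ := exists_nat_ge (a x)
    filter_upwards [eventually_ge_atTop k₀] with k hk
    rw [min_eq_left (hk₀.trans (by exact_mod_cast hk))]
  exact le_of_tendsto' (lintegral_tendsto_of_tendsto_of_monotone (fun k =>
    (((ha.min measurable_const).mul (hpm.pow_const 2)).ennreal_ofReal).aemeasurable)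
    hmono hlim) key

end

/-! ### The Jensen gap and the limit of difference quotients. -/

noncomputable section

/-- The integrated Jensen gap of `g` on segments in the direction `h`. -/
def segGap {d : ℕ} (φ : ℝ → ℝ) (g : Rd d → ℝ) (h : Rd d) : ℝ≥0∞ :=
  ∫⁻ x, ∫⁻ s, ENNReal.ofReal ((g (x + s • h) - segAvg g h x) ^ 2 *
    taylorWeight φ (segAvg g h x) (g (x + s • h))) ∂unitMeasure

theorem locallyIntegrable_of_lintegral_sq {d : ℕ} {g : Rd d → ℝ} (hg : Measurable g)
    (hgL : ∀ R : ℝ, ∫⁻ x in Metric.ball 0 R, ‖g x‖ₑ ^ 2 < ⊤) : LocallyIntegrable g :=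
  locallyIntegrable_of_integrableOn_ball fun R => by
    have : IsFiniteMeasure (volume.restrict (Metric.ball (0 : Rd d) R)) :=
      ⟨by simpa using measure_ball_lt_top⟩
    exact ((memLp_two_iff hg.aestronglyMeasurable).2 (hgL R)).integrable (by norm_num)

theorem tendsto_lintegral_enorm_of_sq {d : ℕ} {r : ℕ → Rd d → ℝ} (hr : ∀ n, Measurable (r n))
    {R : ℝ} (h : Tendsto (fun n => ∫⁻ x in Metric.ball 0 R, ‖r n x‖ₑ ^ 2) atTop (𝓝 0)) :
    Tendsto (fun n => ∫⁻ x in Metric.ball 0 R, ‖r n x‖ₑ) atTop (𝓝 0) := by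
  have h1 := (tendsto_eLpNorm_two_iff (f := r)).2 h
  set V := (volume.restrict (Metric.ball (0 : Rd d) R) univ) ^
    (1 / (1 : ℝ≥0∞).toReal - 1 / (2 : ℝ≥0∞).toReal) with hV
  have hVf : V ≠ ⊤ := by
    refine (ENNReal.rpow_lt_top_of_nonneg (by norm_num) ?_).ne
    simpa using measure_ball_lt_top.ne
  have h2 : Tendsto (fun n => eLpNorm (r n) 2 (volume.restrict (Metric.ball 0 R)) * V) atTop
      (𝓝 0) := by
    simpa using ENNReal.Tendsto.mul_const h1 (Or.inr hVf)
  refine tendsto_of_tendsto_of_tendsto_of_le_of_le tendsto_const_nhds h2 (fun _ => zero_le)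
    (fun n => ?_)
  rw [← eLpNorm_one_eq_lintegral_enorm]
  exact eLpNorm_le_eLpNorm_mul_rpow_measure_univ (by norm_num) (hr n).aestronglyMeasurable

/-- The linear term of the dual form thus carries the same factor 1/12 as the quadratic one in
`integral_sub_half_sq`, so it factors out of the limit. -/
theorem integral_id_mul_sub_half : ∫ s, (s - 1 / 2) * s ∂unitMeasure = 1 / 12 := by
  have h : ∀ s : ℝ, (s - 1 / 2) * s = s ^ 2 - 1 / 2 * s := fun s => by ring
  simp_rw [h]
  rw [integral_unitMeasure, intervalIntegral.integral_sub (by simp) (by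
    exact Continuous.intervalIntegrable (by fun_prop) _ _), intervalIntegral.integral_const_mul,
    integral_pow, integral_id]
  norm_num

theorem exists_lipschitz_test {d : ℕ} {ψ : Rd d → ℝ} (hψ : ContDiff ℝ ∞ ψ)
    (hc : HasCompactSupport ψ) : ∃ C : ℝ, 0 ≤ C ∧ ∀ x y, |ψ x - ψ y| ≤ C * ‖x - y‖ := by
  obtain ⟨C, hC⟩ := hψ.lipschitzWith_of_hasCompactSupport hc (by norm_num)
  exact ⟨C, C.2, fun x y => by simpa [dist_eq_norm] using hC.dist_le_mul x y⟩

/-- Difference quotients on segments converge to the distributional derivative. -/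
theorem tendsto_integral_diff_quotient {d : ℕ} {g : Rd d → ℝ} {G : ℕ → Rd d → ℝ}
    (hg : Measurable g) (hG : ∀ n, Measurable (G n))
    (hgL : ∀ R : ℝ, ∫⁻ x in Metric.ball 0 R, ‖g x‖ₑ ^ 2 < ⊤)
    (hGl : ∀ n, LocallyIntegrable (G n))
    (hconv : ∀ R : ℝ, Tendsto (fun n => ∫⁻ x in Metric.ball 0 R, ‖G n x - g x‖ₑ ^ 2) atTop (𝓝 0))
    {ε : ℕ → ℝ} (hε : ∀ n, 0 < ε n) (hε0 : Tendsto ε atTop (𝓝 0)) (z : Rd d)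
    (ψ : testFunctions d) :
    Tendsto (fun n => ∫ q : Rd d × ℝ, (ψ : Rd d → ℝ) q.1 * ((q.2 - 1 / 2) / ε n) *
      G n (q.1 + q.2 • ε n • z) ∂(volume.prod unitMeasure)) atTop
      (𝓝 (1 / 12 * dirPairing (locallyIntegrable_of_lintegral_sq hg hgL) z ψ)) := by
  have hgl := locallyIntegrable_of_lintegral_sq hg hgL
  obtain ⟨ψ, hψ, hc⟩ := ψ
  obtain ⟨C, R, hC0, hR0, hC, hR⟩ := exists_bound_of_hasCompactSupport hψ.continuous hc
  obtain ⟨L, hL0, hL⟩ := exists_lipschitz_test hψ hc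
  have hψc := hψ.continuous
  simp only
  -- Translation puts the shift on `ψ`, and subtracting `ψ q.1` costs nothing since `s - 1/2` has
  -- mean 0. What remains is a difference quotient of a Lipschitz function, bounded uniformly in
  -- `n`, and supported in a fixed ball once `ε n < 1`.
  set K : ℕ → Rd d × ℝ → ℝ := fun n q =>
    (q.2 - 1 / 2) * ((ψ (q.1 - q.2 • ε n • z) - ψ q.1) / ε n) with hK
  have hhalf : ∀ s ∈ Ioc (0 : ℝ) 1, |s - 1 / 2| ≤ 1 := fun s hs => by
    rw [abs_le]; constructor <;> linarith [hs.1, hs.2]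
  have hKm : ∀ n, Measurable (K n) := fun n => Continuous.measurable (by fun_prop)
  have hKb : ∀ n q, q.2 ∈ Ioc (0 : ℝ) 1 → |K n q| ≤ L * ‖z‖ := by
    intro n q hq
    have h1 := hL (q.1 - q.2 • ε n • z) q.1
    have h2 : ‖q.1 - q.2 • ε n • z - q.1‖ ≤ ε n * ‖z‖ := by
      rw [sub_sub_cancel_left, norm_neg]
      refine (norm_smul_lt_of_mem_Ioc hq _).trans (le_of_eq ?_)
      rw [norm_smul, Real.norm_of_nonneg (hε n).le]
    rw [abs_mul, abs_div, abs_of_pos (hε n)]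
    have h3 : |ψ (q.1 - q.2 • ε n • z) - ψ q.1| / ε n ≤ L * ‖z‖ := by
      rw [div_le_iff₀ (hε n)]
      calc _ ≤ L * ‖q.1 - q.2 • ε n • z - q.1‖ := h1
        _ ≤ L * (ε n * ‖z‖) := by gcongr
        _ = L * ‖z‖ * ε n := by ring
    calc |q.2 - 1 / 2| * (|ψ (q.1 - q.2 • ε n • z) - ψ q.1| / ε n)
        ≤ 1 * (L * ‖z‖) := mul_le_mul (hhalf _ hq) h3
          (div_nonneg (abs_nonneg _) (hε n).le) zero_le_one
      _ = L * ‖z‖ := one_mul _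
  have hKz : ∀ n, ε n < 1 → ∀ q : Rd d × ℝ, q.2 ∈ Ioc (0 : ℝ) 1 → R + ‖z‖ ≤ ‖q.1‖ →
      K n q = 0 := by
    intro n hn q hq h
    have h2 : ‖q.2 • ε n • z‖ ≤ ‖z‖ := by
      refine (norm_smul_lt_of_mem_Ioc hq _).trans ?_
      rw [norm_smul, Real.norm_of_nonneg (hε n).le]
      exact mul_le_of_le_one_left (norm_nonneg _) hn.le
    have h3 := norm_sub_norm_le q.1 (q.2 • ε n • z)
    simp only [hK]
    rw [hR q.1 (by linarith [norm_nonneg z]), hR _ (by linarith)]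
    simp
  have hev : ∀ᶠ n in atTop, ε n < 1 := hε0.eventually_lt_const one_pos
  have hKint : ∀ n, ε n < 1 → ∀ k : Rd d → ℝ, Measurable k → LocallyIntegrable k →
      Integrable (fun q : Rd d × ℝ => K n q * k q.1) (volume.prod unitMeasure) := by
    intro n hn k hkm hk
    simpa using integrable_mul_segment hkm hk 0 (hKm n) (hKb n) (hKz n hn)
  have hrew : ∀ n, ε n < 1 → ∫ q : Rd d × ℝ, ψ q.1 * ((q.2 - 1 / 2) / ε n) *
      G n (q.1 + q.2 • ε n • z) ∂(volume.prod unitMeasure) =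
      ∫ q : Rd d × ℝ, K n q * G n q.1 ∂(volume.prod unitMeasure) := by
    intro n hn
    have i1 : Integrable (fun q : Rd d × ℝ => ψ q.1 * ((q.2 - 1 / 2) / ε n) *
        G n (q.1 + q.2 • ε n • z)) (volume.prod unitMeasure) := by
      refine integrable_mul_segment (hG n) (hGl n) (ε n • z) (C := C * (ε n)⁻¹) (R := R)
        (K := fun q => ψ q.1 * ((q.2 - 1 / 2) / ε n)) (Continuous.measurable (by fun_prop))
        (fun q hq => ?_) (fun q _ h => by simp [hR _ h])
      rw [abs_mul, abs_div, abs_of_pos (hε n), div_eq_mul_inv]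
      refine mul_le_mul (hC _) ?_ (mul_nonneg (abs_nonneg _) (inv_pos.2 (hε n)).le) hC0
      exact mul_le_of_le_one_left (inv_pos.2 (hε n)).le (hhalf _ hq)
    rw [integral_prod_symm _ i1, integral_prod_symm _ (hKint n hn _ (hG n) (hGl n))]
    have e1 : ∀ s : ℝ, ∫ x, ψ x * ((s - 1 / 2) / ε n) * G n (x + s • ε n • z) =
        (∫ x, K n (x, s) * G n x) + (s - 1 / 2) * ((∫ x, ψ x * G n x) / ε n) := by
      intro s
      have htr : HasCompactSupport (fun x => ψ (x - s • ε n • z)) := by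
        simpa [sub_eq_add_neg, Function.comp_def] using
          hc.comp_homeomorph (Homeomorph.addRight (-(s • ε n • z)))
      have j1 : Integrable (fun x => ψ (x - s • ε n • z) * G n x) :=
        integrable_test_mul (by fun_prop) htr (hGl n)
      have j2 : Integrable (fun x => ψ x * G n x) := integrable_test_mul hψc hc (hGl n)
      have e2 : ∫ x, ψ x * ((s - 1 / 2) / ε n) * G n (x + s • ε n • z) =
          ((s - 1 / 2) / ε n) * ∫ x, ψ (x - s • ε n • z) * G n x := by
        rw [← integral_const_mul, ← integral_add_right_eq_self
          (fun x => (s - 1 / 2) / ε n * (ψ (x - s • ε n • z) * G n x)) (s • ε n • z)]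
        refine integral_congr_ae (ae_of_all _ fun x => ?_)
        simp only [add_sub_cancel_right]; ring
      have e3 : ∫ x, K n (x, s) * G n x = ((s - 1 / 2) / ε n) *
          ((∫ x, ψ (x - s • ε n • z) * G n x) - ∫ x, ψ x * G n x) := by
        rw [← integral_sub j1 j2, ← integral_const_mul]
        refine integral_congr_ae (ae_of_all _ fun x => ?_)
        simp only [hK]; ring
      rw [e2, e3]; ring
    simp only [e1]
    rw [integral_add (hKint n hn _ (hG n) (hGl n)).integral_prod_right
      ((by
        have : Integrable (fun s : ℝ => s - 1 / 2) unitMeasure :=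
          (Continuous.integrableOn_Ioc (by fun_prop))
        exact this.mul_const _)), integral_mul_const, integral_sub_half]
    simp
  have hlim : 1 / 12 * dirPairing hgl z ⟨ψ, hψ, hc⟩ =
      ∫ q : Rd d × ℝ, ((q.2 - 1 / 2) * (-(q.2 * fderiv ℝ ψ q.1 z))) * g q.1
        ∂(volume.prod unitMeasure) := by
    have h1 := integral_prod_mul (μ := (volume : Measure (Rd d))) (ν := unitMeasure)
      (fun x => fderiv ℝ ψ x z * g x) (fun s : ℝ => (s - 1 / 2) * s)
    rw [integral_id_mul_sub_half] at h1
    simp only [dirPairing, LinearMap.coe_mk, AddHom.coe_mk]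
    rw [mul_neg, mul_comm, ← h1, ← integral_neg]
    refine integral_congr_ae (ae_of_all _ fun q => ?_)
    simp only; ring
  rw [hlim]
  have t1 : Tendsto (fun n => ∫ q : Rd d × ℝ, K n q * g q.1 ∂(volume.prod unitMeasure)) atTop
      (𝓝 (∫ q : Rd d × ℝ, ((q.2 - 1 / 2) * (-(q.2 * fderiv ℝ ψ q.1 z))) * g q.1
        ∂(volume.prod unitMeasure))) := by
    have hn : IntegrableOn (fun x => ‖g x‖) (Metric.ball 0 (R + ‖z‖)) :=
      (LocallyIntegrable.integrableOn_ball hgl (R + ‖z‖)).norm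
    have hb : Integrable (fun q : Rd d × ℝ => (L * ‖z‖) *
        ((Metric.ball (0 : Rd d) (R + ‖z‖)).indicator (fun x => ‖g x‖) q.1))
        (volume.prod unitMeasure) :=
      ((hn.integrable_indicator measurableSet_ball).comp_fst unitMeasure).const_mul _
    refine tendsto_integral_filter_of_dominated_convergence _ ?_ ?_ hb ?_
    · exact Eventually.of_forall fun n =>
        ((hKm n).mul (hg.comp measurable_fst)).aestronglyMeasurable
    · filter_upwards [hev] with n hn
      filter_upwards [ae_snd_mem_Ioc] with q hq
      by_cases h : R + ‖z‖ ≤ ‖q.1‖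
      · rw [hKz n hn q hq h, zero_mul, norm_zero]
        exact mul_nonneg (by positivity) (indicator_nonneg (fun _ _ => norm_nonneg _) _)
      · rw [indicator_of_mem (by simpa using h), norm_mul]
        exact mul_le_mul_of_nonneg_right (hKb n q hq) (norm_nonneg _)
    · refine ae_of_all _ fun q => ?_
      refine Tendsto.mul_const _ (Tendsto.const_mul _ ?_)
      have hd : HasDerivAt (fun t : ℝ => ψ (q.1 + t • (-(q.2 • z))))
          (fderiv ℝ ψ q.1 (-(q.2 • z))) 0 := by
        have h1 : HasDerivAt (fun t : ℝ => q.1 + t • (-(q.2 • z))) (-(q.2 • z)) 0 := by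
          simpa using ((hasDerivAt_id (0 : ℝ)).smul_const (-(q.2 • z))).const_add q.1
        have h2 := ((hψ.differentiable (by norm_num)) (q.1 + (0 : ℝ) • (-(q.2 • z))))
          |>.hasFDerivAt.comp_hasDerivAt (0 : ℝ) h1
        refine h2.congr_deriv (by simp)
      have hε' : Tendsto ε atTop (𝓝[≠] 0) :=
        tendsto_nhdsWithin_iff.2 ⟨hε0, Eventually.of_forall fun n => (hε n).ne'⟩
      have h3 := (hd.tendsto_slope_zero).comp hε'
      refine Tendsto.congr (fun n => ?_) (h3.trans (le_of_eq ?_))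
      · simp only [Function.comp_apply, zero_add, zero_smul, add_zero, smul_eq_mul]
        rw [div_eq_inv_mul, smul_neg, smul_comm, sub_eq_add_neg q.1]
      · simp
  -- Replacing `G n` by its limit is harmless: `K n` is bounded with support in a fixed ball, where
  -- `G n` converges in `L¹`.
  have t2 : Tendsto (fun n => ∫ q : Rd d × ℝ, K n q * (G n q.1 - g q.1)
      ∂(volume.prod unitMeasure)) atTop (𝓝 0) := by
    have h1 := tendsto_lintegral_enorm_of_sq (fun n => (hG n).sub hg) (hconv (R + ‖z‖))
    have h2 : Tendsto (fun n => ENNReal.ofReal (L * ‖z‖) *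
        ∫⁻ x in Metric.ball 0 (R + ‖z‖), ‖(G n - g) x‖ₑ) atTop (𝓝 0) := by
      simpa using ENNReal.Tendsto.const_mul h1 (Or.inr ENNReal.ofReal_ne_top)
    rw [tendsto_zero_iff_enorm_tendsto_zero]
    refine tendsto_of_tendsto_of_tendsto_of_le_of_le' tendsto_const_nhds h2
      (Eventually.of_forall fun _ => zero_le) ?_
    filter_upwards [hev] with n hn
    refine (enorm_integral_le_lintegral_enorm _).trans ?_
    have hm : Measurable fun q : Rd d × ℝ => (Metric.ball (0 : Rd d) (R + ‖z‖)).indicator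
        (fun x => ‖(G n - g) x‖ₑ) q.1 :=
      ((((hG n).sub hg).enorm).indicator measurableSet_ball).comp measurable_fst
    calc ∫⁻ q : Rd d × ℝ, ‖K n q * (G n q.1 - g q.1)‖ₑ ∂(volume.prod unitMeasure)
        ≤ ∫⁻ q : Rd d × ℝ, ENNReal.ofReal (L * ‖z‖) *
          (Metric.ball (0 : Rd d) (R + ‖z‖)).indicator (fun x => ‖(G n - g) x‖ₑ) q.1
          ∂(volume.prod unitMeasure) := by
          refine lintegral_mono_ae ?_
          filter_upwards [ae_snd_mem_Ioc] with q hq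
          by_cases h : R + ‖z‖ ≤ ‖q.1‖
          · rw [hKz n hn q hq h]; simp
          · rw [indicator_of_mem (by simpa using h), enorm_mul]
            gcongr
            · rw [Real.enorm_eq_ofReal_abs]
              exact ENNReal.ofReal_le_ofReal (hKb n q hq)
            · rfl
      _ = ENNReal.ofReal (L * ‖z‖) * ∫⁻ x in Metric.ball 0 (R + ‖z‖), ‖(G n - g) x‖ₑ := by
          rw [lintegral_const_mul _ hm,
            ← lintegral_indicator measurableSet_ball,
            lintegral_prod _ hm.aemeasurable]
          simp
  have t3 := t1.add t2
  rw [add_zero] at t3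
  refine t3.congr' ?_
  filter_upwards [hev] with n hn
  have i1 : Integrable (fun q : Rd d × ℝ => K n q * (G n q.1 - g q.1))
    (volume.prod unitMeasure) := hKint n hn _ ((hG n).sub hg) ((hGl n).sub hgl)
  rw [hrew n hn, ← integral_add (hKint n hn _ hg hgl) i1]
  refine integral_congr_ae (ae_of_all _ fun q => ?_)
  simp only; ring

end

/-! ### The lower bound in a fixed direction. -/

noncomputable section

theorem ofReal_integral_le_lintegral {X : Type*} [MeasurableSpace X] {μ : Measure X} {k : X → ℝ}
    (hk : Integrable k μ) : ENNReal.ofReal (∫ x, k x ∂μ) ≤ ∫⁻ x, ENNReal.ofReal (k x) ∂μ := by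
  have h1 : ∫⁻ x, ENNReal.ofReal (k x) ∂μ = ∫⁻ x, ENNReal.ofReal (max (k x) 0) ∂μ :=
    lintegral_congr fun x => by simp
  rw [h1, ← ofReal_integral_eq_lintegral_ofReal hk.pos_part (ae_of_all _ fun x => le_max_right _ _)]
  exact ENNReal.ofReal_le_ofReal (integral_mono hk hk.pos_part fun x => le_max_left _ _)

theorem measurable_segGap_integrand {d : ℕ} {φ : ℝ → ℝ} (hφ : Continuous φ) {g : Rd d → ℝ}
    (hg : Measurable g) (h : Rd d) : Measurable fun q : Rd d × ℝ =>
      (g (q.1 + q.2 • h) - segAvg g h q.1) ^ 2 *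
        taylorWeight φ (segAvg g h q.1) (g (q.1 + q.2 • h)) := by
  have h1 : Measurable fun q : Rd d × ℝ => segAvg g h q.1 :=
    (measurable_segAvg hg h).comp measurable_fst
  have h2 := measurable_comp_add_smul hg h
  exact ((h2.sub h1).pow_const 2).mul ((continuous_taylorWeight hφ).measurable.comp (h1.prodMk h2))

theorem segGap_eq_lintegral_prod {d : ℕ} {φ : ℝ → ℝ} (hφ : Continuous φ) {g : Rd d → ℝ}
    (hg : Measurable g) (h : Rd d) : segGap φ g h = ∫⁻ q : Rd d × ℝ,
      ENNReal.ofReal ((g (q.1 + q.2 • h) - segAvg g h q.1) ^ 2 *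
        taylorWeight φ (segAvg g h q.1) (g (q.1 + q.2 • h))) ∂(volume.prod unitMeasure) := by
  rw [lintegral_prod _ (measurable_segGap_integrand hφ hg h).ennreal_ofReal.aemeasurable]
  rfl

/-- Pointwise this is `y² a ≥ 2yw - w² / a` with `y` the deviation of `g` from its mean and `w = ε
ψ(x)(s - 1/2)`. The choice of `w` imitates the expected profile of the deviation, which is affine in
`s` with mean 0. -/
theorem ofReal_sub_le_segGap_div {d : ℕ} {φ : ℝ → ℝ} (hφ : Continuous φ) {α : ℝ} (hα : 0 < α)
    (hαφ : ∀ s, α ≤ φ s) {g : Rd d → ℝ} (hg : Measurable g) (hgl : LocallyIntegrable g)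
    {ε : ℝ} (hε : 0 < ε) (z : Rd d) (ψ : testFunctions d) :
    ENNReal.ofReal (2 * (∫ q : Rd d × ℝ, (ψ : Rd d → ℝ) q.1 * ((q.2 - 1 / 2) / ε) *
      g (q.1 + q.2 • ε • z) ∂(volume.prod unitMeasure)) -
      ∫ q : Rd d × ℝ, (ψ : Rd d → ℝ) q.1 ^ 2 * (q.2 - 1 / 2) ^ 2 *
        (taylorWeight φ (segAvg g (ε • z) q.1) (g (q.1 + q.2 • ε • z)))⁻¹
        ∂(volume.prod unitMeasure)) ≤ segGap φ g (ε • z) / ENNReal.ofReal (ε ^ 2) := by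
  obtain ⟨ψ, hψ, hc⟩ := ψ
  simp only
  obtain ⟨C, R, hC0, hR0, hC, hR⟩ := exists_bound_of_hasCompactSupport hψ.continuous hc
  have hψc := hψ.continuous
  have hhalf : ∀ s ∈ Ioc (0 : ℝ) 1, |s - 1 / 2| ≤ 1 := fun s hs => by
    rw [abs_le]; constructor <;> linarith [hs.1, hs.2]
  set A : Rd d × ℝ → ℝ := fun q => taylorWeight φ (segAvg g (ε • z) q.1) (g (q.1 + q.2 • ε • z))
    with hA
  have hAα : ∀ q, α / 2 ≤ A q := fun q => le_taylorWeight hφ hαφ _ _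
  have hA0 : ∀ q, 0 < A q := fun q => (half_pos hα).trans_le (hAα q)
  have hmm : Measurable fun q : Rd d × ℝ => segAvg g (ε • z) q.1 :=
    (measurable_segAvg hg (ε • z)).comp measurable_fst
  have hgm := measurable_comp_add_smul hg (ε • z)
  have hAm : Measurable A := (continuous_taylorWeight hφ).measurable.comp (hmm.prodMk hgm)
  have i1 : Integrable (fun q : Rd d × ℝ => ψ q.1 * ((q.2 - 1 / 2) / ε) *
      g (q.1 + q.2 • ε • z)) (volume.prod unitMeasure) := by
    refine integrable_mul_segment hg hgl (ε • z) (C := C * ε⁻¹) (R := R)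
      (K := fun q => ψ q.1 * ((q.2 - 1 / 2) / ε)) (Continuous.measurable (by fun_prop))
      (fun q hq => ?_) (fun q _ h => by simp [hR _ h])
    rw [abs_mul, abs_div, abs_of_pos hε, div_eq_mul_inv]
    refine mul_le_mul (hC _) ?_ (mul_nonneg (abs_nonneg _) (inv_pos.2 hε).le) hC0
    exact mul_le_of_le_one_left (inv_pos.2 hε).le (hhalf _ hq)
  have is : Integrable (fun s : ℝ => (s - 1 / 2) / ε) unitMeasure :=
    Continuous.integrableOn_Ioc (by fun_prop)
  have i2 : Integrable (fun q : Rd d × ℝ => (ψ q.1 * segAvg g (ε • z) q.1) * ((q.2 - 1 / 2) / ε))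
      (volume.prod unitMeasure) :=
    (integrable_test_mul hψc hc (locallyIntegrable_segAvg hg hgl _)).mul_prod is
  -- The mean over the segment does not depend on `s`, so it drops out of the linear term.
  have hz : ∫ q : Rd d × ℝ, (ψ q.1 * segAvg g (ε • z) q.1) * ((q.2 - 1 / 2) / ε)
      ∂(volume.prod unitMeasure) = 0 := by
    rw [integral_prod_mul (fun x => ψ x * segAvg g (ε • z) x) (fun s : ℝ => (s - 1 / 2) / ε),
      integral_div, integral_sub_half]
    simp
  have i3 : Integrable (fun q : Rd d × ℝ => ψ q.1 ^ 2 * (q.2 - 1 / 2) ^ 2 * (A q)⁻¹)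
      (volume.prod unitMeasure) := by
    have h1 : Integrable (fun q : Rd d × ℝ => ψ q.1 ^ 2 * (q.2 - 1 / 2) ^ 2)
        (volume.prod unitMeasure) :=
      ((hψc.memLp_of_hasCompactSupport (p := 2) hc).integrable_sq).mul_prod
        (Continuous.integrableOn_Ioc (by fun_prop) : Integrable (fun s : ℝ => (s - 1 / 2) ^ 2)
          unitMeasure)
    refine h1.mul_bdd (c := (α / 2)⁻¹) hAm.inv.aestronglyMeasurable (ae_of_all _ fun q => ?_)
    rw [Real.norm_eq_abs, abs_of_pos (inv_pos.2 (hA0 q))]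
    exact inv_anti₀ (half_pos hα) (hAα q)
  set X : Rd d × ℝ → ℝ := fun q => 2 * (ψ q.1 * ((q.2 - 1 / 2) / ε) * g (q.1 + q.2 • ε • z) -
    (ψ q.1 * segAvg g (ε • z) q.1) * ((q.2 - 1 / 2) / ε)) -
      ψ q.1 ^ 2 * (q.2 - 1 / 2) ^ 2 * (A q)⁻¹ with hX
  have i4 : Integrable (fun q => 2 * (ψ q.1 * ((q.2 - 1 / 2) / ε) * g (q.1 + q.2 • ε • z) -
    (ψ q.1 * segAvg g (ε • z) q.1) * ((q.2 - 1 / 2) / ε))) (volume.prod unitMeasure) :=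
    (i1.sub i2).const_mul 2
  have hXi : Integrable X (volume.prod unitMeasure) := i4.sub i3
  have hXe : ∫ q, X q ∂(volume.prod unitMeasure) =
      2 * (∫ q : Rd d × ℝ, ψ q.1 * ((q.2 - 1 / 2) / ε) *
      g (q.1 + q.2 • ε • z) ∂(volume.prod unitMeasure)) -
      ∫ q : Rd d × ℝ, ψ q.1 ^ 2 * (q.2 - 1 / 2) ^ 2 * (A q)⁻¹ ∂(volume.prod unitMeasure) := by
    rw [hX, integral_sub i4 i3, integral_const_mul, integral_sub i1 i2, hz, sub_zero]
  rw [← hXe]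
  refine (ofReal_integral_le_lintegral hXi).trans ?_
  rw [segGap_eq_lintegral_prod hφ hg, ENNReal.le_div_iff_mul_le (Or.inl (by simpa using hε.ne'))
    (Or.inl ENNReal.ofReal_ne_top), ← lintegral_mul_const' _ _ ENNReal.ofReal_ne_top]
  refine lintegral_mono fun q => ?_
  rw [← ENNReal.ofReal_mul' (sq_nonneg _)]
  apply ENNReal.ofReal_le_ofReal
  have hAq := hA0 q
  change X q * ε ^ 2 ≤ (g (q.1 + q.2 • ε • z) - segAvg g (ε • z) q.1) ^ 2 * A q
  simp only [hX]
  generalize A q = a at *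
  generalize g (q.1 + q.2 • ε • z) = y
  generalize segAvg g (ε • z) q.1 = m
  have e : (y - m) ^ 2 * a - (2 * (ψ q.1 * ((q.2 - 1 / 2) / ε) * y -
      ψ q.1 * m * ((q.2 - 1 / 2) / ε)) - ψ q.1 ^ 2 * (q.2 - 1 / 2) ^ 2 * a⁻¹) * ε ^ 2 =
      ((y - m) * a - ε * ψ q.1 * (q.2 - 1 / 2)) ^ 2 / a := by
    field_simp
    ring
  have : 0 ≤ ((y - m) * a - ε * ψ q.1 * (q.2 - 1 / 2)) ^ 2 / a := by positivity
  linarith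

/-- Both terms of the dual form converge: the linear one as a difference quotient, the quadratic one
because the reciprocal weights are continuous and bounded by `2 / α`. No upper bound on `φ` enters.
-/
theorem ofReal_le_liminf_segGap {d : ℕ} {φ : ℝ → ℝ} (hφ : Continuous φ) {α : ℝ} (hα : 0 < α)
    (hαφ : ∀ s, α ≤ φ s) {g : Rd d → ℝ} {G : ℕ → Rd d → ℝ}
    (hg : Measurable g) (hG : ∀ n, Measurable (G n))
    (hgL : ∀ R : ℝ, ∫⁻ x in Metric.ball 0 R, ‖g x‖ₑ ^ 2 < ⊤)
    (hGl : ∀ n, LocallyIntegrable (G n))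
    (hconv : ∀ R : ℝ, Tendsto (fun n => ∫⁻ x in Metric.ball 0 R, ‖G n x - g x‖ₑ ^ 2) atTop (𝓝 0))
    {ε : ℕ → ℝ} (hε : ∀ n, 0 < ε n) (hε0 : Tendsto ε atTop (𝓝 0)) (z : Rd d)
    (ψ : testFunctions d) :
    ENNReal.ofReal (1 / 12 * (2 * dirPairing (locallyIntegrable_of_lintegral_sq hg hgL) z ψ -
      ∫ x, (ψ : Rd d → ℝ) x ^ 2 / (φ (g x) / 2))) ≤
      liminf (fun n => segGap φ (G n) (ε n • z) / ENNReal.ofReal (ε n ^ 2)) atTop := by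
  have hpos : ∀ q : ℝ × ℝ, 0 < taylorWeight φ q.1 q.2 := fun q =>
    (half_pos hα).trans_le (le_taylorWeight hφ hαφ _ _)
  have t1 := tendsto_integral_diff_quotient hg hG hgL hGl hconv hε hε0 z ψ
  have hh : Tendsto (fun n => ε n • z) atTop (𝓝 0) := by
    simpa using hε0.smul_const z
  have t2 := tendsto_integral_segment hg hG hgL hconv hh
    (B := fun q => (taylorWeight φ q.1 q.2)⁻¹)
    ((continuous_taylorWeight hφ).inv₀ fun q => (hpos q).ne') (C := (α / 2)⁻¹)
    (fun q => by
      rw [abs_of_pos (inv_pos.2 (hpos q))]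
      exact inv_anti₀ (half_pos hα) (le_taylorWeight hφ hαφ _ _))
    (w := fun x => (ψ : Rd d → ℝ) x ^ 2) (memLp_testFunction ψ).integrable_sq
  have t3 := ENNReal.tendsto_ofReal ((t1.const_mul 2).sub t2)
  have e : 2 * (1 / 12 * dirPairing (locallyIntegrable_of_lintegral_sq hg hgL) z ψ) -
      1 / 12 * ∫ x, (ψ : Rd d → ℝ) x ^ 2 * (taylorWeight φ (g x) (g x))⁻¹ =
      1 / 12 * (2 * dirPairing (locallyIntegrable_of_lintegral_sq hg hgL) z ψ -
      ∫ x, (ψ : Rd d → ℝ) x ^ 2 / (φ (g x) / 2)) := by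
    simp only [taylorWeight_self, div_eq_mul_inv]
    ring
  rw [← e, ← t3.liminf_eq]
  exact liminf_le_liminf (Eventually.of_forall fun n =>
    ofReal_sub_le_segGap_div hφ hα hαφ (hG n) (hGl n) (hε n) z ψ)

/-- The lower bound in a fixed direction. -/
theorem exists_isWeakDirDeriv_of_liminf_segGap {d : ℕ} {φ : ℝ → ℝ} (hφ : Continuous φ) {α : ℝ}
    (hα : 0 < α) (hαφ : ∀ s, α ≤ φ s) {g : Rd d → ℝ} {G : ℕ → Rd d → ℝ}
    (hg : Measurable g) (hG : ∀ n, Measurable (G n))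
    (hgL : ∀ R : ℝ, ∫⁻ x in Metric.ball 0 R, ‖g x‖ₑ ^ 2 < ⊤)
    (hGl : ∀ n, LocallyIntegrable (G n))
    (hconv : ∀ R : ℝ, Tendsto (fun n => ∫⁻ x in Metric.ball 0 R, ‖G n x - g x‖ₑ ^ 2) atTop (𝓝 0))
    {ε : ℕ → ℝ} (hε : ∀ n, 0 < ε n) (hε0 : Tendsto ε atTop (𝓝 0)) (z : Rd d)
    (hfin : liminf (fun n => segGap φ (G n) (ε n • z) / ENNReal.ofReal (ε n ^ 2)) atTop < ⊤) :
    ∃ p : Rd d → ℝ, Measurable p ∧ MemLp p 2 ∧ IsWeakDirDeriv g z p ∧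
      ∫⁻ x, ENNReal.ofReal (1 / 24 * (φ (g x) * p x ^ 2)) ≤
        liminf (fun n => segGap φ (G n) (ε n • z) / ENNReal.ofReal (ε n ^ 2)) atTop := by
  set L := liminf (fun n => segGap φ (G n) (ε n • z) / ENNReal.ofReal (ε n ^ 2)) atTop with hL
  have hgl := locallyIntegrable_of_lintegral_sq hg hgL
  have hle : ∀ ψ : testFunctions d, 2 * dirPairing hgl z ψ -
      ∫ x, (ψ : Rd d → ℝ) x ^ 2 / (φ (g x) / 2) ≤ 12 * L.toReal := by
    intro ψ
    have h := ofReal_le_liminf_segGap hφ hα hαφ hg hG hgL hGl hconv hε hε0 z ψ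
    rw [← hL, ENNReal.ofReal_le_iff_le_toReal hfin.ne] at h
    linarith
  have ham : Measurable fun x => φ (g x) / 2 := (hφ.measurable.comp hg).div_const 2
  have haα : ∀ x, α / 2 ≤ φ (g x) / 2 := fun x => by linarith [hαφ (g x)]
  -- Halving `hle` gives the constant `6L`; the penalty is at most `2α⁻¹‖ψ‖²` because `φ ≥ α`, and
  -- half of it is `α⁻¹‖ψ‖²`.
  have hbd := abs_le_mul_norm_of_le_add_sq (dirPairing hgl z) (testToL2 d)
    (K₁ := 6 * L.toReal) (K₂ := α⁻¹) (fun ψ => by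
      have h1 := hle ψ
      have h2 : ∫ x, (ψ : Rd d → ℝ) x ^ 2 / (φ (g x) / 2) ≤ 2 * (α⁻¹ * ‖testToL2 d ψ‖ ^ 2) := by
        rw [norm_testToL2_sq, ← mul_assoc, ← integral_const_mul]
        refine integral_mono_of_nonneg (ae_of_all _ fun x => div_nonneg (sq_nonneg _)
          ((half_pos hα).le.trans (haα x)))
          ((memLp_testFunction ψ).integrable_sq.const_mul _) (ae_of_all _ fun x => ?_)
        have h3 := hαφ (g x)
        have h4 : 0 < φ (g x) := hα.trans_le h3
        simp only
        rw [div_div_eq_mul_div, div_eq_mul_inv, mul_comm _ (2 : ℝ), mul_assoc, mul_assoc,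
          mul_comm _ (φ (g x))⁻¹]
        gcongr
      linarith)
  obtain ⟨p, hpm, hpL, hp⟩ := exists_memLp_of_le_norm (dirPairing hgl z) hbd
  refine ⟨p, hpm, hpL, (isWeakDirDeriv_iff hgl).2 hp, ?_⟩
  have h1 := lintegral_mul_sq_le_of_test ham (half_pos hα) haα hpm hpL (K := 12 * L.toReal)
    (fun ψ => by rw [← hp ψ]; exact hle ψ)
  have h2 : ∀ x, ENNReal.ofReal (1 / 24 * (φ (g x) * p x ^ 2)) =
      ENNReal.ofReal (1 / 12) * ENNReal.ofReal (φ (g x) / 2 * p x ^ 2) := fun x => by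
    rw [← ENNReal.ofReal_mul (by norm_num)]
    congr 1; ring
  simp_rw [h2]
  rw [lintegral_const_mul' _ _ ENNReal.ofReal_ne_top]
  calc _ ≤ ENNReal.ofReal (1 / 12) * ENNReal.ofReal (12 * L.toReal) := by gcongr
    _ = L := by
      rw [← ENNReal.ofReal_mul (by norm_num), ← mul_assoc]
      norm_num
      exact hfin.ne

end

/-! ### The upper bound in a fixed direction. -/

noncomputable section

theorem IsWeakDirDeriv.smul {d : ℕ} {g p : Rd d → ℝ} {v : Rd d} (h : IsWeakDirDeriv g v p)
    (c : ℝ) : IsWeakDirDeriv g (c • v) (fun x => c * p x) := by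
  intro ψ h1 h2
  have := h ψ h1 h2
  simp only [map_smul, smul_eq_mul, mul_assoc, mul_left_comm _ c]
  rw [integral_const_mul, integral_const_mul, this, mul_neg]

/-- Let `k(s) = g(x + sv) - g(x) - s r(x)`. As `s` has mean 1/2, the integrand on the left is the
square of `k` minus its own mean, and Jensen with `(a + b)² ≤ 2a² + 2b²` costs a factor 4. -/
theorem lintegral_segAvg_error_le {d : ℕ} {g r : Rd d → ℝ} (hg : Measurable g)
    (hgl : LocallyIntegrable g) (hr : Measurable r) (v : Rd d) :
    ∫⁻ q : Rd d × ℝ, ‖g (q.1 + q.2 • v) - segAvg g v q.1 - (q.2 - 1 / 2) * r q.1‖ₑ ^ 2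
        ∂(volume.prod unitMeasure) ≤
      4 * ∫⁻ q : Rd d × ℝ, ‖g (q.1 + q.2 • v) - g q.1 - q.2 * r q.1‖ₑ ^ 2
        ∂(volume.prod unitMeasure) := by
  have hgm := measurable_comp_add_smul hg v
  have hmm : Measurable fun q : Rd d × ℝ => segAvg g v q.1 :=
    (measurable_segAvg hg v).comp measurable_fst
  have hrm : Measurable fun q : Rd d × ℝ => r q.1 := hr.comp measurable_fst
  have hgm' : Measurable fun q : Rd d × ℝ => g q.1 := hg.comp measurable_fst
  have m1 : Measurable fun q : Rd d × ℝ =>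
      ‖g (q.1 + q.2 • v) - segAvg g v q.1 - (q.2 - 1 / 2) * r q.1‖ₑ ^ 2 :=
    (((hgm.sub hmm).sub ((measurable_snd.sub_const _).mul hrm)).enorm).pow_const 2
  have m2 : Measurable fun q : Rd d × ℝ => g (q.1 + q.2 • v) - g q.1 - q.2 * r q.1 :=
    (hgm.sub hgm').sub (measurable_snd.mul hrm)
  rw [lintegral_prod _ m1.aemeasurable, lintegral_prod _ (m2.enorm.pow_const 2).aemeasurable,
    ← lintegral_const_mul _ (m2.enorm.pow_const 2).lintegral_prod_right']
  refine lintegral_mono_ae ?_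
  filter_upwards [ae_integrable_segment hg hgl v] with x hx
  set k : ℝ → ℝ := fun s => g (x + s • v) - g x - s * r x with hk
  have hkm : Measurable k := m2.comp measurable_prodMk_left
  have hid : Integrable (fun s : ℝ => s * r x) unitMeasure :=
    Continuous.integrableOn_Ioc (by fun_prop)
  have hs : ∫ s : ℝ, s ∂unitMeasure = 1 / 2 := by
    rw [integral_unitMeasure, integral_id]; norm_num
  have hki : ∫ s, k s ∂unitMeasure = segAvg g v x - g x - 1 / 2 * r x := by
    have i0 : Integrable (fun s => g (x + s • v) - g x) unitMeasure :=
      hx.sub (integrable_const _)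
    simp only [hk]
    rw [integral_sub i0 hid, integral_sub hx (integrable_const _),
      integral_mul_const, hs]
    simp [segAvg]
  have hpt : ∀ s, ‖g (x + s • v) - segAvg g v x - (s - 1 / 2) * r x‖ₑ ^ 2 ≤
      2 * ‖k s‖ₑ ^ 2 + 2 * ∫⁻ s, ‖k s‖ₑ ^ 2 ∂unitMeasure := by
    intro s
    have e : g (x + s • v) - segAvg g v x - (s - 1 / 2) * r x =
        k s + -(∫ s, k s ∂unitMeasure) := by
      rw [hki, hk]; ring
    rw [e]
    refine (enorm_add_sq_le _ _).trans ?_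
    gcongr
    rw [enorm_neg]
    simpa using enorm_integral_sub_sq_le (μ := unitMeasure) hkm 0
  calc _ ≤ ∫⁻ s, (2 * ‖k s‖ₑ ^ 2 + 2 * ∫⁻ s, ‖k s‖ₑ ^ 2 ∂unitMeasure) ∂unitMeasure :=
        lintegral_mono hpt
    _ = 4 * ∫⁻ s, ‖k s‖ₑ ^ 2 ∂unitMeasure := by
        rw [lintegral_add_right _ measurable_const, lintegral_const_mul _ (hkm.enorm.pow_const 2)]
        simp only [lintegral_const, measure_univ, mul_one]
        rw [← add_mul]; norm_num

/-- The fundamental theorem in direction `sv` writes the increment as `s` times a mean of `p`; then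
Jensen in `τ`, with the leftover factor `s² ≤ 1` dropped. -/
theorem lintegral_sub_sub_le {d : ℕ} {g p r : Rd d → ℝ} {v : Rd d} (h : IsWeakDirDeriv g v p)
    (hg : Measurable g) (hgl : LocallyIntegrable g) (hp : Measurable p)
    (hpl : LocallyIntegrable p) (hr : Measurable r) :
    ∫⁻ q : Rd d × ℝ, ‖g (q.1 + q.2 • v) - g q.1 - q.2 * r q.1‖ₑ ^ 2 ∂(volume.prod unitMeasure) ≤
      ∫⁻ s, (∫⁻ τ, (∫⁻ x, ‖p (x + τ • s • v) - r x‖ₑ ^ 2) ∂unitMeasure) ∂unitMeasure := by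
  have hgm := measurable_comp_add_smul hg v
  have hrm : Measurable fun q : Rd d × ℝ => r q.1 := hr.comp measurable_fst
  have hgm' : Measurable fun q : Rd d × ℝ => g q.1 := hg.comp measurable_fst
  have m2 : Measurable fun q : Rd d × ℝ => g (q.1 + q.2 • v) - g q.1 - q.2 * r q.1 :=
    (hgm.sub hgm').sub (measurable_snd.mul hrm)
  rw [lintegral_prod_symm _ (m2.enorm.pow_const 2).aemeasurable]
  refine lintegral_mono_ae (ae_unitMeasure_mem.mono fun s hs => ?_)
  have hm3 : Measurable fun q : Rd d × ℝ => p (q.1 + q.2 • s • v) - r q.1 :=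
    (measurable_comp_add_smul hp (s • v)).sub hrm
  rw [lintegral_lintegral_swap (f := fun τ x => ‖p (x + τ • s • v) - r x‖ₑ ^ 2)
    ((hm3.enorm.pow_const 2).comp measurable_swap).aemeasurable]
  refine lintegral_mono_ae ?_
  filter_upwards [(h.smul s).ae_sub_eq_segAvg hg hgl (hp.const_mul s) (hpl.smul s)] with x hx
  rw [hx]
  have hk : Measurable fun τ : ℝ => s * p (x + τ • s • v) :=
    ((measurable_comp_add_smul hp (s • v)).comp measurable_prodMk_left).const_mul s
  refine (enorm_integral_sub_sq_le hk (s * r x)).trans ?_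
  refine lintegral_mono fun τ => ?_
  rw [← mul_sub, enorm_mul]
  gcongr
  refine mul_le_of_le_one_left zero_le ?_
  rw [Real.enorm_eq_ofReal hs.1.le, ENNReal.ofReal_le_one]
  exact hs.2

theorem enorm_mul_sq (c x : ℝ) : ‖c * x‖ₑ ^ 2 = ENNReal.ofReal (c ^ 2) * ‖x‖ₑ ^ 2 := by
  rw [enorm_mul, mul_pow, Real.enorm_eq_ofReal_abs c, ← ENNReal.ofReal_pow (abs_nonneg c), sq_abs]

theorem enorm_sq_eq_ofReal (x : ℝ) : ‖x‖ₑ ^ 2 = ENNReal.ofReal (x ^ 2) := by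
  rw [Real.enorm_eq_ofReal_abs, ← ENNReal.ofReal_pow (abs_nonneg x), sq_abs]

/-- A uniform bound of the Jensen gap by the directional derivative. -/
theorem segGap_div_le {d : ℕ} {φ : ℝ → ℝ} (hφ : Continuous φ) {g p : Rd d → ℝ} {z : Rd d}
    (h : IsWeakDirDeriv g z p) (hg : Measurable g) (hgl : LocallyIntegrable g)
    (hp : Measurable p) (hpl : LocallyIntegrable p) {M : ℝ}
    (hM : ∀ (x v : Rd d) (s : ℝ), taylorWeight φ (segAvg g v x) (g (x + s • v)) ≤ M) (ε : ℝ) :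
    segGap φ g (ε • z) / ENNReal.ofReal (ε ^ 2) ≤
      ENNReal.ofReal M * (4 * ∫⁻ x, ‖p x‖ₑ ^ 2) := by
  have hpl' : LocallyIntegrable (fun x => ε * p x) := hpl.smul ε
  -- With `r = 0` the two error estimates become bounds on the deviation itself, which suffices for
  -- domination.
  have h1 := lintegral_segAvg_error_le hg hgl (measurable_const (a := (0 : ℝ))) (ε • z)
  have h2 := lintegral_sub_sub_le (h.smul ε) hg hgl (hp.const_mul ε) hpl'
    (measurable_const (a := (0 : ℝ)))
  simp only [mul_zero, sub_zero] at h1 h2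
  have h3 : ∀ s τ : ℝ, ∫⁻ x, ‖ε * p (x + τ • s • ε • z)‖ₑ ^ 2 =
      ENNReal.ofReal (ε ^ 2) * ∫⁻ x, ‖p x‖ₑ ^ 2 := fun s τ => by
    simp_rw [enorm_mul_sq]
    rw [lintegral_const_mul' _ _ ENNReal.ofReal_ne_top,
      lintegral_add_right_eq_self (fun x => ‖p x‖ₑ ^ 2)]
  simp only [h3, lintegral_const, measure_univ, mul_one] at h2
  refine ENNReal.div_le_of_le_mul ?_
  rw [segGap_eq_lintegral_prod hφ hg]
  calc _ ≤ ∫⁻ q : Rd d × ℝ, ENNReal.ofReal M *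
        ‖g (q.1 + q.2 • ε • z) - segAvg g (ε • z) q.1‖ₑ ^ 2 ∂(volume.prod unitMeasure) := by
        refine lintegral_mono fun q => ?_
        rw [enorm_sq_eq_ofReal, ← ENNReal.ofReal_mul' (sq_nonneg _)]
        apply ENNReal.ofReal_le_ofReal
        rw [mul_comm]
        exact mul_le_mul_of_nonneg_right (hM _ _ _) (sq_nonneg _)
    _ ≤ ENNReal.ofReal M * (4 * (ENNReal.ofReal (ε ^ 2) * ∫⁻ x, ‖p x‖ₑ ^ 2)) := by
        rw [lintegral_const_mul' _ _ ENNReal.ofReal_ne_top]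
        gcongr
        exact h1.trans (by gcongr)
    _ = _ := by ring

theorem tendsto_lintegral_translate_segment {d : ℕ} {p : Rd d → ℝ} (hp : MemLp p 2)
    {h : ℕ → Rd d} (hh : Tendsto h atTop (𝓝 0)) :
    Tendsto (fun n => ∫⁻ s, (∫⁻ τ, (∫⁻ x, ‖p (x + τ • s • h n) - p x‖ₑ ^ 2)
      ∂unitMeasure) ∂unitMeasure) atTop (𝓝 0) := by
  rw [ENNReal.tendsto_nhds_zero]
  intro η hη
  obtain ⟨δ, hδ, hball⟩ := Metric.eventually_nhds_iff.1
    (ENNReal.tendsto_nhds_zero.1 (tendsto_lintegral_translate_sub hp) η hη)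
  have e3 : ∀ᶠ n in atTop, ‖h n‖ < δ := by
    simpa using (Metric.tendsto_nhds.1 hh) δ hδ
  filter_upwards [e3] with n hn
  calc _ ≤ ∫⁻ _, (∫⁻ _, η ∂unitMeasure) ∂unitMeasure := by
        refine lintegral_mono_ae (ae_unitMeasure_mem.mono fun s hs => ?_)
        refine lintegral_mono_ae (ae_unitMeasure_mem.mono fun τ hτ => ?_)
        apply hball
        rw [dist_zero_right]
        exact ((norm_smul_lt_of_mem_Ioc hτ _).trans (norm_smul_lt_of_mem_Ioc hs _)).trans_lt hn
    _ = η := by simp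

/-- The upper bound in a fixed direction. -/
theorem limsup_segGap_le {d : ℕ} {φ : ℝ → ℝ} (hφ : Continuous φ) {α : ℝ}
    (hα : 0 < α) (hαφ : ∀ s, α ≤ φ s) {g p : Rd d → ℝ} {z : Rd d}
    (h : IsWeakDirDeriv g z p) (hg : Measurable g)
    (hgL : ∀ R : ℝ, ∫⁻ x in Metric.ball 0 R, ‖g x‖ₑ ^ 2 < ⊤)
    (hp : Measurable p) (hpL : MemLp p 2) {M : ℝ}
    (hM : ∀ (x v : Rd d) (s : ℝ), taylorWeight φ (segAvg g v x) (g (x + s • v)) ≤ M)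
    {ε : ℕ → ℝ} (hε : ∀ n, 0 < ε n) (hε0 : Tendsto ε atTop (𝓝 0)) :
    limsup (fun n => segGap φ g (ε n • z) / ENNReal.ofReal (ε n ^ 2)) atTop ≤
      ∫⁻ x, ENNReal.ofReal (1 / 24 * (φ (g x) * p x ^ 2)) := by
  have hgl := locallyIntegrable_of_lintegral_sq hg hgL
  have hpl : LocallyIntegrable p := hpL.locallyIntegrable (by norm_num)
  have hA0 : ∀ m y, 0 < taylorWeight φ m y := fun m y =>
    (half_pos hα).trans_le (le_taylorWeight hφ hαφ m y)
  have hM0 : 0 < M := (hA0 _ _).trans_le (hM 0 0 0)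
  set B : ℝ × ℝ → ℝ := fun q => min (taylorWeight φ q.1 q.2) M with hB
  have hBc : Continuous B := (continuous_taylorWeight hφ).min continuous_const
  have hB0 : ∀ q, 0 ≤ B q := fun q => le_min (hA0 _ _).le hM0.le
  have hBM : ∀ q, |B q| ≤ M := fun q => by
    rw [abs_of_nonneg (hB0 q)]; exact min_le_right _ _
  have hh : Tendsto (fun n => ε n • z) atTop (𝓝 0) := by simpa using hε0.smul_const z
  have t1 := tendsto_integral_segment hg (G := fun _ => g) (fun _ => hg) hgL (fun R => by simp) hh
    hBc hBM (w := fun x => p x ^ 2) hpL.integrable_sq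
  set I : ℕ → ℝ := fun n => ∫ q : Rd d × ℝ, p q.1 ^ 2 * (q.2 - 1 / 2) ^ 2 *
    B (segAvg g (ε n • z) q.1, g (q.1 + q.2 • ε n • z)) ∂(volume.prod unitMeasure) with hI
  set J := 1 / 12 * ∫ x, p x ^ 2 * B (g x, g x) with hJ
  have hJle : ENNReal.ofReal J ≤ ∫⁻ x, ENNReal.ofReal (1 / 24 * (φ (g x) * p x ^ 2)) := by
    have hi : Integrable fun x => p x ^ 2 * B (g x, g x) :=
      hpL.integrable_sq.mul_bdd (c := M)
        (hBc.measurable.comp (hg.prodMk hg)).aestronglyMeasurable (ae_of_all _ fun x => hBM _)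
    rw [hJ, ← integral_const_mul, ofReal_integral_eq_lintegral_ofReal (hi.const_mul _)
      (ae_of_all _ fun x => mul_nonneg (by norm_num) (mul_nonneg (sq_nonneg _) (hB0 _)))]
    refine lintegral_mono fun x => ENNReal.ofReal_le_ofReal ?_
    have : B (g x, g x) ≤ φ (g x) / 2 := by
      rw [← taylorWeight_self]; exact min_le_left _ _
    nlinarith [mul_le_mul_of_nonneg_left this (sq_nonneg (p x))]
  refine le_trans ?_ hJle
  set η : ℕ → ℝ≥0∞ := fun n => ∫⁻ s, (∫⁻ τ, (∫⁻ x, ‖p (x + τ • s • ε n • z) - p x‖ₑ ^ 2)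
      ∂unitMeasure) ∂unitMeasure with hη
  have tη : Tendsto η atTop (𝓝 0) := tendsto_lintegral_translate_segment hpL hh
  -- Young's inequality splits the deviation into the model profile `u = (s - 1/2) ε p` and an
  -- error. The profile costs `1 + δ` and yields `I n`; the error has the large factor `1 + δ⁻¹` but
  -- tends to 0 for fixed `δ`, by continuity of translations. Only afterwards does `δ` tend to 0.
  have key : ∀ δ : ℝ, 0 < δ → ∀ n, segGap φ g (ε n • z) / ENNReal.ofReal (ε n ^ 2) ≤
      ENNReal.ofReal (1 + δ) * ENNReal.ofReal (I n) +
        ENNReal.ofReal ((1 + δ⁻¹) * M) * (4 * η n) := by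
    intro δ hδ n
    have hεn := hε n
    have hmm : Measurable fun q : Rd d × ℝ => segAvg g (ε n • z) q.1 :=
      (measurable_segAvg hg (ε n • z)).comp measurable_fst
    have hgm := measurable_comp_add_smul hg (ε n • z)
    have hBm : Measurable fun q : Rd d × ℝ =>
        B (segAvg g (ε n • z) q.1, g (q.1 + q.2 • ε n • z)) :=
      hBc.measurable.comp (hmm.prodMk hgm)
    have hIi : Integrable (fun q : Rd d × ℝ => p q.1 ^ 2 * (q.2 - 1 / 2) ^ 2 *
        B (segAvg g (ε n • z) q.1, g (q.1 + q.2 • ε n • z))) (volume.prod unitMeasure) :=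
      (hpL.integrable_sq.mul_prod (Continuous.integrableOn_Ioc (by fun_prop) :
        Integrable (fun s : ℝ => (s - 1 / 2) ^ 2) unitMeasure)).mul_bdd (c := M)
        hBm.aestronglyMeasurable (ae_of_all _ fun q => hBM _)
    have hIe : ENNReal.ofReal (I n) = ∫⁻ q : Rd d × ℝ, ENNReal.ofReal (p q.1 ^ 2 *
        (q.2 - 1 / 2) ^ 2 * B (segAvg g (ε n • z) q.1, g (q.1 + q.2 • ε n • z)))
        ∂(volume.prod unitMeasure) :=
      ofReal_integral_eq_lintegral_ofReal hIi (ae_of_all _ fun q =>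
        mul_nonneg (mul_nonneg (sq_nonneg _) (sq_nonneg _)) (hB0 _))
    have e1 := lintegral_segAvg_error_le hg hgl (hp.const_mul (ε n)) (ε n • z)
    have e2 := lintegral_sub_sub_le (h.smul (ε n)) hg hgl (hp.const_mul (ε n))
      (hpl.smul (ε n)) (hp.const_mul (ε n))
    have e3 : ∀ s τ : ℝ, ∫⁻ x, ‖ε n * p (x + τ • s • ε n • z) - ε n * p x‖ₑ ^ 2 =
        ENNReal.ofReal (ε n ^ 2) * ∫⁻ x, ‖p (x + τ • s • ε n • z) - p x‖ₑ ^ 2 := fun s τ => by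
      simp_rw [← mul_sub, enorm_mul_sq]
      rw [lintegral_const_mul' _ _ ENNReal.ofReal_ne_top]
    simp only [e3] at e2
    simp only [lintegral_const_mul' _ _ (ENNReal.ofReal_ne_top (r := ε n ^ 2))] at e2
    refine ENNReal.div_le_of_le_mul ?_
    rw [segGap_eq_lintegral_prod hφ hg]
    have hpt : ∀ q : Rd d × ℝ, ENNReal.ofReal
        ((g (q.1 + q.2 • ε n • z) - segAvg g (ε n • z) q.1) ^ 2 *
          taylorWeight φ (segAvg g (ε n • z) q.1) (g (q.1 + q.2 • ε n • z))) ≤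
        ENNReal.ofReal ((1 + δ) * ε n ^ 2) * ENNReal.ofReal (p q.1 ^ 2 *
          (q.2 - 1 / 2) ^ 2 * B (segAvg g (ε n • z) q.1, g (q.1 + q.2 • ε n • z))) +
        ENNReal.ofReal ((1 + δ⁻¹) * M) * ‖g (q.1 + q.2 • ε n • z) - segAvg g (ε n • z) q.1 -
          (q.2 - 1 / 2) * (ε n * p q.1)‖ₑ ^ 2 := by
      intro q
      have hBe : B (segAvg g (ε n • z) q.1, g (q.1 + q.2 • ε n • z)) =
          taylorWeight φ (segAvg g (ε n • z) q.1) (g (q.1 + q.2 • ε n • z)) :=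
        min_eq_left (hM _ _ _)
      have hle := hM q.1 (ε n • z) q.2
      have hpos := hA0 (segAvg g (ε n • z) q.1) (g (q.1 + q.2 • ε n • z))
      rw [hBe, enorm_sq_eq_ofReal, ← ENNReal.ofReal_mul (by positivity),
        ← ENNReal.ofReal_mul (by positivity), ← ENNReal.ofReal_add (by positivity) (by positivity)]
      apply ENNReal.ofReal_le_ofReal
      generalize taylorWeight φ (segAvg g (ε n • z) q.1) (g (q.1 + q.2 • ε n • z)) = a at *
      generalize g (q.1 + q.2 • ε n • z) - segAvg g (ε n • z) q.1 = y
      generalize hu : (q.2 - 1 / 2) * (ε n * p q.1) = u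
      have hyoung : y ^ 2 ≤ (1 + δ) * u ^ 2 + (1 + δ⁻¹) * (y - u) ^ 2 := by
        have : (1 + δ) * u ^ 2 + (1 + δ⁻¹) * (y - u) ^ 2 - y ^ 2 =
            δ⁻¹ * (δ * u - (y - u)) ^ 2 := by
          field_simp; ring
        have h2 : 0 ≤ δ⁻¹ * (δ * u - (y - u)) ^ 2 := by positivity
        linarith
      calc y ^ 2 * a ≤ ((1 + δ) * u ^ 2 + (1 + δ⁻¹) * (y - u) ^ 2) * a := by gcongr
        _ = (1 + δ) * u ^ 2 * a + (1 + δ⁻¹) * a * (y - u) ^ 2 := by ring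
        _ ≤ (1 + δ) * u ^ 2 * a + (1 + δ⁻¹) * M * (y - u) ^ 2 := by gcongr
        _ = _ := by rw [← hu]; ring
    calc _ ≤ _ := lintegral_mono hpt
      _ = ENNReal.ofReal ((1 + δ) * ε n ^ 2) * ENNReal.ofReal (I n) +
          ENNReal.ofReal ((1 + δ⁻¹) * M) * ∫⁻ q : Rd d × ℝ, ‖g (q.1 + q.2 • ε n • z) -
            segAvg g (ε n • z) q.1 - (q.2 - 1 / 2) * (ε n * p q.1)‖ₑ ^ 2
            ∂(volume.prod unitMeasure) := by
        rw [lintegral_add_left' (hIi.aestronglyMeasurable.aemeasurable.ennreal_ofReal.const_mul _),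
          lintegral_const_mul' _ _ ENNReal.ofReal_ne_top,
          lintegral_const_mul' _ _ ENNReal.ofReal_ne_top, hIe]
      _ ≤ ENNReal.ofReal ((1 + δ) * ε n ^ 2) * ENNReal.ofReal (I n) +
          ENNReal.ofReal ((1 + δ⁻¹) * M) * (4 * (ENNReal.ofReal (ε n ^ 2) * η n)) := by
        gcongr
        exact e1.trans (by gcongr)
      _ = _ := by
        rw [ENNReal.ofReal_mul (by positivity)]
        ring
  have step : ∀ δ : ℝ, 0 < δ →
      limsup (fun n => segGap φ g (ε n • z) / ENNReal.ofReal (ε n ^ 2)) atTop ≤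
        ENNReal.ofReal (1 + δ) * ENNReal.ofReal J := by
    intro δ hδ
    have t2 : Tendsto (fun n => ENNReal.ofReal (1 + δ) * ENNReal.ofReal (I n) +
        ENNReal.ofReal ((1 + δ⁻¹) * M) * (4 * η n)) atTop
        (𝓝 (ENNReal.ofReal (1 + δ) * ENNReal.ofReal J +
          ENNReal.ofReal ((1 + δ⁻¹) * M) * (4 * 0))) :=
      (ENNReal.Tendsto.const_mul (ENNReal.tendsto_ofReal t1) (Or.inr ENNReal.ofReal_ne_top)).add
        (ENNReal.Tendsto.const_mul (ENNReal.Tendsto.const_mul tη (Or.inr (by norm_num)))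
          (Or.inr ENNReal.ofReal_ne_top))
    rw [mul_zero, mul_zero, add_zero] at t2
    rw [← t2.limsup_eq]
    exact limsup_le_limsup (Eventually.of_forall (key δ hδ))
  have hlim : Tendsto (fun δ : ℝ => ENNReal.ofReal (1 + δ) * ENNReal.ofReal J) (𝓝[>] 0)
      (𝓝 (ENNReal.ofReal (1 + 0) * ENNReal.ofReal J)) := by
    refine ENNReal.Tendsto.mul_const (ENNReal.tendsto_ofReal ?_) (Or.inr ENNReal.ofReal_ne_top)
    exact ((continuous_const.add continuous_id).tendsto (0 : ℝ)).mono_left nhdsWithin_le_nhds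
  rw [add_zero, ENNReal.ofReal_one, one_mul] at hlim
  exact ge_of_tendsto hlim (eventually_nhdsWithin_of_forall fun δ hδ => step δ hδ)

end

/-! ### From the energies to integrals of directional Jensen gaps. -/

noncomputable section

theorem isWeakFDeriv_weakFDeriv {d : ℕ} {F : Type*} [NormedAddCommGroup F] [NormedSpace ℝ F]
    {u : Rd d → F} (h : ∃ u', IsWeakFDeriv u u') : IsWeakFDeriv u (weakFDeriv u) := by
  unfold weakFDeriv
  rw [dif_pos h]
  exact h.choose_spec

theorem ContinuousLinearMap.ext_basisFun {d : ℕ} {F : Type*} [NormedAddCommGroup F]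
    [NormedSpace ℝ F] {A B : Rd d →L[ℝ] F}
    (h : ∀ i, A (EuclideanSpace.basisFun (Fin d) ℝ i) = B (EuclideanSpace.basisFun (Fin d) ℝ i)) :
    A = B := by
  have := (EuclideanSpace.basisFun (Fin d) ℝ).toBasis.ext (f₁ := A.toLinearMap)
    (f₂ := B.toLinearMap) (fun i => by simpa using h i)
  ext x
  exact congrArg (fun L : Rd d →ₗ[ℝ] F => L x) this

theorem LocallyIntegrable.clm_apply_const {d : ℕ} {F : Type*} [NormedAddCommGroup F]
    [NormedSpace ℝ F] {T : Rd d → (Rd d →L[ℝ] F)} (hT : LocallyIntegrable T) (v : Rd d) :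
    LocallyIntegrable (fun x => T x v) := fun x => by
  obtain ⟨s, hs, hi⟩ := hT x
  exact ⟨s, hs, (ContinuousLinearMap.apply ℝ F v).integrable_comp hi⟩

theorem IsWeakFDeriv.ae_eq {d : ℕ} {F : Type*} [NormedAddCommGroup F] [NormedSpace ℝ F]
    [CompleteSpace F] {u : Rd d → F} {u' u'' : Rd d → (Rd d →L[ℝ] F)} (h : IsWeakFDeriv u u')
    (h' : IsWeakFDeriv u u'') : u' =ᵐ[volume] u'' := by
  have hv : ∀ v : Rd d, ∀ᵐ x, u' x v = u'' x v := fun v =>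
    ae_eq_of_integral_contDiff_smul_eq (LocallyIntegrable.clm_apply_const h.2.1 v)
      (LocallyIntegrable.clm_apply_const h'.2.1 v) fun ψ h1 h2 => by
        have e1 := h.2.2 ψ h1 h2 v
        have e2 := h'.2.2 ψ h1 h2 v
        exact neg_injective (e1.symm.trans e2)
  filter_upwards [ae_all_iff.2 fun i => hv (EuclideanSpace.basisFun (Fin d) ℝ i)] with x hx
  exact ContinuousLinearMap.ext_basisFun hx

theorem MemL2loc.congr_ae {d : ℕ} {F : Type*} [NormedAddCommGroup F] {u v : Rd d → F}
    (hu : MemL2loc u) (h : u =ᵐ[volume] v) : MemL2loc v := fun R =>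
  (memLp_congr_ae (ae_restrict_of_ae h)).1 (hu R)

/-- `weakFDeriv` is an arbitrary choice among weak derivatives; by uniqueness it agrees almost
everywhere with the one known to be in `L²_loc`. -/
theorem MemH1loc.memL2loc_weakFDeriv {d : ℕ} {F : Type*} [NormedAddCommGroup F]
    [NormedSpace ℝ F] [CompleteSpace F] {u : Rd d → F} (hu : MemH1loc u) :
    IsWeakFDeriv u (weakFDeriv u) ∧ MemL2loc (weakFDeriv u) := by
  obtain ⟨u', h1, h2⟩ := hu.2
  have h := isWeakFDeriv_weakFDeriv ⟨u', h1⟩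
  exact ⟨h, h2.congr_ae (h1.ae_eq h)⟩

theorem IsWeakDirDeriv.congr_ae {d : ℕ} {g g' p p' : Rd d → ℝ} {v : Rd d}
    (h : IsWeakDirDeriv g v p) (hg : g =ᵐ[volume] g') (hp : p =ᵐ[volume] p') :
    IsWeakDirDeriv g' v p' := fun ψ h1 h2 => by
  rw [← integral_congr_ae (hg.mono fun x hx => congrArg (fun y => fderiv ℝ ψ x v * y) hx),
    ← integral_congr_ae (hp.mono fun x hx => congrArg (fun y => ψ x * y) hx)]
  exact h ψ h1 h2

theorem IsWeakFDeriv.isWeakDirDeriv {d : ℕ} {u : Rd d → ℝ} {u' : Rd d → (Rd d →L[ℝ] ℝ)}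
    (h : IsWeakFDeriv u u') (v : Rd d) : IsWeakDirDeriv u v (fun x => u' x v) :=
  fun ψ h1 h2 => h.2.2 ψ h1 h2 v

theorem IsWeakFDeriv.isWeakDirDeriv_apply {d : ℕ} {U : Rd d → (Rd d →L[ℝ] ℝ)}
    {U' : Rd d → (Rd d →L[ℝ] (Rd d →L[ℝ] ℝ))} (h : IsWeakFDeriv U U') (v w : Rd d) :
    IsWeakDirDeriv (fun x => U x w) v (fun x => U' x v w) := fun ψ h1 h2 => by
  have hc : HasCompactSupport (fun x => fderiv ℝ ψ x v) := h2.fderiv_apply ℝ v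
  have hd : Continuous (fun x => fderiv ℝ ψ x v) :=
    (h1.continuous_fderiv (by norm_num)).clm_apply continuous_const
  have i1 : Integrable (fun x => fderiv ℝ ψ x v • U x) :=
    h.1.integrable_smul_left_of_hasCompactSupport hd hc
  have i2 : Integrable (fun x => ψ x • U' x v) :=
    (LocallyIntegrable.clm_apply_const h.2.1 v).integrable_smul_left_of_hasCompactSupport
      h1.continuous h2
  have e := congrArg (fun L : Rd d →L[ℝ] ℝ => L w) (h.2.2 ψ h1 h2 v)
  simp only [_root_.neg_apply, ContinuousLinearMap.integral_apply i1,
    ContinuousLinearMap.integral_apply i2, _root_.smul_apply, smul_eq_mul] at e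
  exact e

/-- The measure with density `ρ`. -/
def kernelMeasure {d : ℕ} (ρ : Rd d → ℝ) : Measure (Rd d) :=
  volume.withDensity fun z => ENNReal.ofReal (ρ z)

theorem isFiniteMeasure_kernelMeasure {d : ℕ} {ρ : Rd d → ℝ} (hρ : Integrable ρ) :
    IsFiniteMeasure (kernelMeasure ρ) := isFiniteMeasure_withDensity_ofReal hρ.2

theorem lintegral_kernel {d : ℕ} {ρ : Rd d → ℝ} (hρ0 : ∀ z, 0 ≤ ρ z) (hρ : Integrable ρ)
    (k : Rd d → ℝ) : ∫⁻ z, ENNReal.ofReal (ρ z * k z) =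
      ∫⁻ z, ENNReal.ofReal (k z) ∂(kernelMeasure ρ) := by
  rw [kernelMeasure, lintegral_withDensity_eq_lintegral_mul_non_measurable₀ _
    hρ.aestronglyMeasurable.aemeasurable.ennreal_ofReal
    (ae_of_all _ fun _ => ENNReal.ofReal_lt_top)]
  exact lintegral_congr fun z => ENNReal.ofReal_mul (hρ0 z)

theorem measurable_unitDir {d : ℕ} : Measurable (unitDir : Rd d → Rd d) :=
  (measurable_norm.inv).smul measurable_id

theorem norm_smul_unitDir {d : ℕ} (z : Rd d) : ‖z‖ • unitDir z = z := by
  rcases eq_or_ne z 0 with rfl | h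
  · simp
  · rw [unitDir, smul_smul, mul_inv_cancel₀ (norm_ne_zero_iff.2 h), one_smul]

theorem norm_unitDir_le {d : ℕ} (z : Rd d) : ‖unitDir z‖ ≤ 1 := by
  rw [unitDir, norm_smul, norm_inv, norm_norm]
  exact inv_mul_le_one

theorem measurable_clm_apply {X : Type*} [MeasurableSpace X] {d : ℕ} {T : X → (Rd d →L[ℝ] ℝ)}
    {v : X → Rd d} (hT : Measurable T) (hv : Measurable v) : Measurable fun x => T x (v x) :=
  (isBoundedBilinearMap_apply (𝕜 := ℝ) (E := Rd d) (F := ℝ)).continuous.measurable.comp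
    (hT.prodMk hv)

theorem measurable_segGap_unitDir {d : ℕ} {φ : ℝ → ℝ} (hφ : Continuous φ)
    {g : Rd d → (Rd d →L[ℝ] ℝ)} (hg : Measurable g) (ε : ℝ) :
    Measurable fun z => segGap φ (fun x => g x (unitDir z)) (ε • z) := by
  have h1 : Measurable fun q : (Rd d × Rd d) × ℝ =>
      g (q.1.2 + q.2 • ε • q.1.1) (unitDir q.1.1) :=
    measurable_clm_apply (hg.comp (Continuous.measurable (by fun_prop)))
      (measurable_unitDir.comp (measurable_fst.comp measurable_fst))
  have h2 : Measurable fun q : Rd d × Rd d =>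
      segAvg (fun x => g x (unitDir q.1)) (ε • q.1) q.2 :=
    (h1.stronglyMeasurable.integral_prod_right' (ν := unitMeasure)).measurable
  have h3 : Measurable fun q : (Rd d × Rd d) × ℝ =>
      segAvg (fun x => g x (unitDir q.1.1)) (ε • q.1.1) q.1.2 := h2.comp measurable_fst
  have h4 := (((h1.sub h3).pow_const 2).mul
    ((continuous_taylorWeight hφ).measurable.comp (h3.prodMk h1))).ennreal_ofReal
  exact (h4.lintegral_prod_right' (ν := unitMeasure)).lintegral_prod_right'

/-- Taylor's formula, integrated against a probability measure. -/
theorem lintegral_eq_add_taylor {X : Type*} [MeasurableSpace X] {μ : Measure X}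
    [IsProbabilityMeasure μ] {F F' φ : ℝ → ℝ} (hF : ∀ s, HasDerivAt F (F' s) s)
    (hF' : ∀ s, HasDerivAt F' (φ s) s) (hφ : Continuous φ) (hF0 : ∀ s, 0 ≤ F s)
    (hA : ∀ m y, 0 ≤ taylorWeight φ m y) {k : X → ℝ} (hkm : Measurable k)
    (hk : Integrable k μ) {m : ℝ} (hm : ∫ x, k x ∂μ = m) :
    ∫⁻ x, ENNReal.ofReal (F (k x)) ∂μ = ENNReal.ofReal (F m) +
      ∫⁻ x, ENNReal.ofReal ((k x - m) ^ 2 * taylorWeight φ m (k x)) ∂μ := by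
  set Y : X → ℝ := fun x => (k x - m) ^ 2 * taylorWeight φ m (k x) with hY
  have hFc : Continuous F := continuous_iff_continuousAt.2 fun s => (hF s).continuousAt
  have hYm : Measurable Y := ((hkm.sub_const m).pow_const 2).mul
    ((continuous_taylorWeight hφ).measurable.comp (measurable_const.prodMk hkm))
  have hY0 : ∀ x, 0 ≤ Y x := fun x => mul_nonneg (sq_nonneg _) (hA _ _)
  have hL : Integrable (fun x => F m + F' m * (k x - m)) μ :=
    (integrable_const _).add ((hk.sub (integrable_const m)).const_mul _)
  have he : ∀ x, F (k x) = F m + F' m * (k x - m) + Y x := fun x =>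
    eq_taylor_of_hasDerivAt hF hF' hφ m (k x)
  have hLi : ∫ x, (F m + F' m * (k x - m)) ∂μ = F m := by
    have i1 : Integrable (fun x => F' m * (k x - m)) μ :=
      (hk.sub (integrable_const m)).const_mul _
    rw [integral_add (integrable_const _) i1, integral_const_mul, integral_sub hk (integrable_const m), hm]
    simp
  -- The affine part is integrable, so `F ∘ k` and the remainder are integrable together. If they
  -- are not, both sides are infinite.
  by_cases hYi : Integrable Y μ
  · have hXi : Integrable (fun x => F (k x)) μ := by
      simp_rw [he]; exact hL.add hYi
    rw [← ofReal_integral_eq_lintegral_ofReal hXi (ae_of_all _ fun x => hF0 _),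
      ← ofReal_integral_eq_lintegral_ofReal hYi (ae_of_all _ hY0),
      ← ENNReal.ofReal_add (hF0 _) (integral_nonneg hY0)]
    congr 1
    simp_rw [he]
    rw [integral_add hL hYi, hLi]
  · have hXi : ¬ Integrable (fun x => F (k x)) μ := fun h => hYi <| by
      refine (h.sub hL).congr (ae_of_all _ fun x => ?_)
      simp only [Pi.sub_apply]; rw [he]; ring
    have h1 := mt (lintegral_ofReal_ne_top_iff_integrable hYm.aestronglyMeasurable
      (ae_of_all _ hY0)).1 hYi
    have h2 := mt (lintegral_ofReal_ne_top_iff_integrable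
      (hFc.measurable.comp hkm).aestronglyMeasurable (ae_of_all _ fun x => hF0 _)).1 hXi
    rw [not_not] at h1 h2
    rw [h1]
    simpa using h2

theorem lintegral_dilate {d : ℕ} (k : Rd d → ℝ≥0∞) {ε : ℝ} (hε : 0 < ε) :
    ∫⁻ y, k y = ENNReal.ofReal (ε ^ d) * ∫⁻ z, k (ε • z) := by
  have h1 : ∫⁻ z, k (ε • z) = ∫⁻ y, k y ∂(Measure.map (ε • ·) (volume : Measure (Rd d))) :=
    ((measurableEmbedding_const_smul₀ hε.ne').lintegral_map k).symm
  have hp : 0 < ε ^ d := pow_pos hε d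
  rw [h1, Measure.map_addHaar_smul _ hε.ne', lintegral_smul_measure, smul_eq_mul, ← mul_assoc,
    ← ENNReal.ofReal_mul hp.le, finrank_euclideanSpace_fin, abs_of_pos (inv_pos.2 hp),
    mul_inv_cancel₀ hp.ne', ENNReal.ofReal_one, one_mul]

/-- The substitution `y = x + εz` absorbs the normalisation of the kernel. The energy sees `u` only
up to null sets, which later permits a measurable representative. -/
theorem nonlocalEnergy_eq {d : ℕ} {ρ : Rd d → ℝ} (hρ0 : ∀ z, 0 ≤ ρ z) (hρ : Integrable ρ)
    (f : ℝ → ℝ) {ε : ℝ} (hε : 0 < ε) {u v : Rd d → ℝ} (huv : u =ᵐ[volume] v) :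
    nonlocalEnergy ρ f ε u = ∫⁻ x, ∫⁻ z, ENNReal.ofReal
      (f |(v (x + ε • z) - v x) / (ε * ‖z‖)|) ∂(kernelMeasure ρ) := by
  refine lintegral_congr_ae (huv.mono fun x hx => ?_)
  simp only
  have hpd : 0 < ε ^ d := pow_pos hε d
  calc ∫⁻ y, ENNReal.ofReal (rescale ρ ε (y - x) * f (|u y - u x| / ‖y - x‖))
      = ∫⁻ y, ENNReal.ofReal (rescale ρ ε (y - x) * f (|v y - v x| / ‖y - x‖)) :=
        lintegral_congr_ae (huv.mono fun y hy => by simp only; rw [hy, hx])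
    _ = ∫⁻ y, ENNReal.ofReal (rescale ρ ε y * f (|v (x + y) - v x| / ‖y‖)) := by
        rw [← lintegral_add_left_eq_self _ x]
        simp
    _ = ENNReal.ofReal (ε ^ d) * ∫⁻ z, ENNReal.ofReal
          (rescale ρ ε (ε • z) * f (|v (x + ε • z) - v x| / ‖ε • z‖)) := lintegral_dilate _ hε
    _ = ∫⁻ z, ENNReal.ofReal (ρ z * f |(v (x + ε • z) - v x) / (ε * ‖z‖)|) := by
        rw [← lintegral_const_mul' _ _ ENNReal.ofReal_ne_top]
        refine lintegral_congr fun z => ?_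
        rw [← ENNReal.ofReal_mul hpd.le, rescale, smul_smul, inv_mul_cancel₀ hε.ne', one_smul,
          norm_smul, Real.norm_of_nonneg hε.le, abs_div,
          abs_of_nonneg (mul_nonneg hε.le (norm_nonneg z))]
        congr 1
        field_simp
    _ = _ := lintegral_kernel hρ0 hρ _

theorem localEnergy_eq {d : ℕ} {ρ : Rd d → ℝ} (hρ0 : ∀ z, 0 ≤ ρ z) (hρ : Integrable ρ)
    (f : ℝ → ℝ) {u : Rd d → ℝ} {g : Rd d → (Rd d →L[ℝ] ℝ)} (hg : weakFDeriv u =ᵐ[volume] g) :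
    localEnergy ρ f u =
      ∫⁻ x, ∫⁻ z, ENNReal.ofReal (f |g x (unitDir z)|) ∂(kernelMeasure ρ) := by
  refine lintegral_congr_ae (hg.mono fun x hx => ?_)
  simp only
  rw [hx]
  exact lintegral_kernel hρ0 hρ fun z => f |g x (unitDir z)|

theorem lintegral_sq_apply_lt_top {d : ℕ} {g : Rd d → (Rd d →L[ℝ] ℝ)} (hg : MemL2loc g)
    (w : Rd d) (R : ℝ) : ∫⁻ x in Metric.ball 0 R, ‖g x w‖ₑ ^ 2 < ⊤ := by
  have h : MemLp (fun x => g x w) 2 (volume.restrict (Metric.ball 0 R)) :=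
    (ContinuousLinearMap.apply ℝ ℝ w).comp_memLp' (hg R)
  exact (memLp_two_iff h.1).1 h

theorem IsWeakFDeriv.ae_diff_quotient {d : ℕ} {v : Rd d → ℝ} {g : Rd d → (Rd d →L[ℝ] ℝ)}
    (h : IsWeakFDeriv v g) (hvm : Measurable v) (hgm : Measurable g) {ε : ℝ} (hε : 0 < ε)
    (z : Rd d) : ∀ᵐ x, (v (x + ε • z) - v x) / (ε * ‖z‖) =
      segAvg (fun x => g x (unitDir z)) (ε • z) x := by
  have hl : LocallyIntegrable fun x => (ε * ‖z‖) * g x (unitDir z) :=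
    (LocallyIntegrable.clm_apply_const h.2.1 (unitDir z)).smul (ε * ‖z‖)
  have hm : Measurable fun x => (ε * ‖z‖) * g x (unitDir z) :=
    (measurable_clm_apply hgm measurable_const).const_mul _
  have h1 : IsWeakDirDeriv v (ε • z) (fun x => (ε * ‖z‖) * g x (unitDir z)) := by
    refine (h.isWeakDirDeriv (ε • z)).congr_ae (ae_eq_refl _) (ae_of_all _ fun x => ?_)
    simp only
    rw [← smul_eq_mul (a := ε * ‖z‖), ← map_smul, mul_smul, norm_smul_unitDir]
  filter_upwards [h1.ae_sub_eq_segAvg hvm h.1 hm hl] with x hx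
  rw [hx, segAvg, integral_const_mul]
  -- At `z = 0` both sides are 0: division by zero on the left, `unitDir 0 = 0` on the right.
  rcases eq_or_ne z 0 with rfl | hz
  · simp [segAvg, unitDir]
  · rw [mul_div_cancel_left₀ _ (mul_ne_zero hε.ne' (norm_ne_zero_iff.2 hz))]
    rfl

/-- The integral of `F ∘ g` exceeds that of `F` of the segment means by the Jensen gap. -/
theorem lintegral_eq_add_segGap {d : ℕ} {F F' φ : ℝ → ℝ} (hF : ∀ s, HasDerivAt F (F' s) s)
    (hF' : ∀ s, HasDerivAt F' (φ s) s) (hφ : Continuous φ) (hF0 : ∀ s, 0 ≤ F s)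
    (hA : ∀ m y, 0 ≤ taylorWeight φ m y) {g : Rd d → ℝ} (hg : Measurable g)
    (hgl : LocallyIntegrable g) (h : Rd d) :
    ∫⁻ x, ENNReal.ofReal (F (g x)) =
      (∫⁻ x, ENNReal.ofReal (F (segAvg g h x))) + segGap φ g h := by
  have hFc : Continuous F := continuous_iff_continuousAt.2 fun s => (hF s).continuousAt
  have hmain : ∀ᵐ x, ∫⁻ s, ENNReal.ofReal (F (g (x + s • h))) ∂unitMeasure =
      ENNReal.ofReal (F (segAvg g h x)) +
        ∫⁻ s, ENNReal.ofReal ((g (x + s • h) - segAvg g h x) ^ 2 *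
          taylorWeight φ (segAvg g h x) (g (x + s • h))) ∂unitMeasure := by
    filter_upwards [ae_integrable_segment hg hgl h] with x hi
    exact lintegral_eq_add_taylor hF hF' hφ hF0 hA
      ((measurable_comp_add_smul hg h).comp measurable_prodMk_left) hi rfl
  have mF : Measurable fun q : Rd d × ℝ => ENNReal.ofReal (F (g (q.1 + q.2 • h))) :=
    (hFc.measurable.comp (measurable_comp_add_smul hg h)).ennreal_ofReal
  have m3 : Measurable fun x : Rd d => ENNReal.ofReal (F (segAvg g h x)) :=
    (hFc.measurable.comp (measurable_segAvg hg h)).ennreal_ofReal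
  calc ∫⁻ x, ENNReal.ofReal (F (g x))
      = ∫⁻ s, (∫⁻ x, ENNReal.ofReal (F (g (x + s • h)))) ∂unitMeasure := by
        simp_rw [lintegral_add_right_eq_self (fun x => ENNReal.ofReal (F (g x)))]
        simp
    _ = ∫⁻ x, ∫⁻ s, ENNReal.ofReal (F (g (x + s • h))) ∂unitMeasure := by
        rw [lintegral_lintegral_swap (f := fun x s => ENNReal.ofReal (F (g (x + s • h))))
          mF.aemeasurable]
    _ = _ := by
        rw [lintegral_congr_ae hmain, lintegral_add_left m3]
        rfl

theorem IsWeakFDeriv.congr_ae {d : ℕ} {F : Type*} [NormedAddCommGroup F] [NormedSpace ℝ F]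
    {u v : Rd d → F} {U V : Rd d → (Rd d →L[ℝ] F)} (h : IsWeakFDeriv u U) (huv : u =ᵐ[volume] v)
    (hUV : U =ᵐ[volume] V) : IsWeakFDeriv v V := by
  refine ⟨h.1.congr huv, h.2.1.congr hUV, fun ψ h1 h2 w => ?_⟩
  rw [← integral_congr_ae (huv.mono fun x hx => congrArg (fun y => fderiv ℝ ψ x w • y) hx),
    ← integral_congr_ae (hUV.mono fun x hx => congrArg (fun L => ψ x • L w) hx)]
  exact h.2.2 ψ h1 h2 w

/-- The local energy exceeds the nonlocal one by the integrated Jensen gap. -/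
theorem localEnergy_eq_add {d : ℕ} {ρ : Rd d → ℝ} (hρ0 : ∀ z, 0 ≤ ρ z) (hρ : Integrable ρ)
    {f F' φ : ℝ → ℝ} (hF : ∀ s, HasDerivAt (fun s => f |s|) (F' s) s)
    (hF' : ∀ s, HasDerivAt F' (φ s) s) (hφ : Continuous φ) (hf0 : ∀ s, 0 ≤ f |s|)
    (hA : ∀ m y, 0 ≤ taylorWeight φ m y) {u : Rd d → ℝ} (hu : MemH1loc u)
    {g : Rd d → (Rd d →L[ℝ] ℝ)} (hgm : Measurable g) (hg : weakFDeriv u =ᵐ[volume] g)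
    {ε : ℝ} (hε : 0 < ε) :
    localEnergy ρ f u = nonlocalEnergy ρ f ε u +
      ∫⁻ z, segGap φ (fun x => g x (unitDir z)) (ε • z) ∂(kernelMeasure ρ) := by
  have := isFiniteMeasure_kernelMeasure hρ
  have hw := hu.memL2loc_weakFDeriv.1
  have hFc : Continuous (fun s => f |s|) :=
    continuous_iff_continuousAt.2 fun s => (hF s).continuousAt
  have hum := hw.1.aestronglyMeasurable.aemeasurable
  have hvm : Measurable (hum.mk u) := hum.measurable_mk
  have huv : u =ᵐ[volume] hum.mk u := hum.ae_eq_mk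
  generalize hum.mk u = v at hvm huv
  have hv : IsWeakFDeriv v g := hw.congr_ae huv hg
  have m1 : Measurable fun q : Rd d × Rd d => ENNReal.ofReal (f |g q.1 (unitDir q.2)|) :=
    (hFc.measurable.comp (measurable_clm_apply (hgm.comp measurable_fst)
      (measurable_unitDir.comp measurable_snd))).ennreal_ofReal
  have m2 : Measurable fun q : Rd d × Rd d =>
      ENNReal.ofReal (f |(v (q.1 + ε • q.2) - v q.1) / (ε * ‖q.2‖)|) := by
    have h1 : Measurable fun q : Rd d × Rd d => v (q.1 + ε • q.2) :=
      hvm.comp (Continuous.measurable (by fun_prop))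
    exact (hFc.measurable.comp ((h1.sub (hvm.comp measurable_fst)).div
      (measurable_const.mul measurable_snd.norm))).ennreal_ofReal
  rw [localEnergy_eq hρ0 hρ f hg, nonlocalEnergy_eq hρ0 hρ f hε huv,
    lintegral_lintegral_swap (f := fun x z => ENNReal.ofReal (f |g x (unitDir z)|))
      m1.aemeasurable, lintegral_lintegral_swap (f := fun x z =>
      ENNReal.ofReal (f |(v (x + ε • z) - v x) / (ε * ‖z‖)|)) m2.aemeasurable,
    ← lintegral_add_right _ (measurable_segGap_unitDir hφ hgm ε)]
  refine lintegral_congr fun z => ?_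
  rw [lintegral_eq_add_segGap hF hF' hφ hf0 hA (measurable_clm_apply hgm measurable_const)
    (LocallyIntegrable.clm_apply_const hv.2.1 (unitDir z)) (ε • z)]
  congr 1
  refine lintegral_congr_ae ?_
  filter_upwards [hv.ae_diff_quotient hvm hgm hε z] with x hx
  simp only [hx]

/-- Finiteness of the local energy makes both summands of `localEnergy_eq_add` finite, so the
subtraction in `EReal` is a genuine one. -/
theorem rateEnergy_eq {d : ℕ} {ρ : Rd d → ℝ} (hρ0 : ∀ z, 0 ≤ ρ z) (hρ : Integrable ρ)
    {f F' φ : ℝ → ℝ} (hF : ∀ s, HasDerivAt (fun s => f |s|) (F' s) s)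
    (hF' : ∀ s, HasDerivAt F' (φ s) s) (hφ : Continuous φ) (hf0 : ∀ s, 0 ≤ f |s|)
    (hA : ∀ m y, 0 ≤ taylorWeight φ m y) {u : Rd d → ℝ} (hu : u ∈ rateDomain ρ f)
    {g : Rd d → (Rd d →L[ℝ] ℝ)} (hgm : Measurable g) (hg : weakFDeriv u =ᵐ[volume] g)
    {ε : ℝ} (hε : 0 < ε) :
    rateEnergy ρ f ε u = ((∫⁻ z, segGap φ (fun x => g x (unitDir z)) (ε • z) /
      ENNReal.ofReal (ε ^ 2) ∂(kernelMeasure ρ) : ℝ≥0∞) : EReal) := by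
  have h := localEnergy_eq_add hρ0 hρ hF hF' hφ hf0 hA hu.1 hgm hg hε
  have hlt := hu.2
  have hε2 : 0 < ε ^ 2 := by positivity
  simp only [div_eq_mul_inv]
  rw [lintegral_mul_const' _ _ (by simpa using hε.ne'), rateEnergy, h]
  rw [h] at hlt
  obtain ⟨h1, h2⟩ := ENNReal.add_lt_top.1 hlt
  generalize nonlocalEnergy ρ f ε u = a at *
  generalize ∫⁻ z, segGap φ (fun x => g x (unitDir z)) (ε • z) ∂(kernelMeasure ρ) = b at *
  lift a to NNReal using h1.ne
  lift b to NNReal using h2.ne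
  rw [← ENNReal.coe_add, ← ENNReal.ofReal_inv_of_pos hε2, ← ENNReal.ofReal_coe_nnreal (p := b),
    ← ENNReal.ofReal_mul b.coe_nonneg, EReal.coe_ennreal_ofReal, max_eq_left (by positivity)]
  simp only [EReal.coe_nnreal_eq_coe_real]
  rw [← EReal.coe_sub, ← EReal.coe_div]
  congr 1
  push_cast
  rw [add_sub_cancel_left, div_eq_mul_inv]

theorem measurable_limitDensity {d : ℕ} {φ : ℝ → ℝ} (hφ : Continuous φ)
    {g : Rd d → (Rd d →L[ℝ] ℝ)} (hgm : Measurable g)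
    {H : Rd d → (Rd d →L[ℝ] (Rd d →L[ℝ] ℝ))} (hHm : Measurable H) :
    Measurable fun q : Rd d × Rd d => ENNReal.ofReal (1 / 24 *
      (φ (g q.1 (unitDir q.2)) * H q.1 q.2 (unitDir q.2) ^ 2)) := by
  have h1 : Measurable fun q : Rd d × Rd d => g q.1 (unitDir q.2) :=
    measurable_clm_apply (hgm.comp measurable_fst) (measurable_unitDir.comp measurable_snd)
  have h2 : Measurable fun q : Rd d × Rd d => H q.1 q.2 :=
    (isBoundedBilinearMap_apply (𝕜 := ℝ) (E := Rd d)
      (F := Rd d →L[ℝ] ℝ)).continuous.measurable.comp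
      ((hHm.comp measurable_fst).prodMk measurable_snd)
  have h3 := measurable_clm_apply h2 (measurable_unitDir.comp measurable_snd)
  exact (((hφ.measurable.comp h1).mul (h3.pow_const 2)).const_mul _).ennreal_ofReal

theorem limitEnergy_eq {d : ℕ} {ρ : Rd d → ℝ} (hρ0 : ∀ z, 0 ≤ ρ z) (hρ : Integrable ρ)
    {f : ℝ → ℝ} (hφ : Continuous fun s => secondDeriv f |s|) {u : Rd d → ℝ} (hu : MemH2loc u)
    {g : Rd d → (Rd d →L[ℝ] ℝ)} (hgm : Measurable g) (hg : weakFDeriv u =ᵐ[volume] g)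
    {H : Rd d → (Rd d →L[ℝ] (Rd d →L[ℝ] ℝ))} (hHm : Measurable H)
    (hH : weakFDeriv (weakFDeriv u) =ᵐ[volume] H) :
    limitEnergy ρ f u = ((∫⁻ z, ∫⁻ x, ENNReal.ofReal (1 / 24 *
      (secondDeriv f |g x (unitDir z)| * H x z (unitDir z) ^ 2)) ∂volume
        ∂(kernelMeasure ρ) : ℝ≥0∞) : EReal) := by
  have := isFiniteMeasure_kernelMeasure hρ
  rw [limitEnergy, if_pos hu]
  congr 1
  have m1 := measurable_limitDensity hφ hgm hHm
  rw [lintegral_lintegral_swap (f := fun z x => ENNReal.ofReal (1 / 24 *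
      (secondDeriv f |g x (unitDir z)| * H x z (unitDir z) ^ 2)))
      (m1.comp measurable_swap).aemeasurable,
    show (1 / 24 : ℝ≥0∞) = ENNReal.ofReal (1 / 24) by
      rw [ENNReal.ofReal_div_of_pos (by norm_num)]; norm_num,
    ← lintegral_const_mul' _ _ ENNReal.ofReal_ne_top]
  refine lintegral_congr_ae ?_
  filter_upwards [hg, hH] with x hx hx'
  rw [hx, hx', ← lintegral_const_mul' _ _ ENNReal.ofReal_ne_top, ← lintegral_kernel hρ0 hρ]
  refine lintegral_congr fun z => ?_
  rw [← ENNReal.ofReal_mul (by norm_num)]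
  congr 1
  -- Differentiating along `z` instead of `ẑ` absorbs one factor `|z|`, whose square is the weight
  -- in the limit energy.
  have e : H x z (unitDir z) = ‖z‖ * H x (unitDir z) (unitDir z) := by
    conv_lhs => rw [← norm_smul_unitDir z]
    rw [map_smul, _root_.smul_apply, smul_eq_mul, norm_smul_unitDir]
  rw [e, sq_abs]
  ring

end

/-! ### The Hessian from pure second derivatives in a set of directions. -/

noncomputable section

/-- A set of positive measure contains all small parallelograms up to translation. -/
theorem exists_parallelogram_mem {d : ℕ} {Q : Set (Rd d)} (hQ : MeasurableSet Q)
    (hpos : 0 < volume Q) : ∃ δ : ℝ, 0 < δ ∧ ∀ a b : Rd d, ‖a‖ < δ → ‖b‖ < δ →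
      ∃ p ∈ Q, p + a ∈ Q ∧ p + b ∈ Q ∧ p + (a + b) ∈ Q := by
  obtain ⟨k, hk⟩ : ∃ k : ℕ, 0 < volume (Q ∩ Metric.ball 0 k) := by
    by_contra! h
    have h0 : ∀ k : ℕ, volume (Q ∩ Metric.ball 0 k) = 0 := fun k => le_antisymm (h k) zero_le
    have : volume (⋃ k : ℕ, Q ∩ Metric.ball 0 (k : ℝ)) = 0 := measure_iUnion_null h0
    rw [← inter_iUnion, Metric.iUnion_ball_nat, inter_univ] at this
    exact hpos.ne' this
  set P := Q ∩ Metric.ball (0 : Rd d) k with hP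
  have hPm : MeasurableSet P := hQ.inter measurableSet_ball
  have hPf : volume P ≠ ⊤ :=
    ne_top_of_le_ne_top measure_ball_lt_top.ne (measure_mono inter_subset_right)
  set χ : Rd d → ℝ := P.indicator fun _ => 1 with hχ
  have hχL : MemLp χ 2 := memLp_indicator_const 2 hPm 1 (Or.inr hPf)
  -- Three translations must succeed at once; if each fails on at most a quarter of `P`, the
  -- failures cannot cover `P`.
  have hη : 0 < volume P / 4 := ENNReal.div_pos hk.ne' (by norm_num)
  obtain ⟨δ, hδ, hball⟩ := Metric.eventually_nhds_iff.1
    (ENNReal.tendsto_nhds_zero.1 (tendsto_lintegral_translate_sub hχL) _ hη)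
  have hbad : ∀ h : Rd d, ‖h‖ < δ → volume {x ∈ P | x + h ∉ P} ≤ volume P / 4 := by
    intro h hh
    refine le_trans ?_ (hball (by simpa using hh))
    have hm : MeasurableSet {x ∈ P | x + h ∉ P} :=
      hPm.inter ((measurable_add_const h) hPm).compl
    rw [← lintegral_indicator_one hm]
    refine lintegral_mono fun x => ?_
    by_cases hx : x ∈ {x ∈ P | x + h ∉ P}
    · rw [indicator_of_mem hx, hχ, indicator_of_mem hx.1, indicator_of_notMem hx.2]
      simp
    · rw [indicator_of_notMem hx]; exact zero_le
  -- Half of `δ`, so that `a + b` is still an admissible shift.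
  refine ⟨δ / 2, half_pos hδ, fun a b ha hb => ?_⟩
  by_contra! hcon
  have hsub : P ⊆ {x ∈ P | x + a ∉ P} ∪ ({x ∈ P | x + b ∉ P} ∪ {x ∈ P | x + (a + b) ∉ P}) := by
    intro x hx
    by_contra hx'
    simp only [mem_union, Set.mem_ofPred_eq, not_or, not_and, not_not] at hx'
    exact hcon x hx.1 (hx'.1 hx).1 (hx'.2.1 hx).1 (hx'.2.2 hx).1
  have h3 : volume P ≤ volume P / 4 + (volume P / 4 + volume P / 4) := by
    refine (measure_mono hsub).trans ((measure_union_le _ _).trans ?_)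
    refine add_le_add (hbad _ (by linarith)) ((measure_union_le _ _).trans
      (add_le_add (hbad _ (by linarith)) (hbad _ ?_)))
    exact (norm_add_le _ _).trans_lt (by linarith)
  lift volume P to NNReal using hPf with V
  rw [show (4 : ℝ≥0∞) = ((4 : NNReal) : ℝ≥0∞) by norm_num, ← ENNReal.coe_div (by norm_num)] at h3
  norm_cast at h3 hk
  have h4 : (V : ℝ) ≤ V / 4 + (V / 4 + V / 4) := by exact_mod_cast h3
  have h5 : (0 : ℝ) < V := by exact_mod_cast hk
  linarith

theorem IsWeakDirDeriv.add_dir {d : ℕ} {g p p' : Rd d → ℝ} {v v' : Rd d}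
    (h : IsWeakDirDeriv g v p) (h' : IsWeakDirDeriv g v' p') (hg : LocallyIntegrable g)
    (hp : LocallyIntegrable p) (hp' : LocallyIntegrable p') :
    IsWeakDirDeriv g (v + v') (fun x => p x + p' x) := fun ψ h1 h2 => by
  simp only [map_add, add_mul, mul_add]
  rw [integral_add (integrable_fderiv_test_mul ⟨ψ, h1, h2⟩ hg v)
    (integrable_fderiv_test_mul ⟨ψ, h1, h2⟩ hg v'),
    integral_add (integrable_test_mul h1.continuous h2 hp)
    (integrable_test_mul h1.continuous h2 hp'), h ψ h1 h2, h' ψ h1 h2, neg_add]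

theorem IsWeakDirDeriv.sum_dir {d : ℕ} {ι : Type*} (s : Finset ι) {g : Rd d → ℝ}
    {p : ι → Rd d → ℝ} {v : ι → Rd d} (h : ∀ i ∈ s, IsWeakDirDeriv g (v i) (p i))
    (hg : LocallyIntegrable g) (hp : ∀ i ∈ s, LocallyIntegrable (p i)) :
    IsWeakDirDeriv g (∑ i ∈ s, v i) (fun x => ∑ i ∈ s, p i x) := by
  classical
  induction s using Finset.induction_on with
  | empty => intro ψ _ _; simp
  | insert i s hi ih =>
    simp only [Finset.sum_insert hi]
    exact (h i (Finset.mem_insert_self i s)).add_dir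
      (ih (fun j hj => h j (Finset.mem_insert_of_mem hj))
        fun j hj => hp j (Finset.mem_insert_of_mem hj)) hg (hp i (Finset.mem_insert_self i s))
      (locallyIntegrable_finsetSum s fun j hj => hp j (Finset.mem_insert_of_mem hj))

/-- The distributional second derivative of `u` in the directions `a` and `b`, where `U` is the
weak derivative of `u`. -/
def hessianPairing {d : ℕ} {u : Rd d → ℝ} {U : Rd d → (Rd d →L[ℝ] ℝ)}
    (h : IsWeakFDeriv u U) (a b : Rd d) : testFunctions d →ₗ[ℝ] ℝ :=
  dirPairing (LocallyIntegrable.clm_apply_const h.2.1 b) a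

section

variable {d : ℕ} {u : Rd d → ℝ} {U : Rd d → (Rd d →L[ℝ] ℝ)}

theorem hessianPairing_apply (h : IsWeakFDeriv u U) (a b : Rd d) (ψ : testFunctions d) :
    hessianPairing h a b ψ = - ∫ x, fderiv ℝ (ψ : Rd d → ℝ) x a * U x b := rfl

/-- Integrating by parts once more puts both derivatives on the smooth test function, where they
commute. -/
theorem hessianPairing_comm (h : IsWeakFDeriv u U) (a b : Rd d) (ψ : testFunctions d) :
    hessianPairing h a b ψ = hessianPairing h b a ψ := by
  obtain ⟨ψ, h1, h2⟩ := ψ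
  have hφ : ∀ c : Rd d, ContDiff ℝ ∞ (fun x => fderiv ℝ ψ x c) := fun c =>
    (h1.fderiv_right (m := ∞) (by norm_num)).clm_apply contDiff_const
  have key : ∀ a b : Rd d, hessianPairing h a b ⟨ψ, h1, h2⟩ =
      ∫ x, fderiv ℝ (fderiv ℝ ψ) x b a * u x := fun a b => by
    have e := h.2.2 _ (hφ a) (h2.fderiv_apply ℝ a) b
    simp only [smul_eq_mul] at e
    rw [hessianPairing_apply, ← e]
    refine integral_congr_ae (ae_of_all _ fun x => ?_)
    have hd : DifferentiableAt ℝ (fderiv ℝ ψ) x :=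
      (h1.fderiv_right (m := ∞) (by norm_num)).differentiable (by norm_num) x
    have e2 := (hd.hasFDerivAt.clm_apply (hasFDerivAt_const a x)).fderiv
    simp only
    rw [e2]
    simp
  rw [key, key]
  refine integral_congr_ae (ae_of_all _ fun x => ?_)
  have hs : IsSymmSndFDerivAt ℝ ψ x := h1.contDiffAt.isSymmSndFDerivAt (by
    rw [minSmoothness_of_isRCLikeNormedField]
    exact WithTop.coe_le_coe.2 (le_top : (2 : ℕ∞) ≤ ⊤))
  simp only
  rw [hs.eq]

theorem hessianPairing_add_left (h : IsWeakFDeriv u U) (a a' b : Rd d) (ψ : testFunctions d) :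
    hessianPairing h (a + a') b ψ = hessianPairing h a b ψ + hessianPairing h a' b ψ := by
  simp only [hessianPairing_apply, map_add, add_mul]
  have hl := LocallyIntegrable.clm_apply_const h.2.1 b
  rw [integral_add (integrable_fderiv_test_mul ψ hl a) (integrable_fderiv_test_mul ψ hl a'),
    neg_add]

theorem hessianPairing_add_right (h : IsWeakFDeriv u U) (a b b' : Rd d) (ψ : testFunctions d) :
    hessianPairing h a (b + b') ψ = hessianPairing h a b ψ + hessianPairing h a b' ψ := by
  rw [hessianPairing_comm, hessianPairing_add_left, hessianPairing_comm h b,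
    hessianPairing_comm h b']

theorem hessianPairing_smul_smul (h : IsWeakFDeriv u U) (c : ℝ) (a b : Rd d)
    (ψ : testFunctions d) :
    hessianPairing h (c • a) (c • b) ψ = c ^ 2 * hessianPairing h a b ψ := by
  rw [hessianPairing_apply, hessianPairing_apply, mul_neg, ← integral_const_mul]
  congr 1
  refine integral_congr_ae (ae_of_all _ fun x => ?_)
  simp only [map_smul, smul_eq_mul]
  ring

/-- Polarisation with a base point: for a symmetric bilinear `B` with quadratic form `q`, `2B(a, b)
= q(p + a + b) - q(p + a) - q(p + b) + q(p)`. Only the four vertices of a parallelogram in `Q` are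
used. -/
theorem exists_hessianPairing_eq (h : IsWeakFDeriv u U) {Q : Set (Rd d)}
    (hS : ∀ z ∈ Q, ∃ q, MemLp q 2 ∧ IsWeakDirDeriv (fun x => U x z) z q) {p a b : Rd d}
    (hp : p ∈ Q) (hpa : p + a ∈ Q) (hpb : p + b ∈ Q) (hpab : p + (a + b) ∈ Q) :
    ∃ q : Rd d → ℝ, MemLp q 2 ∧
      ∀ ψ : testFunctions d, hessianPairing h a b ψ = ∫ x, (ψ : Rd d → ℝ) x * q x := by
  have hS' : ∀ z ∈ Q, ∃ q : Rd d → ℝ, MemLp q 2 ∧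
      ∀ ψ : testFunctions d, hessianPairing h z z ψ = ∫ x, (ψ : Rd d → ℝ) x * q x := by
    intro z hz
    obtain ⟨q, hq, e⟩ := hS z hz
    exact ⟨q, hq, (isWeakDirDeriv_iff _).1 e⟩
  obtain ⟨q₀, hq₀, f₀⟩ := hS' _ hp
  obtain ⟨q₁, hq₁, f₁⟩ := hS' _ hpa
  obtain ⟨q₂, hq₂, f₂⟩ := hS' _ hpb
  obtain ⟨q₃, hq₃, f₃⟩ := hS' _ hpab
  refine ⟨fun x => 2⁻¹ * (q₃ x - q₁ x - (q₂ x - q₀ x)),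
    ((hq₃.sub hq₁).sub (hq₂.sub hq₀)).const_mul _, fun ψ => ?_⟩
  have hi : ∀ {q : Rd d → ℝ}, MemLp q 2 → Integrable fun x => (ψ : Rd d → ℝ) x * q x :=
    fun hq => (memLp_testFunction ψ).integrable_mul hq
  have i1 : Integrable fun x => (ψ : Rd d → ℝ) x * q₃ x - (ψ : Rd d → ℝ) x * q₁ x :=
    (hi hq₃).sub (hi hq₁)
  have i2 : Integrable fun x => (ψ : Rd d → ℝ) x * q₂ x - (ψ : Rd d → ℝ) x * q₀ x :=
    (hi hq₂).sub (hi hq₀)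
  have hint : ∫ x, (ψ : Rd d → ℝ) x * (2⁻¹ * (q₃ x - q₁ x - (q₂ x - q₀ x))) =
      2⁻¹ * (hessianPairing h (p + (a + b)) (p + (a + b)) ψ -
        hessianPairing h (p + a) (p + a) ψ -
          (hessianPairing h (p + b) (p + b) ψ - hessianPairing h p p ψ)) := by
    rw [f₀, f₁, f₂, f₃, ← integral_sub (hi hq₃) (hi hq₁), ← integral_sub (hi hq₂) (hi hq₀),
      ← integral_sub i1 i2, ← integral_const_mul]
    refine integral_congr_ae (ae_of_all _ fun x => ?_)
    simp only
    ring
  rw [hint]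
  simp only [hessianPairing_add_left, hessianPairing_add_right]
  rw [hessianPairing_comm h b a]
  ring

/-- Basis vectors scaled by `δ / 2` span a parallelogram with a translate whose vertices lie in `Q`;
bilinearity then undoes the scaling. -/
theorem exists_isWeakDirDeriv_basisFun (h : IsWeakFDeriv u U) {Q : Set (Rd d)}
    (hQ : MeasurableSet Q) (hpos : 0 < volume Q)
    (hS : ∀ z ∈ Q, ∃ q, MemLp q 2 ∧ IsWeakDirDeriv (fun x => U x z) z q) (i j : Fin d) :
    ∃ q, MemLp q 2 ∧ IsWeakDirDeriv (fun x => U x (EuclideanSpace.basisFun (Fin d) ℝ j))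
      (EuclideanSpace.basisFun (Fin d) ℝ i) q := by
  obtain ⟨δ, hδ, hpar⟩ := exists_parallelogram_mem hQ hpos
  have hc : 0 < δ / 2 := half_pos hδ
  have hn : ∀ i, ‖(δ / 2) • EuclideanSpace.basisFun (Fin d) ℝ i‖ < δ := fun i => by
    rw [norm_smul, (EuclideanSpace.basisFun (Fin d) ℝ).norm_eq_one,
      Real.norm_of_nonneg hc.le]
    linarith
  obtain ⟨p, h0, h1, h2, h3⟩ := hpar _ _ (hn i) (hn j)
  obtain ⟨q, hq, hqe⟩ := exists_hessianPairing_eq h hS h0 h1 h2 h3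
  refine ⟨fun x => ((δ / 2) ^ 2)⁻¹ * q x, hq.const_mul _, (isWeakDirDeriv_iff
    (LocallyIntegrable.clm_apply_const h.2.1 _)).2 fun ψ => ?_⟩
  have e1 : ∫ x, (ψ : Rd d → ℝ) x * (((δ / 2) ^ 2)⁻¹ * q x) =
      ((δ / 2) ^ 2)⁻¹ * ∫ x, (ψ : Rd d → ℝ) x * q x := by
    rw [← integral_const_mul]
    refine integral_congr_ae (ae_of_all _ fun x => ?_)
    simp only
    ring
  rw [e1, ← hqe ψ, hessianPairing_smul_smul, ← mul_assoc, inv_mul_cancel₀ (by positivity),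
    one_mul]
  rfl

/-- The bilinear map with matrix `q` in the standard basis. -/
def bilinOfMatrix (q : Fin d → Fin d → ℝ) : Rd d →L[ℝ] (Rd d →L[ℝ] ℝ) :=
  ∑ i, ∑ j, q i j • (EuclideanSpace.proj (𝕜 := ℝ) i : Rd d →L[ℝ] ℝ).smulRight
    (EuclideanSpace.proj (𝕜 := ℝ) j : Rd d →L[ℝ] ℝ)

theorem bilinOfMatrix_apply_basisFun (q : Fin d → Fin d → ℝ) (v : Rd d) (j : Fin d) :
    bilinOfMatrix q v (EuclideanSpace.basisFun (Fin d) ℝ j) = ∑ i, v i * q i j := by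
  simp only [bilinOfMatrix, sum_apply, _root_.smul_apply, ContinuousLinearMap.smulRight_apply,
    EuclideanSpace.basisFun_apply, smul_eq_mul]
  refine Finset.sum_congr rfl fun i _ => ?_
  simp [mul_comm]

theorem memLp_sum_smul {F : Type*} [NormedAddCommGroup F] [NormedSpace ℝ F]
    {q : Fin d → Fin d → Rd d → ℝ} (hq : ∀ i j, MemLp (q i j) 2) (c : Fin d → Fin d → F) :
    MemLp (fun x => ∑ i, ∑ j, q i j x • c i j) 2 :=
  memLp_finsetSum _ fun i _ => memLp_finsetSum _ fun j _ =>
    (ContinuousLinearMap.toSpanSingleton ℝ (c i j)).comp_memLp' (hq i j)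

theorem memL2loc_sum_smul {F : Type*} [NormedAddCommGroup F] [NormedSpace ℝ F]
    {q : Fin d → Fin d → Rd d → ℝ} (hq : ∀ i j, MemLp (q i j) 2) (c : Fin d → Fin d → F) :
    MemL2loc (fun x => ∑ i, ∑ j, q i j x • c i j) := fun _ => (memLp_sum_smul hq c).restrict _

theorem locallyIntegrable_sum_smul {F : Type*} [NormedAddCommGroup F] [NormedSpace ℝ F]
    {q : Fin d → Fin d → Rd d → ℝ} (hq : ∀ i j, MemLp (q i j) 2) (c : Fin d → Fin d → F) :
    LocallyIntegrable (fun x => ∑ i, ∑ j, q i j x • c i j) :=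
  (memLp_sum_smul hq c).locallyIntegrable (by norm_num)

theorem isWeakFDeriv_bilinOfMatrix (hU : LocallyIntegrable U) {q : Fin d → Fin d → Rd d → ℝ}
    (hq : ∀ i j, MemLp (q i j) 2)
    (hqe : ∀ i j, IsWeakDirDeriv (fun x => U x (EuclideanSpace.basisFun (Fin d) ℝ j))
      (EuclideanSpace.basisFun (Fin d) ℝ i) (q i j)) :
    IsWeakFDeriv U fun x => bilinOfMatrix fun i j => q i j x := by
  have hU'l := locallyIntegrable_sum_smul hq fun i j =>
    (EuclideanSpace.proj (𝕜 := ℝ) i : Rd d →L[ℝ] ℝ).smulRight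
      (EuclideanSpace.proj (𝕜 := ℝ) j : Rd d →L[ℝ] ℝ)
  refine ⟨hU, hU'l, fun φ h1 h2 v => ?_⟩
  have hcs : HasCompactSupport (fun x => fderiv ℝ φ x v) := h2.fderiv_apply ℝ v
  have hcd : Continuous (fun x => fderiv ℝ φ x v) :=
    (h1.continuous_fderiv (by norm_num)).clm_apply continuous_const
  have i1 : Integrable (fun x => fderiv ℝ φ x v • U x) :=
    hU.integrable_smul_left_of_hasCompactSupport hcd hcs
  have i2 : Integrable (fun x => φ x • bilinOfMatrix (fun i j => q i j x) v) :=
    (LocallyIntegrable.clm_apply_const hU'l v).integrable_smul_left_of_hasCompactSupport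
      h1.continuous h2
  refine ContinuousLinearMap.ext_basisFun fun j => ?_
  have hql : ∀ i, LocallyIntegrable (q i j) := fun i =>
    (hq i j).locallyIntegrable (by norm_num)
  rw [_root_.neg_apply, ContinuousLinearMap.integral_apply i1,
    ContinuousLinearMap.integral_apply i2]
  simp only [_root_.smul_apply, smul_eq_mul, bilinOfMatrix_apply_basisFun]
  have hsum := IsWeakDirDeriv.sum_dir Finset.univ
    (g := fun x => U x (EuclideanSpace.basisFun (Fin d) ℝ j))
    (p := fun i x => v i * q i j x) (v := fun i => v i • EuclideanSpace.basisFun (Fin d) ℝ i)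
    (fun i _ => (hqe i j).smul (v i)) (LocallyIntegrable.clm_apply_const hU _)
    (fun i _ => (hql i).smul (v i))
  have hv : ∑ i, v i • EuclideanSpace.basisFun (Fin d) ℝ i = v := by
    simpa using (EuclideanSpace.basisFun (Fin d) ℝ).sum_repr v
  rw [hv] at hsum
  exact hsum φ h1 h2

/-- If the pure second derivatives in a set of directions of positive measure are in `L²`, then
the function has a Hessian in `L²`. -/
theorem exists_hessian (h : IsWeakFDeriv u U) {Q : Set (Rd d)} (hQ : MeasurableSet Q)
    (hpos : 0 < volume Q)
    (hS : ∀ z ∈ Q, ∃ q, MemLp q 2 ∧ IsWeakDirDeriv (fun x => U x z) z q) :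
    ∃ U', IsWeakFDeriv U U' ∧ MemL2loc U' := by
  choose q hq hqe using exists_isWeakDirDeriv_basisFun h hQ hpos hS
  exact ⟨_, isWeakFDeriv_bilinOfMatrix h.2.1 hq hqe, memL2loc_sum_smul hq _⟩

end

end

/-! ### Integration over directions and the two Γ-inequalities. -/

noncomputable section

theorem EReal.coe_ennreal_liminf (a : ℕ → ℝ≥0∞) :
    ((liminf a atTop : ℝ≥0∞) : EReal) = liminf (fun n => (a n : EReal)) atTop :=
  EReal.coe_ennreal_strictMono.monotone.map_liminf_of_continuousAt a
    continuous_coe_ennreal_ereal.continuousAt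

theorem EReal.coe_ennreal_limsup (a : ℕ → ℝ≥0∞) :
    ((limsup a atTop : ℝ≥0∞) : EReal) = limsup (fun n => (a n : EReal)) atTop :=
  EReal.coe_ennreal_strictMono.monotone.map_limsup_of_continuousAt a
    continuous_coe_ennreal_ereal.continuousAt

/-- The regularity of the even extension of the energy density. -/
theorem taylor_data_of_strongConvexOn {f : ℝ → ℝ} (hf : ContDiffOn ℝ 2 f (Ici 0)) (hf0 : f 0 = 0)
    (hf1 : derivWithin f (Ici 0) 0 = 0)
    (hf2 : ∃ α : ℝ, 0 < α ∧ StrongConvexOn (Ici 0) α f) :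
    Continuous (fun s => secondDeriv f |s|) ∧
      (∃ F' : ℝ → ℝ, (∀ s, HasDerivAt (fun s => f |s|) (F' s) s) ∧
        ∀ s, HasDerivAt F' (secondDeriv f |s|) s) ∧
      (∃ α : ℝ, 0 < α ∧ ∀ s, α ≤ secondDeriv f |s|) ∧ (∀ s, 0 ≤ f |s|) ∧
      ∀ m y, 0 ≤ taylorWeight (fun s => secondDeriv f |s|) m y := by
  obtain ⟨hφ, F', hF, hF', h0⟩ := hasDerivAt_comp_abs hf hf0 hf1
  obtain ⟨α, hα, hc⟩ := hf2
  have hαφ : ∀ s, α ≤ secondDeriv f |s| := fun s =>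
    le_secondDeriv_of_strongConvexOn hf hc (abs_nonneg s)
  have hA : ∀ m y, 0 ≤ taylorWeight (fun s => secondDeriv f |s|) m y := fun m y =>
    (half_pos hα).le.trans (le_taylorWeight hφ hαφ m y)
  refine ⟨hφ, ⟨F', hF, hF'⟩, ⟨α, hα, hαφ⟩, fun s => ?_, hA⟩
  have := eq_taylor_of_hasDerivAt hF hF' hφ 0 s
  rw [this, h0, abs_zero, hf0]
  simpa using mul_nonneg (sq_nonneg s) (hA 0 s)

/-- The complement of a measurable hull of the exceptional set carries all of `ρ dz`. Were it
Lebesgue null, `ρ dz` would vanish. -/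
theorem exists_measurableSet_of_ae_kernelMeasure {d : ℕ} {ρ : Rd d → ℝ} (hρ0 : ∀ z, 0 ≤ ρ z)
    (hρ : Integrable ρ) (hρ1 : ¬ (ρ =ᵐ[volume] 0)) {P : Rd d → Prop}
    (hP : ∀ᵐ z ∂(kernelMeasure ρ), P z) :
    ∃ Q : Set (Rd d), MeasurableSet Q ∧ 0 < volume Q ∧ ∀ z ∈ Q, P z := by
  refine ⟨(toMeasurable (kernelMeasure ρ) {z | ¬ P z})ᶜ, (measurableSet_toMeasurable _ _).compl,
    pos_iff_ne_zero.2 fun h => hρ1 ?_, fun z hz => ?_⟩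
  · have h1 : kernelMeasure ρ (toMeasurable (kernelMeasure ρ) {z | ¬ P z})ᶜ = 0 :=
      withDensity_absolutelyContinuous _ _ h
    have h2 : kernelMeasure ρ (toMeasurable (kernelMeasure ρ) {z | ¬ P z}) = 0 := by
      rw [measure_toMeasurable]; exact hP
    have h3 : kernelMeasure ρ = 0 := by
      rw [← Measure.measure_univ_eq_zero, ← union_compl_self]
      exact measure_union_null h2 h1
    have h4 := (withDensity_eq_zero_iff
      hρ.aestronglyMeasurable.aemeasurable.ennreal_ofReal).1 h3
    filter_upwards [h4] with z hz
    exact le_antisymm (ENNReal.ofReal_eq_zero.1 hz) (hρ0 z)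
  · by_contra h
    exact hz (subset_toMeasurable _ _ h)

theorem IsWeakDirDeriv.const_mul {d : ℕ} {g p : Rd d → ℝ} {v : Rd d} (h : IsWeakDirDeriv g v p)
    (c : ℝ) : IsWeakDirDeriv (fun x => c * g x) v (fun x => c * p x) := by
  intro ψ h1 h2
  simp only [mul_left_comm _ c]
  rw [integral_const_mul, integral_const_mul, h ψ h1 h2, mul_neg]

theorem TendstoH1loc.tendsto_lintegral_apply {d : ℕ} {U : ℕ → Rd d → ℝ} {u : Rd d → ℝ}
    (h : TendstoH1loc U u) {G : ℕ → Rd d → (Rd d →L[ℝ] ℝ)} {g : Rd d → (Rd d →L[ℝ] ℝ)}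
    (hG : ∀ n, weakFDeriv (U n) =ᵐ[volume] G n) (hg : weakFDeriv u =ᵐ[volume] g) {w : Rd d}
    (hw : ‖w‖ ≤ 1) (R : ℝ) :
    Tendsto (fun n => ∫⁻ x in Metric.ball 0 R, ‖G n x w - g x w‖ₑ ^ 2) atTop (𝓝 0) := by
  refine tendsto_of_tendsto_of_tendsto_of_le_of_le tendsto_const_nhds
    (tendsto_eLpNorm_two_iff.1 (h R).2) (fun _ => zero_le) fun n => ?_
  refine lintegral_mono_ae (ae_restrict_of_ae ?_)
  filter_upwards [hG n, hg] with x h1 h2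
  rw [Pi.sub_apply, h1, h2, ← _root_.sub_apply]
  gcongr
  rw [enorm_le_iff_norm_le]
  exact ((G n x - g x).le_opNorm w).trans (mul_le_of_le_one_right (norm_nonneg _) hw)

theorem MemH1loc.exists_measurable {d : ℕ} {u : Rd d → ℝ} (hu : MemH1loc u) :
    ∃ g : Rd d → (Rd d →L[ℝ] ℝ), Measurable g ∧ weakFDeriv u =ᵐ[volume] g ∧
      IsWeakFDeriv u g ∧ MemL2loc g := by
  obtain ⟨hw, h2⟩ := hu.memL2loc_weakFDeriv
  have hm := hw.2.1.aestronglyMeasurable.aemeasurable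
  exact ⟨hm.mk _, hm.measurable_mk, hm.ae_eq_mk, hw.congr_ae (ae_eq_refl _) hm.ae_eq_mk,
    h2.congr_ae hm.ae_eq_mk⟩

theorem MemH2loc.exists_measurable {d : ℕ} {u : Rd d → ℝ} (hu : MemH2loc u)
    {g : Rd d → (Rd d →L[ℝ] ℝ)} (hg : weakFDeriv u =ᵐ[volume] g) :
    ∃ H : Rd d → (Rd d →L[ℝ] (Rd d →L[ℝ] ℝ)), Measurable H ∧
      weakFDeriv (weakFDeriv u) =ᵐ[volume] H ∧ IsWeakFDeriv g H := by
  have hw := hu.2.memL2loc_weakFDeriv.1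
  have hm := hw.2.1.aestronglyMeasurable.aemeasurable
  exact ⟨hm.mk _, hm.measurable_mk, hm.ae_eq_mk, hw.congr_ae hg hm.ae_eq_mk⟩

theorem memH2loc_of_ae_kernelMeasure {d : ℕ} {ρ : Rd d → ℝ} (hρ0 : ∀ z, 0 ≤ ρ z)
    (hρ : Integrable ρ) (hρ1 : ¬ (ρ =ᵐ[volume] 0)) {u : Rd d → ℝ} (hu : MemH1loc u)
    {g : Rd d → (Rd d →L[ℝ] ℝ)} (hg : weakFDeriv u =ᵐ[volume] g)
    (h : ∀ᵐ z ∂(kernelMeasure ρ), ∃ p, MemLp p 2 ∧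
      IsWeakDirDeriv (fun x => g x (unitDir z)) z p) : MemH2loc u := by
  obtain ⟨Q, hQ, hpos, hS⟩ := exists_measurableSet_of_ae_kernelMeasure hρ0 hρ hρ1 h
  obtain ⟨hw, h2⟩ := hu.memL2loc_weakFDeriv
  refine ⟨hu, h2, exists_hessian hw hQ hpos fun z hz => ?_⟩
  obtain ⟨p, hp, hpd⟩ := hS z hz
  refine ⟨_, hp.const_mul ‖z‖, (hpd.const_mul ‖z‖).congr_ae ?_ (ae_eq_refl _)⟩
  filter_upwards [hg] with x hx
  rw [hx, ← smul_eq_mul, ← map_smul, norm_smul_unitDir]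

section

variable {d : ℕ} {ρ : Rd d → ℝ} {f : ℝ → ℝ}

theorem gammaLowerLimit_rateEnergy (hρ0 : ∀ z, 0 ≤ ρ z) (hρ : Integrable ρ)
    (hρ1 : ¬ (ρ =ᵐ[volume] 0)) (hf : ContDiffOn ℝ 2 f (Ici 0)) (hf0 : f 0 = 0)
    (hf1 : derivWithin f (Ici 0) 0 = 0)
    (hf2 : ∃ α : ℝ, 0 < α ∧ StrongConvexOn (Ici 0) α f) :
    GammaLowerLimit TendstoH1loc (rateDomain ρ f) (rateEnergy ρ f) (limitEnergy ρ f) := by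
  intro u hu ε hε hε0 ξ hξ hconv
  obtain ⟨hφ, ⟨F', hF, hF'⟩, ⟨α, hα, hαφ⟩, hp, hA⟩ := taylor_data_of_strongConvexOn hf hf0 hf1 hf2
  obtain ⟨g, hgm, hg, hgw, hgL⟩ := hu.1.exists_measurable
  choose G hGm hG hGw hGL using fun n => (hξ n).1.exists_measurable
  simp only [fun n => rateEnergy_eq hρ0 hρ hF hF' hφ hp hA (hξ n) (hGm n) (hG n) (hε n)]
  rw [← EReal.coe_ennreal_liminf]
  set φ : ℝ → ℝ := fun s => secondDeriv f |s| with hφd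
  set b : ℕ → Rd d → ℝ≥0∞ := fun n z => segGap φ (fun x => G n x (unitDir z)) (ε n • z) /
    ENNReal.ofReal (ε n ^ 2) with hb
  have hbm : ∀ n, Measurable (b n) := fun n =>
    (measurable_segGap_unitDir hφ (hGm n) (ε n)).div_const _
  -- Fatou serves twice: a finite total liminf makes the liminf finite for almost every `z`, and the
  -- directional bounds integrate to the full one.
  have hfatou := lintegral_liminf_le (μ := kernelMeasure ρ) (u := atTop) hbm
  rcases eq_or_ne (liminf (fun n => ∫⁻ z, b n z ∂(kernelMeasure ρ)) atTop) ⊤ with ht | ht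
  · rw [ht]; exact le_top
  have hae : ∀ᵐ z ∂(kernelMeasure ρ), ∃ p : Rd d → ℝ, MemLp p 2 ∧
      IsWeakDirDeriv (fun x => g x (unitDir z)) z p ∧
      ∫⁻ x, ENNReal.ofReal (1 / 24 * (φ (g x (unitDir z)) * p x ^ 2)) ≤
        liminf (fun n => b n z) atTop := by
    filter_upwards [ae_lt_top (.liminf hbm) (ne_top_of_le_ne_top ht hfatou)] with z hz
    obtain ⟨p, -, h1, h2, h3⟩ := exists_isWeakDirDeriv_of_liminf_segGap hφ hα hαφ
      (measurable_clm_apply hgm measurable_const)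
      (fun n => measurable_clm_apply (hGm n) measurable_const)
      (lintegral_sq_apply_lt_top hgL (unitDir z))
      (fun n => LocallyIntegrable.clm_apply_const (hGw n).2.1 (unitDir z))
      (hconv.tendsto_lintegral_apply hG hg (norm_unitDir_le z)) hε hε0 z hz
    exact ⟨p, h1, h2, h3⟩
  have hu2 : MemH2loc u := memH2loc_of_ae_kernelMeasure hρ0 hρ hρ1 hu.1 hg
    (hae.mono fun z ⟨p, h1, h2, _⟩ => ⟨p, h1, h2⟩)
  obtain ⟨H, hHm, hH, hHw⟩ := hu2.exists_measurable hg
  rw [limitEnergy_eq hρ0 hρ hφ hu2 hgm hg hHm hH, EReal.coe_ennreal_le_coe_ennreal_iff]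
  refine le_trans (lintegral_mono_ae ?_) hfatou
  filter_upwards [hae] with z ⟨p, h1, h2, h3⟩
  refine le_trans (le_of_eq (lintegral_congr_ae ?_)) h3
  have hl : LocallyIntegrable fun x => H x z (unitDir z) :=
    LocallyIntegrable.clm_apply_const (LocallyIntegrable.clm_apply_const hHw.2.1 z) (unitDir z)
  -- Uniqueness of weak derivatives identifies the `L²` function found for this `z` with the
  -- corresponding entry of the Hessian.
  filter_upwards [h2.ae_eq (hHw.isWeakDirDeriv_apply z (unitDir z))
    (h1.locallyIntegrable (by norm_num)) hl] with x hx
  rw [hx]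

theorem abs_segAvg_le {g : Rd d → ℝ} {L : ℝ} (h : ∀ x, |g x| ≤ L) (v x : Rd d) :
    |segAvg g v x| ≤ L := by
  have := norm_integral_le_of_norm_le_const (μ := unitMeasure)
    (f := fun s : ℝ => g (x + s • v)) (ae_of_all _ fun s => h _)
  simpa [segAvg] using this

/-- If `f''` or the gradient of `u` is bounded, then the Taylor weights along segments are
bounded, for a suitable representative of the gradient. -/
theorem MemH1loc.exists_taylorWeight_le (hφ : Continuous fun s => secondDeriv f |s|)
    {u : Rd d → ℝ} (hu : MemH1loc u)
    (hb : BddAbove (secondDeriv f '' Ici 0) ∨ ∃ L : ℝ, ∀ᵐ x, ‖weakFDeriv u x‖ ≤ L) :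
    ∃ g : Rd d → (Rd d →L[ℝ] ℝ), Measurable g ∧ weakFDeriv u =ᵐ[volume] g ∧
      ∃ M : ℝ, ∀ w : Rd d, ‖w‖ ≤ 1 → ∀ (x v : Rd d) (s : ℝ),
        taylorWeight (fun s => secondDeriv f |s|) (segAvg (fun x => g x w) v x)
          (g (x + s • v) w) ≤ M := by
  obtain ⟨g, hgm, hg, -, -⟩ := hu.exists_measurable
  rcases hb with ⟨M, hM⟩ | ⟨L, hL⟩
  · exact ⟨g, hgm, hg, M / 2, fun w _ x v s => taylorWeight_le hφ convex_univ
      (fun t _ => hM ⟨|t|, abs_nonneg t, rfl⟩) (mem_univ _) (mem_univ _)⟩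
  · have hK : IsCompact (Icc (-|L|) |L|) := isCompact_Icc
    obtain ⟨M, hM⟩ := (hK.image hφ).bddAbove
    -- The weights must be bounded at every point, not almost every one, so the gradient is set to 0
    -- on the null set where it exceeds the bound.
    set S : Set (Rd d) := {x | ‖g x‖ ≤ |L|} with hS
    have hSm : MeasurableSet S := measurableSet_le hgm.norm measurable_const
    have hbd : ∀ x, ‖S.indicator g x‖ ≤ |L| := fun x => by
      by_cases hx : x ∈ S
      · rw [indicator_of_mem hx]; exact hx
      · rw [indicator_of_notMem hx, norm_zero]; exact abs_nonneg L
    have hbw : ∀ w : Rd d, ‖w‖ ≤ 1 → ∀ x, |S.indicator g x w| ≤ |L| := fun w hw x =>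
      ((S.indicator g x).le_opNorm w).trans
        ((mul_le_of_le_one_right (norm_nonneg _) hw).trans (hbd x))
    refine ⟨S.indicator g, hgm.indicator hSm, ?_, M / 2, fun w hw x v s =>
      taylorWeight_le hφ (convex_Icc (-|L|) |L|) (fun t ht => hM (mem_image_of_mem _ ht))
        (abs_le.1 (abs_segAvg_le (hbw w hw) v x)) (abs_le.1 (hbw w hw _))⟩
    filter_upwards [hg, hL] with x h1 h2
    rw [indicator_of_mem, h1]
    rw [hS, Set.mem_ofPred_eq, ← h1]
    exact h2.trans (le_abs_self L)

theorem enorm_sq_le_ofReal_mul {α t q : ℝ} (hα : 0 < α) (h : α ≤ t) :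
    ‖q‖ₑ ^ 2 ≤ ENNReal.ofReal (24 / α) * ENNReal.ofReal (1 / 24 * (t * q ^ 2)) := by
  rw [enorm_sq_eq_ofReal, ← ENNReal.ofReal_mul (by positivity)]
  refine ENNReal.ofReal_le_ofReal ?_
  calc q ^ 2 = 24 / α * (1 / 24 * (α * q ^ 2)) := by field_simp
    _ ≤ 24 / α * (1 / 24 * (t * q ^ 2)) := by gcongr

theorem tendstoH1loc_const (u : Rd d → ℝ) : TendstoH1loc (fun _ => u) u := fun _ =>
  ⟨tendsto_eLpNorm_two_iff.2 (by simp), tendsto_eLpNorm_two_iff.2 (by simp)⟩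

theorem limsup_rateEnergy_le (hρ0 : ∀ z, 0 ≤ ρ z) (hρ : Integrable ρ)
    (hf : ContDiffOn ℝ 2 f (Ici 0)) (hf0 : f 0 = 0) (hf1 : derivWithin f (Ici 0) 0 = 0)
    (hf2 : ∃ α : ℝ, 0 < α ∧ StrongConvexOn (Ici 0) α f) {u : Rd d → ℝ}
    (hu : u ∈ rateDomain ρ f)
    (hbd : BddAbove (secondDeriv f '' Ici 0) ∨ ∃ L : ℝ, ∀ᵐ x, ‖weakFDeriv u x‖ ≤ L)
    {ε : ℕ → ℝ} (hε : ∀ n, 0 < ε n) (hε0 : Tendsto ε atTop (𝓝 0)) :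
    limsup (fun n => rateEnergy ρ f (ε n) u) atTop ≤ limitEnergy ρ f u := by
  obtain ⟨hφ, ⟨F', hF, hF'⟩, ⟨α, hα, hαφ⟩, hp, hA⟩ := taylor_data_of_strongConvexOn hf hf0 hf1 hf2
  obtain ⟨g, hgm, hg, M, hM⟩ := hu.1.exists_taylorWeight_le hφ hbd
  by_cases hu2 : MemH2loc u
  swap
  · rw [limitEnergy, if_neg hu2]; exact le_top
  have hgL : MemL2loc g := hu2.2.1.congr_ae hg
  obtain ⟨H, hHm, hH, hHw⟩ := hu2.exists_measurable hg
  simp only [fun n => rateEnergy_eq hρ0 hρ hF hF' hφ hp hA hu hgm hg (hε n)]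
  rw [limitEnergy_eq hρ0 hρ hφ hu2 hgm hg hHm hH, ← EReal.coe_ennreal_limsup,
    EReal.coe_ennreal_le_coe_ennreal_iff]
  have := isFiniteMeasure_kernelMeasure hρ
  set φ : ℝ → ℝ := fun s => secondDeriv f |s| with hφd
  set D : Rd d → ℝ≥0∞ := fun z => ∫⁻ x, ENNReal.ofReal (1 / 24 *
    (φ (g x (unitDir z)) * H x z (unitDir z) ^ 2)) with hD
  have hDm : Measurable D := (measurable_limitDensity hφ hgm hHm).lintegral_prod_left'
  change _ ≤ ∫⁻ z, D z ∂(kernelMeasure ρ)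
  rcases eq_or_ne (∫⁻ z, D z ∂(kernelMeasure ρ)) ⊤ with ht | ht
  · rw [ht]; exact le_top
  have hgz : ∀ z, Measurable fun x => g x (unitDir z) := fun z =>
    measurable_clm_apply hgm measurable_const
  have hgl : ∀ z, LocallyIntegrable fun x => g x (unitDir z) := fun z =>
    LocallyIntegrable.clm_apply_const hHw.1 (unitDir z)
  have hpm : ∀ z, Measurable fun x => H x z (unitDir z) := fun z => by
    have h2 : Measurable fun x : Rd d => H x z :=
      (ContinuousLinearMap.apply ℝ (Rd d →L[ℝ] ℝ) z).continuous.measurable.comp hHm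
    exact measurable_clm_apply h2 measurable_const
  have hpl : ∀ z, LocallyIntegrable fun x => H x z (unitDir z) := fun z =>
    LocallyIntegrable.clm_apply_const (LocallyIntegrable.clm_apply_const hHw.2.1 z) (unitDir z)
  have hpD : ∀ z, ∫⁻ x, ‖H x z (unitDir z)‖ₑ ^ 2 ≤ ENNReal.ofReal (24 / α) * D z := fun z => by
    rw [hD, ← lintegral_const_mul' _ _ ENNReal.ofReal_ne_top]
    exact lintegral_mono fun x => enorm_sq_le_ofReal_mul hα (hαφ _)
  -- The factor `4M` comes from `segGap_div_le`, and `24 / α` bounds `∫ p²` by the limit density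
  -- through `φ ≥ α`. The limit density itself is thus the majorant for reverse Fatou, and no moment
  -- of `ρ` is needed.
  set C : ℝ≥0∞ := ENNReal.ofReal M * (4 * ENNReal.ofReal (24 / α)) with hC
  have hCt : C ≠ ⊤ := by finiteness
  have hfatou := limsup_lintegral_le (μ := kernelMeasure ρ) (f := fun n z =>
    segGap φ (fun x => g x (unitDir z)) (ε n • z) / ENNReal.ofReal (ε n ^ 2))
    (fun z => C * D z) (fun n => (measurable_segGap_unitDir hφ hgm (ε n)).div_const _)
    (fun n => ae_of_all _ fun z => by
      refine (segGap_div_le hφ (hHw.isWeakDirDeriv_apply z (unitDir z)) (hgz z) (hgl z) (hpm z)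
        (hpl z) (hM _ (norm_unitDir_le z)) (ε n)).trans ?_
      simp only [hC, mul_assoc]
      gcongr
      exact hpD z)
    (by rw [lintegral_const_mul' _ _ hCt]; exact ENNReal.mul_ne_top hCt ht)
  refine hfatou.trans (lintegral_mono_ae ?_)
  filter_upwards [ae_lt_top hDm ht] with z hz
  have hpL : MemLp (fun x => H x z (unitDir z)) 2 :=
    (memLp_two_iff (hpm z).aestronglyMeasurable).2
      ((hpD z).trans_lt (ENNReal.mul_lt_top ENNReal.ofReal_lt_top hz))
  exact limsup_segGap_le hφ hα hαφ (hHw.isWeakDirDeriv_apply z (unitDir z)) (hgz z)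
    (lintegral_sq_apply_lt_top hgL _) (hpm z) hpL (hM _ (norm_unitDir_le z)) hε hε0

end

end

theorem mainTheorem1 (d : ℕ) (hd : 1 ≤ d)
    (ρ : Rd d → ℝ) (hρ_nonneg : ∀ z, 0 ≤ ρ z) (hρ_int : Integrable ρ)
    (hρ_ne : ¬ (ρ =ᵐ[volume] 0))
    (f : ℝ → ℝ) (hf_smooth : ContDiffOn ℝ 2 f (Ici 0))
    (hf_zero : f 0 = 0) (hf_deriv : derivWithin f (Ici 0) 0 = 0)
    (hf_convex : ∃ α : ℝ, 0 < α ∧ StrongConvexOn (Ici 0) α f) :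
    GammaLowerLimit TendstoH1loc (rateDomain ρ f) (rateEnergy ρ f) (limitEnergy ρ f) ∧
    ∀ Y : Set (Rd d → ℝ), Y ⊆ rateDomain ρ f →
      (BddAbove (secondDeriv f '' Ici 0) ∨
        ∀ u ∈ Y, ∃ L : ℝ, ∀ᵐ x, ‖weakFDeriv u x‖ ≤ L) →
      GammaConverges TendstoH1loc Y (rateEnergy ρ f) (limitEnergy ρ f) := by
  have hlow := gammaLowerLimit_rateEnergy hρ_nonneg hρ_int hρ_ne hf_smooth hf_zero hf_deriv
    hf_convex
  refine ⟨hlow, fun Y hY hb => ⟨fun u hu ε hε hε0 ξ hξ hconv =>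
    hlow u (hY hu) ε hε hε0 ξ (fun n => hY (hξ n)) hconv, fun u hu ε hε hε0 =>
    -- The constant recovery sequence never leaves `Y`, which is why an arbitrary subset of the
    -- domain is allowed.
    ⟨fun _ => u, fun _ => hu, tendstoH1loc_const u, ?_⟩⟩⟩
  exact limsup_rateEnergy_le hρ_nonneg hρ_int hf_smooth hf_zero hf_deriv hf_convex (hY hu)
    (hb.imp_right fun h => h u hu) hε hε0
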